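/- All graphs are finite and simple. For distinct vertices $x,y$ of a graph $G$, let $\kappa(x,y)$ be the maximum number of pairwise internally vertex-disjoint paths between $x$ and $y$. The graph $G$ is $3$-connected if it has at least two vertices and $\kappa(x,y)\ge 3$ for all distinct $x,y\in V(G)$; it has maximal local connectivity $3$ if $\kappa(x,y)\le 3$ for all distinct $x,y\in V(G)$. An odd wheel is a graph obtained from a cycle of odd length (at least $3$) by adding a vertex that is adjacent to every vertex of the cycle. **Theorem.** Let $G$ be a $3$-connected graph with maximal local connectivity $3$. Then $G$ is $3$-colourable if and only if $G$ is not an odd wheel. Moreover, there is a polynomial-time algorithm that, given a $3$-connected graph $G$ with maximal local connectivity $3$, finds an optimal colouring of $G$, that is, a proper colouring of $G$ with colours in $\{1,\dots,\chi(G)\}$. (Polynomial time: one program for a random access machine with unit-cost addition, truncated subtraction, comparison and array access on natural numbers, which is given the adjacency matrix of a graph $G$ of this class on the vertices $0,\dots,n-1$, and which halts after at most $p(n)$ steps, for a fixed polynomial $p$.) -/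

import Mathlib

namespace SimpleGraph

variable {V : Type*}

/-- A set of `x`-`y` paths is internally disjoint if two different members have no vertex in common
apart from the ends `x` and `y`. -/
def InternallyDisjoint (G : SimpleGraph V) {x y : V} (S : Set (G.Path x y)) : Prop :=
  ∀ p ∈ S, ∀ q ∈ S, p ≠ q →
    ∀ v, v ∈ (p : G.Walk x y).support → v ∈ (q : G.Walk x y).support → v = x ∨ v = y

/-- The local connectivity `κ(x, y)` of two distinct vertices: the maximum number of (different)
internally disjoint `x`-`y` paths. -/
noncomputable def localConnectivity (G : SimpleGraph V) (x y : V) : ℕ∞ :=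
  ⨆ S : {S : Set (G.Path x y) // G.InternallyDisjoint S}, (S : Set (G.Path x y)).encard

/-- `G` is `k`-connected: it has at least two vertices, and `κ(x, y) ≥ k` for all distinct
`x` and `y`. -/
def IsKConnected (G : SimpleGraph V) (k : ℕ) : Prop :=
  Nontrivial V ∧ ∀ x y : V, x ≠ y → (k : ℕ∞) ≤ G.localConnectivity x y

/-- `G` has maximal local connectivity `k`: `κ(x, y) ≤ k` for all distinct `x` and `y`. -/
def HasMaximalLocalConnectivity (G : SimpleGraph V) (k : ℕ) : Prop :=
  ∀ x y : V, x ≠ y → G.localConnectivity x y ≤ (k : ℕ∞)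

/-- `G` is an odd wheel: it consists of a cycle of odd length and one further vertex, the hub,
that is adjacent to every vertex of the cycle. -/
def IsOddWheel (G : SimpleGraph V) : Prop :=
  ∃ n : ℕ, 3 ≤ n ∧ Odd n ∧ ∃ hub : V,
    Nonempty (G.induce {v : V | v ≠ hub} ≃g cycleGraph n) ∧ ∀ v : V, v ≠ hub → G.Adj hub v

/-- `φ` is an optimal colouring of `G`: a proper colouring with colours in `{1, …, χ(G)}`. -/
def IsOptimalColouring (G : SimpleGraph V) (φ : V → ℕ) : Prop :=
  (∀ u v : V, G.Adj u v → φ u ≠ φ v) ∧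
    ∀ v : V, 1 ≤ φ v ∧ (φ v : ℕ∞) ≤ G.chromaticNumber

end SimpleGraph

/-! A random access machine, programmed by structured programs. The memory consists of
registers and of arrays, which hold natural numbers. One time unit is charged for each constant, register access, array
access, arithmetic operation, comparison, assignment and test. There is no
multiplication, so that in `t` steps a number grows by at most `O(t)` bits and polynomial time
is the same as polynomial time on a Turing machine. -/

namespace RAM

/-- Expressions over the memory. The names of registers and arrays are fixed in the program. -/
inductive Expr : Type
  | const (c : ℕ)
  | reg (x : ℕ)
  | read (a : ℕ) (i : Expr)
  | add (e f : Expr)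
  | sub (e f : Expr)
  | lt (e f : Expr)
  | eq (e f : Expr)

/-- Programs. The tests of `ite` and `loop` succeed if the expression is not zero. -/
inductive Prog : Type
  | skip
  | set (x : ℕ) (e : Expr)
  | write (a : ℕ) (i e : Expr)
  | seq (P Q : Prog)
  | ite (e : Expr) (P Q : Prog)
  | loop (e : Expr) (P : Prog)

/-- A memory state: the contents of the registers and of the cells of the arrays. -/
structure State : Type where
  reg : ℕ → ℕ
  arr : ℕ → ℕ → ℕ

/-- The value of an expression. Subtraction is truncated at zero; a comparison yields
`1` if it holds and `0` otherwise. -/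
def Expr.eval (σ : State) : Expr → ℕ
  | .const c => c
  | .reg x => σ.reg x
  | .read a i => σ.arr a (i.eval σ)
  | .add e f => e.eval σ + f.eval σ
  | .sub e f => e.eval σ - f.eval σ
  | .lt e f => if e.eval σ < f.eval σ then 1 else 0
  | .eq e f => if e.eval σ = f.eval σ then 1 else 0

/-- The time for the evaluation of an expression. -/
def Expr.cost : Expr → ℕ
  | .const _ => 1
  | .reg _ => 1
  | .read _ i => i.cost + 1
  | .add e f => e.cost + f.cost + 1
  | .sub e f => e.cost + f.cost + 1
  | .lt e f => e.cost + f.cost + 1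
  | .eq e f => e.cost + f.cost + 1

/-- The state after `v` has been stored in register `x`. -/
def State.setReg (σ : State) (x v : ℕ) : State where
  reg := fun y => if y = x then v else σ.reg y
  arr := σ.arr

/-- The state after `v` has been stored in cell `i` of array `a`. -/
def State.setArr (σ : State) (a i v : ℕ) : State where
  reg := σ.reg
  arr := fun b j => if b = a ∧ j = i then v else σ.arr b j

/-- `Runs P σ t τ`: started in the state `σ`, the program `P` halts after exactly `t` steps,
in the state `τ`. -/
inductive Runs : Prog → State → ℕ → State → Prop
  | skip (σ : State) : Runs .skip σ 1 σ
  | set (σ : State) (x : ℕ) (e : Expr) :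
      Runs (.set x e) σ (e.cost + 1) (σ.setReg x (e.eval σ))
  | write (σ : State) (a : ℕ) (i e : Expr) :
      Runs (.write a i e) σ (i.cost + e.cost + 1) (σ.setArr a (i.eval σ) (e.eval σ))
  | seq {P Q : Prog} {σ τ ρ : State} {s t : ℕ} :
      Runs P σ s τ → Runs Q τ t ρ → Runs (.seq P Q) σ (s + t) ρ
  | ite_true {e : Expr} {P Q : Prog} {σ τ : State} {t : ℕ} :
      e.eval σ ≠ 0 → Runs P σ t τ → Runs (.ite e P Q) σ (e.cost + 1 + t) τ
  | ite_false {e : Expr} {P Q : Prog} {σ τ : State} {t : ℕ} :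
      e.eval σ = 0 → Runs Q σ t τ → Runs (.ite e P Q) σ (e.cost + 1 + t) τ
  | loop_true {e : Expr} {P : Prog} {σ τ ρ : State} {s t : ℕ} :
      e.eval σ ≠ 0 → Runs P σ s τ → Runs (.loop e P) τ t ρ →
        Runs (.loop e P) σ (e.cost + 1 + s + t) ρ
  | loop_false {e : Expr} {P : Prog} {σ : State} :
      e.eval σ = 0 → Runs (.loop e P) σ (e.cost + 1) σ

open Classical in
/-- The initial state for an input graph with vertices `0, …, n - 1`: register `0` holds `n`,
array `0` holds the adjacency matrix row by row, and everything else is zero. -/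
noncomputable def input {n : ℕ} (G : SimpleGraph (Fin n)) : State where
  reg := fun x => if x = 0 then n else 0
  arr := fun a k =>
    if a = 0 ∧ ∃ i j : Fin n, k = (i : ℕ) * n + (j : ℕ) ∧ G.Adj i j then 1 else 0

/-- The vertex labelling that a final state represents: the label of `v` is in cell `v` of
array `1`. -/
def output (n : ℕ) (τ : State) : Fin n → ℕ := fun v => τ.arr 1 v

/-- The program `P` finds, for every graph `G` of the class `C`, an optimal colouring of `G`, in a
number of steps that is bounded by a polynomial in the number of vertices. -/
def FindsOptimalColouringInPolyTime (P : Prog)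
    (C : ∀ n : ℕ, SimpleGraph (Fin n) → Prop) : Prop :=
  ∃ p : Polynomial ℕ, ∀ (n : ℕ) (G : SimpleGraph (Fin n)), C n G →
    ∃ (t : ℕ) (τ : State), Runs P (input G) t τ ∧ t ≤ p.eval n ∧
      G.IsOptimalColouring (output n τ)

end RAM

/-!
Menger's theorem turns the hypotheses into statements about separations: `G` has no separator of
fewer than three vertices, and any two vertices are separated by three vertices, or by the edge
between them and two vertices. An uncrossing argument replaces these separators by edges: any two
vertices are separated by at most three edges (`SimpleGraph.exists_cut_of_separation`). The proof
works with this structure only; it is called `Tight`, and it is inherited by the torsos of a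
matching cut, in which one side of a cut of three disjoint edges is replaced by a triangle
(`IsMatchingCut.tight_split`).

*At most one vertex `h` has degree more than three, and `h` is not dominating.* There are two
nonadjacent vertices `h`, `z` with a common neighbour `t`, and the graph without `h` and `z` is
connected. Colour `h` and `z` alike and the other vertices greedily towards `t`. Each of them has
an uncoloured neighbour when its turn comes, except `t`, which has two neighbours of the same
colour; so three colours suffice (`RAM.PartialCol.update`).

*At least two vertices have degree more than three.* Edge cuts are submodular, hence a minimal set
that contains such a vertex, misses another one, and is left by only three edges contains exactly
one such vertex; and these three edges form a matching cut (`Tight.exists_leaf`). The torso of this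
side is coloured as before, the other torso by induction. The ends of the cut edges in a torso do
not all have the same colour, because they are joined to the vertices of a triangle; therefore some
permutation of the colours on one side makes the two colourings compatible (`exists_perm`,
`IsMatchingCut.isCol_glue`).

*Some vertex is dominating.* All other vertices have degree three then, so the graph is a wheel
(`Tight.exists_cycle`), which is `3`-colourable unless it is an odd wheel.

All choices in this argument are made among polynomially many possibilities, so that the algorithm
can try them all. It is written in the language `RAM.Cmd`, whose only loops run over `0, …, n - 1`,
so that its running time is bounded by a polynomial that is computed from the program text
(`RAM.Cmd.runs_compile`). Every round of the algorithm peels off the whole graph, or one side of a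
matching cut, and records its colouring; after at most `n` rounds the graph is used up, and the
recorded colourings are put together in the reverse order (`RAM.exec_levels`, `RAM.exec_unwind`).
As every colouring is checked before it is accepted, the passes that produce them need to be
analysed for the successful choices only. Colourings with two colours, and wheels, are dealt with
beforehand (`RAM.exec_main`).
-/

/-! ### Menger's theorem -/

namespace Menger

variable {V : Type*}

/-- `S` separates `A` from `B` in the digraph with arc set `E`. The separation is witnessed by a set
`R` that contains `A \ S`, misses `B` and `S`, and that no arc leaves except into `S`. -/
def Separates (E : Finset (V × V)) (A B S : Finset V) : Prop :=
  ∃ R : Set V, (∀ a ∈ A, a ∈ R ∨ a ∈ S) ∧ (∀ b ∈ B, b ∉ R) ∧ (∀ s ∈ S, s ∉ R) ∧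
    ∀ a b, (a, b) ∈ E → a ∈ R → b ∈ R ∨ b ∈ S

/-- A linkage of `k` disjoint paths from `A` to `B`: the path that starts in `a ∈ I` has
the vertex sequence `a :: L a`. -/
def Linked (E : Finset (V × V)) (A B : Finset V) (k : ℕ) : Prop :=
  ∃ (I : Finset V) (L : V → List V), I ⊆ A ∧ I.card = k ∧
    (∀ a ∈ I, List.IsChain (fun u v => (u, v) ∈ E) (a :: L a) ∧ (a :: L a).Nodup ∧
      (a :: L a).getLast (List.cons_ne_nil _ _) ∈ B) ∧
    ∀ a ∈ I, ∀ b ∈ I, a ≠ b → List.Disjoint (a :: L a) (b :: L b)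

/-- A path that starts in `R ∪ S` and meets `S` at most in its last vertex stays in `R ∪ S`. -/
theorem mem_or_mem_of_chain {E : Finset (V × V)} {R : Set V} {S : Finset V}
    (hR : ∀ a b, (a, b) ∈ E → a ∈ R → b ∈ R ∨ b ∈ S) (l : List V) :
    ∀ a, List.IsChain (fun u v => (u, v) ∈ E) (a :: l) → (a :: l).Nodup →
      (a ∈ R ∨ a ∈ S) →
      (∀ x ∈ a :: l, x ∈ S → x = (a :: l).getLast (List.cons_ne_nil _ _)) →
      ∀ x ∈ a :: l, x ∈ R ∨ x ∈ S := by
  induction l with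
  | nil => intro a _ _ ha _ x hx; simp at hx; subst hx; exact ha
  | cons b l ih =>
    intro a hc hn ha hS x hx
    have haR : a ∈ R := by
      rcases ha with h | h
      · exact h
      · have := hS a (by simp) h
        rw [List.getLast_cons (List.cons_ne_nil _ _)] at this
        have hm := List.getLast_mem (List.cons_ne_nil b l)
        rw [← this] at hm
        exact absurd hm (List.nodup_cons.1 hn).1
    rcases List.mem_cons.1 hx with rfl | hx
    · exact ha
    · rw [List.isChain_cons_cons] at hc
      refine ih b hc.2 (List.nodup_cons.1 hn).2 (hR _ _ hc.1 haR) ?_ x hx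
      intro y hy hyS
      have := hS y (List.mem_cons_of_mem _ hy) hyS
      rwa [List.getLast_cons (List.cons_ne_nil _ _)] at this

/-- A path that does not meet `S` after its first vertex stays in `R` once it has a vertex there. -/
theorem getLast_mem_of_chain {E : Finset (V × V)} {R : Set V} {S : Finset V}
    (hR : ∀ a b, (a, b) ∈ E → a ∈ R → b ∈ R ∨ b ∈ S) (l : List V) :
    ∀ a, List.IsChain (fun u v => (u, v) ∈ E) (a :: l) → (∀ x ∈ l, x ∉ S) →
      ∀ x ∈ a :: l, x ∈ R → (a :: l).getLast (List.cons_ne_nil _ _) ∈ R := by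
  induction l with
  | nil => intro a _ _ x hx; simp at hx; subst hx; simp
  | cons b l ih =>
    intro a hc hS x hx hxR
    rw [List.isChain_cons_cons] at hc
    rw [List.getLast_cons (List.cons_ne_nil _ _)]
    have hS' : ∀ x ∈ l, x ∉ S := fun y hy => hS y (List.mem_cons_of_mem _ hy)
    rcases List.mem_cons.1 hx with rfl | hx
    · exact ih b hc.2 hS' b (by simp) ((hR _ _ hc.1 hxR).resolve_right (hS b (by simp)))
    · exact ih b hc.2 hS' x hx hxR

variable [DecidableEq V]

/-- Gluing step: a linkage from `A` to `S ∪ {u}` and one from `S ∪ {v}` to `B`, in a digraph in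
which `S` separates `A` from `B`, are joined at `S` and along the arc `(u, v)`. -/
theorem Linked.glue {E E' : Finset (V × V)} {A B S : Finset V} {u v : V} {k : ℕ}
    (hE : E' ⊆ E) (huv : (u, v) ∈ E) (hu : u ∉ S) (hv : v ∉ S)
    {R : Set V} (hAR : ∀ a ∈ A, a ∈ R ∨ a ∈ S) (hBR : ∀ b ∈ B, b ∉ R)
    (hR : ∀ a b, (a, b) ∈ E' → a ∈ R → b ∈ R ∨ b ∈ S) (hvR : v ∉ R)
    (hk : S.card + 1 = k) (h1 : Linked E' A (insert u S) k) (h2 : Linked E' (insert v S) B k) :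
    Linked E A B k := by
  classical
  obtain ⟨I, P, hIA, hIk, hP, hPd⟩ := h1
  obtain ⟨J, Q, hJS, hJk, hQ, hQd⟩ := h2
  have hJ : J = insert v S := Finset.eq_of_subset_of_card_le hJS (by
    rw [hJk, Finset.card_insert_of_notMem hv, hk])
  let e : V → V := fun a => (a :: P a).getLast (List.cons_ne_nil _ _)
  have hemem : ∀ a, e a ∈ a :: P a := fun a => List.getLast_mem _
  have heinj : Set.InjOn e I := by
    intro a ha b hb hab
    by_contra hne
    exact hPd a ha b hb hne (hemem a) (by
      have := hemem b
      rwa [← hab] at this)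
  have hesurj : Set.SurjOn e I (insert u S : Finset V) :=
    Finset.surjOn_of_injOn_of_card_le e (fun a ha => (hP a ha).2.2) heinj (by
      rw [hIk, Finset.card_insert_of_notMem hu, hk])
  -- a path of the first linkage meets `S ∪ {u}` in its last vertex only
  have hPS : ∀ a ∈ I, ∀ x ∈ a :: P a, x ∈ insert u S → x = e a := by
    intro a ha x hx hxS
    obtain ⟨b, hb, hbx⟩ := hesurj hxS
    by_cases hab : a = b
    · subst hab; exact hbx.symm
    · exact absurd (hemem b) (by rw [hbx]; exact fun h => hPd a ha b hb hab hx h)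
  have hQS : ∀ s ∈ J, ∀ x ∈ Q s, x ∉ insert v S := by
    intro s hs x hx hxS
    rw [← hJ] at hxS
    by_cases hsx : s = x
    · subst hsx; exact (List.nodup_cons.1 (hQ s hs).2.1).1 hx
    · exact hQd s hs x hxS hsx (List.mem_cons_of_mem _ hx) (by simp)
  have hPR : ∀ a ∈ I, ∀ x ∈ a :: P a, x ∈ R ∨ x ∈ S := by
    intro a ha
    refine mem_or_mem_of_chain hR (P a) a (hP a ha).1 (hP a ha).2.1 (hAR a (hIA ha)) ?_
    exact fun x hx hxS => hPS a ha x hx (Finset.mem_insert_of_mem hxS)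
  have hQR : ∀ s ∈ J, ∀ x ∈ s :: Q s, x ∉ R := by
    intro s hs x hx hxR
    exact hBR _ (hQ s hs).2.2 (getLast_mem_of_chain hR (Q s) s (hQ s hs).1
      (fun y hy hyS => hQS s hs y hy (Finset.mem_insert_of_mem hyS)) x hx hxR)
  let f : V → V := fun s => if s = u then v else s
  have hf : ∀ a ∈ I, f (e a) ∈ J := by
    intro a ha
    have := (hP a ha).2.2
    rw [hJ]
    simp only [f]
    split_ifs with h
    · simp
    · exact Finset.mem_insert_of_mem ((Finset.mem_insert.1 this).resolve_left h)
  let T : V → List V := fun a => if e a = u then v :: Q v else Q (e a)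
  have hTsub : ∀ a, ∀ x ∈ T a, x ∈ f (e a) :: Q (f (e a)) := by
    intro a x hx
    simp only [T, f] at hx ⊢
    split_ifs at hx ⊢ with h
    · exact hx
    · exact List.mem_cons_of_mem _ hx
  have hTS : ∀ a ∈ I, ∀ x ∈ T a, x ∉ S := by
    intro a ha x hx hxS
    have hJe := hf a ha
    simp only [T, f] at hx hJe
    split_ifs at hx hJe with h
    · rcases List.mem_cons.1 hx with rfl | hx
      · exact hv hxS
      · exact hQS _ hJe x hx (Finset.mem_insert_of_mem hxS)
    · exact hQS _ hJe x hx (Finset.mem_insert_of_mem hxS)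
  have hcross : ∀ a ∈ I, ∀ b ∈ I, List.Disjoint (a :: P a) (T b) := by
    intro a ha b hb x hx hx'
    rcases hPR a ha x hx with h | h
    · exact hQR _ (hf b hb) x (hTsub b x hx') h
    · exact hTS b hb x hx' h
  refine ⟨I, fun a => P a ++ T a, hIA, hIk, fun a ha => ⟨?_, ?_, ?_⟩, ?_⟩
  · rw [← List.cons_append, List.isChain_append]
    refine ⟨(hP a ha).1.imp fun _ _ h => hE h, ?_, ?_⟩
    · have hJe := hf a ha
      simp only [T, f] at hJe ⊢
      split_ifs at hJe ⊢ with h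
      · exact (hQ v hJe).1.imp fun _ _ h => hE h
      · exact ((hQ _ hJe).1.imp fun _ _ h => hE h).tail
    · intro x hx y hy
      have hxe : x = e a := by
        rw [List.getLast?_eq_some_getLast (List.cons_ne_nil _ _)] at hx
        simpa using hx.symm
      have hJe := hf a ha
      simp only [T, f] at hJe hy
      subst hxe
      split_ifs at hJe hy with h
      · simp at hy
        rw [h, ← hy]; exact huv
      · have := (hQ _ hJe).1
        cases hq : Q (e a) with
        | nil => simp [hq] at hy
        | cons c l =>
          rw [hq] at this hy
          simp at hy
          subst hy
          exact hE (List.isChain_cons_cons.1 this).1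
  · rw [← List.cons_append, List.nodup_append]
    refine ⟨(hP a ha).2.1, ?_, fun x hx y hy hxy => hcross a ha a ha hx (hxy ▸ hy)⟩
    have hJe := hf a ha
    simp only [T, f] at hJe ⊢
    split_ifs at hJe ⊢ with h
    · exact (hQ v hJe).2.1
    · exact (List.nodup_cons.1 (hQ _ hJe).2.1).2
  · have hJe := hf a ha
    have hl := (hQ _ hJe).2.2
    by_cases hT : T a = []
    · have h' : e a ≠ u := fun h => by simp [T, h] at hT
      simp only [T, f, if_neg h'] at hT hl
      simp only [T, if_neg h', hT, List.append_nil]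
      simpa [hT, e] using hl
    · have : (a :: (P a ++ T a)).getLast (List.cons_ne_nil _ _) = (T a).getLast hT := by
        rw [List.getLast_cons (by simp [hT]), List.getLast_append_of_ne_nil _ hT]
      rw [this]
      by_cases h' : e a = u
      · simpa [T, f, h'] using hl
      · simp only [f, if_neg h'] at hl
        have hT' : Q (e a) ≠ [] := by simpa [T, h'] using hT
        rw [List.getLast_cons hT'] at hl
        simpa [T, h'] using hl
  · intro a ha b hb hab
    show List.Disjoint (a :: P a ++ T a) (b :: P b ++ T b)
    rw [List.disjoint_append_left, List.disjoint_append_right, List.disjoint_append_right]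
    refine ⟨⟨hPd a ha b hb hab, hcross a ha b hb⟩, (hcross b hb a ha).symm, ?_⟩
    have hne : f (e a) ≠ f (e b) := by
      intro h
      have he : e a ≠ e b := fun h => hab (heinj ha hb h)
      have h1 := (hP a ha).2.2
      have h2 := (hP b hb).2.2
      change e a ∈ _ at h1
      change e b ∈ _ at h2
      simp only [f] at h
      split_ifs at h with h3 h4 h4
      · exact he (h3.trans h4.symm)
      · exact hv (h ▸ (Finset.mem_insert.1 h2).resolve_left h4)
      · exact hv (h ▸ (Finset.mem_insert.1 h1).resolve_left h3)
      · exact he h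
    exact fun x hx hx' => hQd _ (hf a ha) _ (hf b hb) hne (hTsub a x hx) (hTsub b x hx')

/-- **Menger's theorem** for disjoint paths between two vertex sets of a finite digraph, by
induction on the number of arcs. If the deletion of the arc `(u, v)` allows a separator `S` with
fewer than `k` vertices, then `S` has `k - 1` vertices, and the induction hypothesis provides
linkages from `A` to `S ∪ {u}` and from `S ∪ {v}` to `B`. -/
theorem linked_of_le_separator (E : Finset (V × V)) : ∀ (A B : Finset V) (k : ℕ),
    (∀ S, Separates E A B S → k ≤ S.card) → Linked E A B k := by
  classical
  induction E using Finset.strongInduction with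
  | H E ih =>
  intro A B k h
  rcases E.eq_empty_or_nonempty with rfl | ⟨⟨u, v⟩, huv⟩
  · have hk : k ≤ (A ∩ B).card := by
      refine h _ ⟨{a | a ∈ A ∧ a ∉ B}, ?_, ?_, ?_, ?_⟩
      · intro a ha; by_cases hb : a ∈ B <;> simp [ha, hb]
      · rintro b hb ⟨_, h⟩; exact h hb
      · intro s hs; simp at hs; simp [hs]
      · simp
    obtain ⟨I, hI, hIk⟩ := Finset.exists_subset_card_eq hk
    refine ⟨I, fun _ => [], hI.trans Finset.inter_subset_left, hIk, ?_, ?_⟩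
    · intro a ha
      exact ⟨List.isChain_singleton _, List.nodup_singleton _,
        (Finset.mem_inter.1 (hI ha)).2⟩
    · intro a _ b _ hab
      simpa using hab.symm
  · have hss : E.erase (u, v) ⊂ E := Finset.erase_ssubset huv
    by_cases hE' : ∀ S, Separates (E.erase (u, v)) A B S → k ≤ S.card
    · obtain ⟨I, L, h1, h2, h3, h4⟩ := ih _ hss A B k hE'
      exact ⟨I, L, h1, h2, fun a ha => ⟨(h3 a ha).1.imp fun _ _ h => Finset.mem_of_mem_erase h,
        (h3 a ha).2⟩, h4⟩
    · push Not at hE'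
      obtain ⟨S, hS, hSk⟩ := hE'
      obtain ⟨R, hAR, hBR, hSR, hR⟩ := id hS
      have harc : ∀ a b, (a, b) ∈ E → (a = u ∧ b = v) ∨ (a, b) ∈ E.erase (u, v) := by
        intro a b hab
        by_cases h : (a, b) = (u, v)
        · left; simpa using h
        · right; exact Finset.mem_erase.2 ⟨h, hab⟩
      have huR : u ∈ R := by
        by_contra hu
        refine absurd (h S ⟨R, hAR, hBR, hSR, fun a b hab ha => ?_⟩) (by omega)
        rcases harc a b hab with ⟨rfl, rfl⟩ | h'
        · exact absurd ha hu
        · exact hR a b h' ha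
      have hvR : v ∉ R ∧ v ∉ S := by
        by_contra hv
        refine absurd (h S ⟨R, hAR, hBR, hSR, fun a b hab ha => ?_⟩) (by omega)
        rcases harc a b hab with ⟨rfl, rfl⟩ | h'
        · tauto
        · exact hR a b h' ha
      have huS : u ∉ S := fun hu => hSR u hu huR
      have hk : S.card + 1 = k := by
        have := h (insert v S) ⟨R, fun a ha => ?_, hBR, ?_, fun a b hab ha => ?_⟩
        · rw [Finset.card_insert_of_notMem hvR.2] at this; omega
        · rcases hAR a ha with h' | h' <;> simp [h']
        · intro s hs
          rcases Finset.mem_insert.1 hs with rfl | hs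
          exacts [hvR.1, hSR s hs]
        · rcases harc a b hab with ⟨rfl, rfl⟩ | h'
          · simp
          · rcases hR a b h' ha with h' | h' <;> simp [h']
      refine Linked.glue hss.subset huv huS hvR.2 hAR hBR hR hvR.1 hk
        (ih _ hss _ _ _ ?_) (ih _ hss _ _ _ ?_)
      · rintro T ⟨R', hA', hB', hT', hR'⟩
        refine h T ⟨R' ∩ R, ?_, fun b hb hb' => hBR b hb hb'.2, fun s hs hs' => hT' s hs hs'.1, ?_⟩
        · intro a ha
          rcases hA' a ha with h' | h'
          · left
            refine ⟨h', (hAR a ha).resolve_right fun h'' => ?_⟩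
            exact hB' a (Finset.mem_insert_of_mem h'') h'
          · exact Or.inr h'
        · rintro a b hab ⟨ha', ha⟩
          rcases harc a b hab with ⟨rfl, rfl⟩ | h'
          · exact absurd ha' (hB' _ (by simp))
          · rcases hR' a b h' ha' with h1 | h1
            · left
              refine ⟨h1, (hR a b h' ha).resolve_right fun h'' => ?_⟩
              exact hB' b (Finset.mem_insert_of_mem h'') h1
            · exact Or.inr h1
      · rintro T ⟨R', hA', hB', hT', hR'⟩
        have key : ∀ b, b ∈ R ∨ b ∈ S → b ∈ (R ∪ R') \ (T : Set V) ∨ b ∈ T := by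
          intro b hb
          by_cases hbT : b ∈ T
          · exact Or.inr hbT
          · left
            refine ⟨?_, hbT⟩
            rcases hb with hb | hb
            · exact Or.inl hb
            · exact Or.inr ((hA' b (Finset.mem_insert_of_mem hb)).resolve_right hbT)
        have key' : ∀ b, b ∈ R' ∨ b ∈ T → b ∈ (R ∪ R') \ (T : Set V) ∨ b ∈ T := by
          intro b hb
          by_cases hbT : b ∈ T
          · exact Or.inr hbT
          · exact Or.inl ⟨Or.inr (hb.resolve_right hbT), hbT⟩
        refine h T ⟨(R ∪ R') \ T, fun a ha => key a (hAR a ha), ?_, fun s hs hs' => hs'.2 hs, ?_⟩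
        · rintro b hb ⟨hb' | hb', _⟩
          exacts [hBR b hb hb', hB' b hb hb']
        · rintro a b hab ⟨ha, haT⟩
          rcases harc a b hab with ⟨rfl, rfl⟩ | h'
          · exact key' _ (hA' _ (by simp))
          · rcases ha with ha | ha
            · exact key b (hR a b h' ha)
            · exact key' b (hR' a b h' ha)

end Menger

/-! ### Boundaries of vertex sets -/

namespace SimpleGraph

open Classical in
/-- The neighbours in `A` of the vertex set `Q`, outside of `Q`. -/
noncomputable def nb {V : Type*} (H : SimpleGraph V) (A Q : Finset V) : Finset V :=
  A.filter fun v => v ∉ Q ∧ ∃ u ∈ Q, H.Adj u v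

open Classical in
/-- The edges from `Z` to the vertices of `A` outside of `Z`, oriented away from `Z`. -/
noncomputable def cutEdges {V : Type*} (H : SimpleGraph V) (A Z : Finset V) : Finset (V × V) :=
  (A ×ˢ A).filter fun p => p.1 ∈ Z ∧ p.2 ∉ Z ∧ H.Adj p.1 p.2

/-- The number of edges between `Z` and the vertices of `A` outside of `Z`. -/
noncomputable def cutSize {V : Type*} (H : SimpleGraph V) (A Z : Finset V) : ℕ :=
  (H.cutEdges A Z).card

theorem mem_cutEdges {V : Type*} {H : SimpleGraph V} {A Z : Finset V} {p : V × V} :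
    p ∈ H.cutEdges A Z ↔ (p.1 ∈ A ∧ p.2 ∈ A) ∧ p.1 ∈ Z ∧ p.2 ∉ Z ∧ H.Adj p.1 p.2 := by
  simp [cutEdges]

theorem mem_nb {V : Type*} {H : SimpleGraph V} {A Q : Finset V} {v : V} :
    v ∈ H.nb A Q ↔ v ∈ A ∧ v ∉ Q ∧ ∃ u ∈ Q, H.Adj u v := by
  simp [nb]

section LocalConnectivity

variable {V : Type*}

theorem exists_path_of_chain (G : SimpleGraph V) {x y a : V} {l : List V}
    (hc : List.IsChain G.Adj (a :: l)) (hn : (a :: l).Nodup) (hx : G.Adj x a)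
    (hy : G.Adj ((a :: l).getLast (List.cons_ne_nil _ _)) y) (hxy : x ≠ y)
    (hxl : x ∉ a :: l) (hyl : y ∉ a :: l) :
    ∃ p : G.Path x y, (p : G.Walk x y).support = x :: (a :: l) ++ [y] := by
  have hchain : List.IsChain G.Adj (x :: (a :: l) ++ [y]) := by
    rw [List.isChain_append]
    refine ⟨List.isChain_cons_cons.2 ⟨hx, hc⟩, List.isChain_singleton _, ?_⟩
    intro u hu v hv
    rw [List.getLast?_eq_some_getLast (List.cons_ne_nil _ _)] at hu
    simp at hv hu
    subst hv
    rw [← hu]; exact hy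
  obtain ⟨p, hp⟩ : ∃ p : G.Walk x y, p.support = x :: (a :: l) ++ [y] := by
    have hne : x :: (a :: l) ++ [y] ≠ [] := List.cons_ne_nil _ _
    have hh : (x :: (a :: l) ++ [y]).head hne = x := rfl
    have hl : (x :: (a :: l) ++ [y]).getLast hne = y := List.getLast_concat
    exact ⟨(Walk.ofSupport _ hne hchain).copy hh hl,
      (Walk.support_copy _ hh hl).trans (Walk.support_ofSupport _ _)⟩
  refine ⟨⟨p, ?_⟩, hp⟩
  rw [Walk.isPath_def, hp, List.nodup_append]
  refine ⟨List.nodup_cons.2 ⟨hxl, hn⟩, List.nodup_singleton _, ?_⟩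
  intro u hu v hv huv
  simp only [List.mem_singleton] at hv
  rw [huv, hv] at hu
  rcases List.mem_cons.1 hu with h | h
  · exact hxy h.symm
  · exact hyl h

theorem lt_localConnectivity {G : SimpleGraph V} {x y : V} {S : Set (G.Path x y)}
    (hS : G.InternallyDisjoint S) {k : ℕ} (hk : (k : ℕ∞) < S.encard) :
    (k : ℕ∞) < G.localConnectivity x y :=
  hk.trans_le (le_iSup (fun S : {S : Set (G.Path x y) // G.InternallyDisjoint S} =>
    (S : Set (G.Path x y)).encard) ⟨S, hS⟩)

theorem exists_of_le_localConnectivity {G : SimpleGraph V} {x y : V} {k : ℕ}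
    (hk : ((k + 1 : ℕ) : ℕ∞) ≤ G.localConnectivity x y) :
    ∃ S : Set (G.Path x y), G.InternallyDisjoint S ∧ ((k + 1 : ℕ) : ℕ∞) ≤ S.encard := by
  by_contra! h
  have : G.localConnectivity x y ≤ (k : ℕ∞) := iSup_le fun S => by
    have := h S.1 S.2
    push_cast at this
    exact ENat.lt_add_one_iff (ENat.natCast_ne_top k) |>.1 this
  have h2 := hk.trans this
  norm_cast at h2
  omega

variable [Fintype V] [DecidableEq V]

/-- Menger's theorem for two vertices `x`, `y` with at most three internally disjoint paths between
them. If `x` and `y` are adjacent, the edge between them is one of the three elements that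
separate. -/
theorem exists_separation {G : SimpleGraph V} {x y : V} (hxy : x ≠ y)
    (h : G.localConnectivity x y ≤ (3 : ℕ)) :
    ∃ Q : Finset V, x ∈ Q ∧ y ∉ Q ∧ (G.nb Finset.univ Q).card ≤ 3 ∧
      ∀ u ∈ Q, G.Adj u y → u = x := by
  classical
  by_contra! hno
  refine absurd h (not_le.2 ?_)
  let E : Finset (V × V) := Finset.univ.filter fun p =>
    G.Adj p.1 p.2 ∧ p.1 ≠ x ∧ p.1 ≠ y ∧ p.2 ≠ x ∧ p.2 ≠ y
  let A : Finset V := Finset.univ.filter fun v => G.Adj x v ∧ v ≠ y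
  let B : Finset V := Finset.univ.filter fun v => G.Adj v y ∧ v ≠ x
  have hsep : ∀ S, Menger.Separates E A B S → (if G.Adj x y then 3 else 4) ≤ S.card := by
    rintro S ⟨R, hA, hB, hS, hR⟩
    let Q : Finset V := Finset.univ.filter fun v => v = x ∨ v ∈ R ∧ v ≠ y
    have hQy : ∀ u ∈ Q, G.Adj u y → u = x := by
      intro u hu huy
      simp only [Q, Finset.mem_filter_univ] at hu
      by_contra hux
      exact hB u (by simp [B, huy, hux]) (hu.resolve_left hux).1
    have hQ : 3 < (G.nb Finset.univ Q).card := by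
      by_contra hlt
      obtain ⟨u, hu, huy, hux⟩ := hno Q (by simp [Q]) (by simp [Q, hxy.symm]) (by omega)
      exact hux (hQy u hu huy)
    have hsub : G.nb Finset.univ Q ⊆ S ∪ if G.Adj x y then {y} else ∅ := by
      intro v hv
      rw [mem_nb] at hv
      obtain ⟨-, hvQ, u, hu, huv⟩ := hv
      by_cases hvy : v = y
      · subst hvy
        have := hQy u hu huv
        subst this
        simp [huv]
      · refine Finset.mem_union_left _ ?_
        simp only [Q, Finset.mem_filter_univ, not_or, not_and, not_not] at hu hvQ
        have hvR : v ∉ R := fun h => hvy (hvQ.2 h)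
        by_cases hux : u = x
        · subst hux
          exact (hA v (by simp [A, huv, hvy])).resolve_left hvR
        · obtain ⟨huR, huy⟩ := hu.resolve_left hux
          exact (hR u v (by simp [E, *]) huR).resolve_left hvR
    have := (Finset.card_le_card hsub).trans (Finset.card_union_le _ _)
    split_ifs at this ⊢ <;> simp at this <;> omega
  obtain ⟨I, L, hIA, hIk, hL, hd⟩ := Menger.linked_of_le_separator E A B _ hsep
  have hmem : ∀ a ∈ I, ∀ v ∈ a :: L a, v ≠ x ∧ v ≠ y := by
    have aux : ∀ (l : List V) (a : V), a ≠ x ∧ a ≠ y → List.IsChain (fun u v => (u, v) ∈ E) (a :: l) →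
        ∀ v ∈ a :: l, v ≠ x ∧ v ≠ y := by
      intro l
      induction l with
      | nil => intro a ha _ v hv; simp at hv; subst hv; exact ha
      | cons b l ih =>
        intro a ha hc v hv
        rw [List.isChain_cons_cons] at hc
        rcases List.mem_cons.1 hv with rfl | hv
        · exact ha
        · refine ih b ?_ hc.2 v hv
          have := hc.1
          simp only [E, Finset.mem_filter_univ] at this
          exact this.2.2.2
    intro a ha
    have := hIA ha
    simp only [A, Finset.mem_filter_univ] at this
    exact aux _ a ⟨this.1.ne', this.2⟩ (hL a ha).1
  have hp : ∀ a : I, ∃ p : G.Path x y,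
      (p : G.Walk x y).support = x :: ((a : V) :: L a) ++ [y] := by
    rintro ⟨a, ha⟩
    have haA := hIA ha
    simp only [A, Finset.mem_filter_univ] at haA
    have hlB := (hL a ha).2.2
    simp only [B, Finset.mem_filter_univ] at hlB
    refine exists_path_of_chain G ((hL a ha).1.imp fun u v h => ?_) (hL a ha).2.1 haA.1 hlB.1 hxy
      (fun h => (hmem a ha x h).1 rfl) (fun h => (hmem a ha y h).2 rfl)
    simp only [E, Finset.mem_filter_univ] at h
    exact h.1
  choose p hp using hp
  have hpinj : Function.Injective p := by
    intro a b hab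
    have := hp a
    rw [hab, hp b] at this
    simp at this
    exact this.1.symm
  have hpd : G.InternallyDisjoint (Set.range p) := by
    rintro _ ⟨a, rfl⟩ _ ⟨b, rfl⟩ hab v hva hvb
    rw [hp] at hva hvb
    have hne : (a : V) ≠ b := fun h => hab (congrArg p (Subtype.ext h))
    by_contra! hv
    have h1 : v ∈ (a : V) :: L a := by simpa [hv.1, hv.2] using hva
    have h2 : v ∈ (b : V) :: L b := by simpa [hv.1, hv.2] using hvb
    exact hd a a.2 b b.2 hne h1 h2
  have hcard : (Set.range p).encard = I.card := by
    rw [← Set.image_univ, hpinj.encard_image]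
    simp
  by_cases hadj : G.Adj x y
  · let q : G.Path x y := Path.singleton hadj
    have hq : (q : G.Walk x y).support = [x, y] := rfl
    have hqp : q ∉ Set.range p := by
      rintro ⟨a, ha⟩
      have := hp a
      rw [ha, hq] at this
      simp at this
    refine lt_localConnectivity (S := insert q (Set.range p)) ?_ ?_
    · rintro r hr s hs hrs v hvr hvs
      rcases hr with rfl | hr
      · simpa [hq] using hvr
      · rcases hs with rfl | hs
        · simpa [hq] using hvs
        · exact hpd r hr s hs hrs v hvr hvs
    · rw [Set.encard_insert_of_notMem hqp, hcard, hIk, if_pos hadj]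
      norm_num
  · refine lt_localConnectivity hpd ?_
    rw [hcard, hIk, if_neg hadj]
    norm_num

/-- Disjoint paths from `q ∈ Q` to a vertex beyond the boundary of `Q` leave `Q` through different
boundary vertices. -/
theorem le_card_nb {G : SimpleGraph V} {k : ℕ} {Q : Finset V} {q w : V}
    (h : ((k + 1 : ℕ) : ℕ∞) ≤ G.localConnectivity q w) (hq : q ∈ Q) (hw : w ∉ Q)
    (hwn : w ∉ G.nb Finset.univ Q) : k + 1 ≤ (G.nb Finset.univ Q).card := by
  classical
  obtain ⟨S, hS, hk⟩ := exists_of_le_localConnectivity h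
  have : ∀ p : G.Path q w, ∃ v ∈ G.nb Finset.univ Q, v ∈ (p : G.Walk q w).support := by
    intro p
    obtain ⟨d, hd, h1, h2⟩ := (p : G.Walk q w).exists_boundary_dart Q hq hw
    exact ⟨d.snd, mem_nb.2 ⟨Finset.mem_univ _, h2, d.fst, h1, d.adj⟩,
      Walk.dart_snd_mem_support_of_mem_darts _ hd⟩
  choose f hf hf' using this
  have hinj : Set.InjOn f S := by
    intro p hp r hr hpr
    by_contra hne
    have := hS p hp r hr hne (f p) (hf' p) (hpr ▸ hf' r)
    have hp' := hf p
    rcases this with h | h <;> rw [h] at hp'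
    · exact (mem_nb.1 hp').2.1 hq
    · exact hwn hp'
  have h2 : S.encard ≤ (G.nb Finset.univ Q : Set V).encard := by
    rw [← hinj.encard_image]
    exact Set.encard_le_encard (by rintro _ ⟨p, _, rfl⟩; exact hf p)
  have h3 := hk.trans h2
  rw [Set.encard_coe_eq_coe_finsetCard] at h3
  exact_mod_cast h3

theorem IsKConnected.lt_card {G : SimpleGraph V} {k : ℕ} (h : G.IsKConnected (k + 1)) :
    k + 1 < Fintype.card V := by
  classical
  obtain ⟨⟨x, y, hxy⟩, hc⟩ := h
  obtain ⟨S, hS, hk⟩ := exists_of_le_localConnectivity (hc x y hxy)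
  let f : G.Path x y → V := fun p => (p : G.Walk x y).snd
  have hne : ∀ p : G.Path x y, f p ≠ x := by
    rintro ⟨p, hp⟩
    cases p with
    | nil => exact absurd rfl hxy
    | cons h p => simpa [f] using h.ne'
  have hinj : Set.InjOn f S := by
    intro p hp r hr hpr
    by_contra hpr'
    have hy : f p = y := by
      refine (hS p hp r hr hpr' (f p) ?_ ?_).resolve_left (hne p)
      · exact Walk.getVert_mem_support _ _
      · rw [hpr]; exact Walk.getVert_mem_support _ _
    have key : ∀ p : G.Path x y, f p = y → (p : G.Walk x y).support = [x, y] := by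
      rintro ⟨p, hp⟩ hpy
      cases p with
      | nil => exact absurd rfl hxy
      | cons h p =>
        simp [f] at hpy
        subst hpy
        have := (Walk.cons_isPath_iff _ _).1 hp
        have hnil := (Walk.isPath_iff_nil.1 this.1).eq_nil
        show x :: p.support = [x, _]
        rw [hnil]
        rfl
    exact hpr' (Subtype.ext (Walk.ext_support ((key p hy).trans (key r (hpr ▸ hy)).symm)))
  have h2 : S.encard ≤ ((Finset.univ.erase x : Finset V) : Set V).encard := by
    rw [← hinj.encard_image]
    exact Set.encard_le_encard (by rintro _ ⟨p, _, rfl⟩; simpa using hne p)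
  have h3 := hk.trans h2
  rw [Set.encard_coe_eq_coe_finsetCard] at h3
  have h4 : k + 1 ≤ (Finset.univ.erase x : Finset V).card := by exact_mod_cast h3
  rw [Finset.card_erase_of_mem (Finset.mem_univ _), Finset.card_univ] at h4
  have := Fintype.card_pos_iff.2 ⟨x⟩
  omega

end LocalConnectivity

/-! ### From local connectivity to edge cuts -/

/-- The structural form of "3-connected with maximal local connectivity 3" that the proof works
with, for the graph `H` on the finite vertex set `A`: no separation by fewer than three
vertices, and every two vertices are separated by at most three edges. -/
structure Tight {V : Type*} (H : SimpleGraph V) (A : Finset V) : Prop where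
  mem : ∀ {u v}, H.Adj u v → u ∈ A
  card : 4 ≤ A.card
  conn : ∀ Q ⊆ A, Q.Nonempty → (∃ w ∈ A, w ∉ Q ∧ w ∉ H.nb A Q) → 3 ≤ (H.nb A Q).card
  cut : ∀ x ∈ A, ∀ y ∈ A, x ≠ y → ∃ Z ⊆ A, x ∈ Z ∧ y ∉ Z ∧ H.cutSize A Z ≤ 3

section

variable {V : Type*}

/-- An edge cut is at most as large as a set that contains an end of each of its edges, these ends
being different. -/
theorem cutSize_le_of_injOn {H : SimpleGraph V} {A Z N : Finset V} (f : V → V → V)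
    (hf : ∀ u v, u ∈ Z → v ∈ A → v ∉ Z → H.Adj u v → f u v ∈ N)
    (hinj : ∀ u v u' v', u ∈ Z → v ∈ A → v ∉ Z → H.Adj u v → u' ∈ Z → v' ∈ A → v' ∉ Z →
      H.Adj u' v' → f u v = f u' v' → u = u' ∧ v = v') : H.cutSize A Z ≤ N.card := by
  refine Finset.card_le_card_of_injOn (fun p => f p.1 p.2) ?_ ?_
  · rintro ⟨u, v⟩ hp
    rw [Finset.mem_coe, mem_cutEdges] at hp
    exact hf u v hp.2.1 hp.1.2 hp.2.2.1 hp.2.2.2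
  · rintro ⟨u, v⟩ hp ⟨u', v'⟩ hp' h
    rw [Finset.mem_coe, mem_cutEdges] at hp hp'
    have := hinj u v u' v' hp.2.1 hp.1.2 hp.2.2.1 hp.2.2.2 hp'.2.1 hp'.1.2 hp'.2.2.1 hp'.2.2.2 h
    rw [this.1, this.2]

variable [DecidableEq V]

/-- In a 3-connected graph in which every two vertices `x`, `y` are separated by three vertices
(or by the edge `xy` and two vertices), every two vertices are separated by three edges. Among the
separations of `x` from `y`, the one whose side `Q` is smallest yields the edge cut: a vertex `s` of
the separator with two neighbours on both sides would allow to uncross `Q` with a separation of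
`x` from `s`. -/
theorem exists_cut_of_separation {H : SimpleGraph V} {A : Finset V}
    (conn : ∀ Q ⊆ A, Q.Nonempty → (∃ w ∈ A, w ∉ Q ∧ w ∉ H.nb A Q) → 3 ≤ (H.nb A Q).card)
    (sep : ∀ x ∈ A, ∀ y ∈ A, x ≠ y → ∃ Q ⊆ A, x ∈ Q ∧ y ∉ Q ∧ (H.nb A Q).card ≤ 3 ∧
      ∀ u ∈ Q, H.Adj u y → u = x)
    {x y : V} (hx : x ∈ A) (hy : y ∈ A) (hxy : x ≠ y) :
    ∃ Z ⊆ A, x ∈ Z ∧ y ∉ Z ∧ H.cutSize A Z ≤ 3 := by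
  classical
  obtain ⟨Q, ⟨hQA, hxQ, hyQ, hQ3, hQy⟩, hmin⟩ := WellFounded.has_min
    (measure (Finset.card : Finset V → ℕ)).wf {Q | Q ⊆ A ∧ x ∈ Q ∧ y ∉ Q ∧ (H.nb A Q).card ≤ 3 ∧
      ∀ u ∈ Q, H.Adj u y → u = x} (sep x hx y hy hxy)
  set N := H.nb A Q with hN
  by_cases hall : ∀ s ∈ N, (∀ u ∈ Q, ∀ u' ∈ Q, H.Adj u s → H.Adj u' s → u = u') ∨
      (∀ v ∈ A, ∀ v' ∈ A, v ∉ Q → v' ∉ Q → H.Adj s v → H.Adj s v' → v = v')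
  · -- a vertex of the separator with several neighbours in `Q` goes to the side of `Q`; then only
    -- one edge is cut for each vertex of the separator
    let Z := Q ∪ N.filter fun s => ¬ ∀ u ∈ Q, ∀ u' ∈ Q, H.Adj u s → H.Adj u' s → u = u'
    have hZ : ∀ v, v ∈ Z ↔ v ∈ Q ∨ v ∈ N ∧ ¬ ∀ u ∈ Q, ∀ u' ∈ Q, H.Adj u v → H.Adj u' v → u = u' := by
      intro v; simp only [Z, Finset.mem_union, Finset.mem_filter]
    refine ⟨Z, ?_, ?_, ?_, le_trans ?_ hQ3⟩
    · intro v hv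
      rcases (hZ v).1 hv with h | h
      exacts [hQA h, (mem_nb.1 h.1).1]
    · exact (hZ x).2 (Or.inl hxQ)
    · rw [hZ]
      rintro (h | h)
      · exact hyQ h
      · exact h.2 fun u hu u' hu' huy hu'y => (hQy u hu huy).trans (hQy u' hu' hu'y).symm
    · refine cutSize_le_of_injOn (fun u v => if u ∈ Q then v else u) ?_ ?_
      · intro u v hu hv hvZ huv
        show (if u ∈ Q then v else u) ∈ N
        split_ifs with huQ
        · exact mem_nb.2 ⟨hv, fun h => hvZ ((hZ v).2 (Or.inl h)), u, huQ, huv⟩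
        · exact (((hZ u).1 hu).resolve_left huQ).1
      · intro u v u' v' hu hv hvZ huv hu' hv' hvZ' huv' h
        have hvQ : v ∉ Q := fun h => hvZ ((hZ v).2 (Or.inl h))
        have hvQ' : v' ∉ Q := fun h => hvZ' ((hZ v').2 (Or.inl h))
        split_ifs at h with h1 h2 h2
        · subst h
          refine ⟨?_, rfl⟩
          by_contra hne
          refine hvZ ((hZ v).2 (Or.inr ⟨mem_nb.2 ⟨hv, hvQ, u, h1, huv⟩, fun hh => ?_⟩))
          exact hne (hh u h1 u' h2 huv huv')
        · exact absurd hu' (h ▸ hvZ)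
        · exact absurd hu (h ▸ hvZ')
        · subst h
          refine ⟨rfl, ?_⟩
          have huN := ((hZ u).1 hu).resolve_left h1
          exact ((hall u huN.1).resolve_left huN.2) v hv v' hv' hvQ hvQ' huv huv'
  · exfalso
    push Not at hall
    obtain ⟨s, hs, ⟨u₁, hu₁, u₂, hu₂, hus₁, hus₂, hu⟩, v₁, hv₁, v₂, hv₂, hvQ₁, hvQ₂, hsv₁, hsv₂, hv⟩ :=
      hall
    have hs' := mem_nb.1 hs
    obtain ⟨Q', hQA', hxQ', hsQ', hQ3', hQs⟩ := sep x hx s hs'.1 (fun h => hs'.2.1 (h ▸ hxQ))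
    set N' := H.nb A Q' with hN'
    -- the two neighbours of `s` in `Q` do not both lie in `Q'`
    have hsmall : (Q ∩ Q').card < Q.card := by
      refine Finset.card_lt_card (Finset.ssubset_iff_subset_ne.2 ⟨Finset.inter_subset_left, ?_⟩)
      intro h
      have h' : ∀ u ∈ Q, u ∈ Q' := fun u hu => (Finset.mem_inter.1 (h.symm ▸ hu)).2
      exact hu ((hQs _ (h' _ hu₁) hus₁).trans (hQs _ (h' _ hu₂) hus₂).symm)
    -- by the choice of `Q`, its part in `Q'` has a larger boundary, so the opposite corner has a
    -- smaller one and is empty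
    have h4 : 4 ≤ (H.nb A (Q ∩ Q')).card := by
      by_contra h4
      refine hmin (Q ∩ Q') ⟨Finset.inter_subset_left.trans hQA, ?_, ?_, by omega, ?_⟩ hsmall
      · simp [hxQ, hxQ']
      · simp [hyQ]
      · intro u hu; exact hQy u (Finset.mem_inter.1 hu).1
    let U := (N ∩ (Q' ∪ N')) ∪ (N' ∩ Q)
    let T := (N \ Q') ∪ (N' \ Q)
    have hU : H.nb A (Q ∩ Q') ⊆ U := by
      intro v hv
      obtain ⟨hvA, hvQ, u, hu, huv⟩ := mem_nb.1 hv
      rw [Finset.mem_inter] at hu hvQ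
      have h1 : v ∉ Q → v ∈ N := fun h => mem_nb.2 ⟨hvA, h, u, hu.1, huv⟩
      have h2 : v ∉ Q' → v ∈ N' := fun h => mem_nb.2 ⟨hvA, h, u, hu.2, huv⟩
      simp only [U, Finset.mem_union, Finset.mem_inter]
      tauto
    have hNQ : ∀ v ∈ N, v ∉ Q := fun v hv => (mem_nb.1 hv).2.1
    have hNQ' : ∀ v ∈ N', v ∉ Q' := fun v hv => (mem_nb.1 hv).2.1
    have hT : T.card ≤ 2 := by
      have h1 := Finset.card_union_add_card_inter U T
      have h2 := Finset.card_union_add_card_inter N N'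
      have h3 : (U ∪ T).card ≤ (N ∪ N').card := by
        refine Finset.card_le_card fun v hv => ?_
        simp only [U, T, Finset.mem_union, Finset.mem_inter, Finset.mem_sdiff] at hv ⊢
        tauto
      have h5 : (U ∩ T).card ≤ (N ∩ N').card := by
        refine Finset.card_le_card fun v hv => ?_
        simp only [U, T, Finset.mem_union, Finset.mem_inter, Finset.mem_sdiff] at hv ⊢
        have := hNQ v
        have := hNQ' v
        tauto
      have := Finset.card_le_card hU
      omega
    have hB : ∀ v ∈ A, v ∉ Q → v ∉ Q' → v ∈ N ∨ v ∈ N' := by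
      by_contra! hB
      obtain ⟨b, hbA, hbQ, hbQ', hbN, hbN'⟩ := hB
      let B := A.filter fun v => v ∉ Q ∧ v ∉ Q' ∧ v ∉ N ∧ v ∉ N'
      have hBT : H.nb A B ⊆ T := by
        intro v hv
        obtain ⟨hvA, hvB, u, hu, huv⟩ := mem_nb.1 hv
        simp only [B, Finset.mem_filter] at hu hvB
        have h1 : v ∉ Q := fun h => hu.2.2.2.1 (mem_nb.2 ⟨hu.1, hu.2.1, v, h, huv.symm⟩)
        have h2 : v ∉ Q' := fun h => hu.2.2.2.2 (mem_nb.2 ⟨hu.1, hu.2.2.1, v, h, huv.symm⟩)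
        simp only [T, Finset.mem_union, Finset.mem_sdiff]
        tauto
      have h3 := conn B (Finset.filter_subset _ _)
        ⟨b, Finset.mem_filter.2 ⟨hbA, hbQ, hbQ', hbN, hbN'⟩⟩ ⟨x, hx, by simp [B, hxQ], ?_⟩
      · have := Finset.card_le_card hBT
        omega
      · intro h
        have := hBT h
        simp [T, hxQ, hxQ'] at this
    -- hence `s` and its two neighbours outside of `Q` lie in the boundary `T` of that corner
    have key : ∀ v ∈ A, v ∉ Q → H.Adj s v → v ∈ T := by
      intro v hvA hvQ hsv
      have hvQ' : v ∉ Q' := fun h => hvQ (hQs v h hsv.symm ▸ hxQ)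
      have := hB v hvA hvQ hvQ'
      simp only [T, Finset.mem_union, Finset.mem_sdiff]
      tauto
    have hsub : ({s, v₁, v₂} : Finset V) ⊆ T := by
      intro v hv
      simp only [Finset.mem_insert, Finset.mem_singleton] at hv
      rcases hv with rfl | rfl | rfl
      · simp [T, hs, hsQ']
      · exact key _ hv₁ hvQ₁ hsv₁
      · exact key _ hv₂ hvQ₂ hsv₂
    have := Finset.card_le_card hsub
    rw [Finset.card_insert_of_notMem (by simp [hsv₁.ne, hsv₂.ne]), Finset.card_pair hv] at this
    omega

end

/-- A 3-connected graph with maximal local connectivity 3 gives a tight graph on its image under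
an injection. -/
theorem tight_map {V W : Type*} [Fintype V] [DecidableEq W] {G : SimpleGraph V}
    (h3 : G.IsKConnected 3) (hm : G.HasMaximalLocalConnectivity 3) (f : V ↪ W) :
    Tight (G.map f) (Finset.univ.map f) := by
  classical
  have hnb : ∀ Q : Finset V, (G.map f).nb (Finset.univ.map f) (Q.map f) =
      (G.nb Finset.univ Q).map f := by
    intro Q
    ext w
    simp only [mem_nb, Finset.mem_map, map_adj]
    constructor
    · rintro ⟨⟨v, -, rfl⟩, h1, u, ⟨u', hu', rfl⟩, u'', v', huv, h2, h3⟩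
      rw [f.injective h2] at huv
      rw [f.injective h3] at huv
      exact ⟨v, ⟨Finset.mem_univ _, fun h => h1 ⟨v, h, rfl⟩, u', hu', huv⟩, rfl⟩
    · rintro ⟨v, ⟨-, h1, u, hu, huv⟩, rfl⟩
      refine ⟨⟨v, Finset.mem_univ _, rfl⟩, ?_, f u, ⟨u, hu, rfl⟩, u, v, huv, rfl, rfl⟩
      rintro ⟨v', hv', h⟩
      exact h1 (f.injective h ▸ hv')
  have hsub : ∀ Q : Finset W, Q ⊆ Finset.univ.map f → ∃ Q' : Finset V, Q = Q'.map f := by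
    intro Q hQ
    obtain ⟨Q', -, h⟩ := Finset.subset_map_iff.1 hQ
    exact ⟨Q', h⟩
  have hconn : ∀ Q ⊆ Finset.univ.map f, Q.Nonempty →
      (∃ w ∈ Finset.univ.map f, w ∉ Q ∧ w ∉ (G.map f).nb (Finset.univ.map f) Q) →
      3 ≤ ((G.map f).nb (Finset.univ.map f) Q).card := by
    intro Q hQ hne hw
    obtain ⟨Q, rfl⟩ := hsub Q hQ
    rw [hnb] at hw ⊢
    obtain ⟨w, hw, hwQ, hwn⟩ := hw
    obtain ⟨w, -, rfl⟩ := Finset.mem_map.1 hw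
    rw [Finset.mem_map'] at hwQ hwn
    obtain ⟨q, hq⟩ := Finset.map_nonempty.1 hne
    rw [Finset.card_map]
    exact le_card_nb (k := 2) (h3.2 q w fun h => hwQ (h ▸ hq)) hq hwQ hwn
  refine ⟨?_, ?_, hconn, ?_⟩
  · rintro u v huv
    obtain ⟨u, v, -, rfl, rfl⟩ := (map_adj _ _ _ _).1 huv
    simp
  · rw [Finset.card_map, Finset.card_univ]
    exact h3.lt_card
  · intro x hx y hy hxy
    refine exists_cut_of_separation hconn ?_ hx hy hxy
    intro x hx y hy hxy
    obtain ⟨x, -, rfl⟩ := Finset.mem_map.1 hx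
    obtain ⟨y, -, rfl⟩ := Finset.mem_map.1 hy
    have hxy' : x ≠ y := fun h => hxy (h ▸ rfl)
    obtain ⟨Q, h1, h2, h4, h5⟩ := exists_separation hxy' (hm x y hxy')
    refine ⟨Q.map f, Finset.map_subset_map.2 (Finset.subset_univ _), ?_, ?_, ?_, ?_⟩
    · rwa [Finset.mem_map']
    · rwa [Finset.mem_map']
    · rwa [hnb, Finset.card_map]
    · intro u hu huy
      obtain ⟨u, hu, rfl⟩ := Finset.mem_map.1 hu
      obtain ⟨u', y', h, h6, h7⟩ := (map_adj _ _ _ _).1 huy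
      rw [f.injective h6, f.injective h7] at h
      rw [h5 u ((Finset.mem_map' f).1 hu) h]

/-! ### Edge cuts and degrees in tight graphs -/

open Classical in
/-- The number of neighbours of `v` in `A`. -/
noncomputable def degIn {V : Type*} (H : SimpleGraph V) (A : Finset V) (v : V) : ℕ :=
  (A.filter fun u => H.Adj v u).card

section

variable {V : Type*} {H : SimpleGraph V} {A : Finset V}

theorem card_le_of_subset_pair {α : Type*} [DecidableEq α] {s : Finset α} {a b : α}
    (h : ∀ x ∈ s, x = a ∨ x = b) : s.card ≤ 2 :=
  (Finset.card_le_card (t := {a, b}) fun x hx => by simpa using h x hx).trans Finset.card_le_two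

theorem le_degIn {l : Finset V} (v : V) (hl : ∀ u ∈ l, u ∈ A ∧ H.Adj v u) :
    l.card ≤ H.degIn A v := by
  classical
  exact Finset.card_le_card fun u hu => by simpa using hl u hu

theorem cutSize_submodular [DecidableEq V] (Z X : Finset V) :
    H.cutSize A (Z ∩ X) + H.cutSize A (Z ∪ X) ≤ H.cutSize A Z + H.cutSize A X := by
  classical
  simp only [cutSize, cutEdges, Finset.card_filter, ← Finset.sum_add_distrib]
  refine Finset.sum_le_sum fun p _ => ?_
  by_cases h1 : p.1 ∈ Z <;> by_cases h2 : p.1 ∈ X <;> by_cases h3 : p.2 ∈ Z <;>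
    by_cases h4 : p.2 ∈ X <;> by_cases h5 : H.Adj p.1 p.2 <;> simp [h1, h2, h3, h4, h5]

theorem cutSize_sdiff [DecidableEq V] (Z : Finset V) : H.cutSize A (A \ Z) = H.cutSize A Z := by
  classical
  refine Finset.card_bij' (fun p _ => p.swap) (fun p _ => p.swap) ?_ ?_ ?_ ?_ <;>
    simp +contextual [mem_cutEdges, H.adj_comm]

theorem card_nb_le_cutSize (Q : Finset V) (hQ : Q ⊆ A) : (H.nb A Q).card ≤ H.cutSize A Q := by
  classical
  have : ∀ v ∈ H.nb A Q, ∃ u ∈ Q, H.Adj u v := fun v hv => (mem_nb.1 hv).2.2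
  choose! f hf using this
  refine Finset.card_le_card_of_injOn (fun v => (f v, v)) ?_ ?_
  · intro v hv
    obtain ⟨h1, h2, -⟩ := mem_nb.1 hv
    simp [mem_cutEdges, h1, h2, hf v hv, hQ (hf v hv).1]
  · intro v _ v' _ h
    exact (Prod.ext_iff.1 h).2

theorem cutSize_singleton_le (v : V) : H.cutSize A {v} ≤ H.degIn A v := by
  classical
  refine cutSize_le_of_injOn (fun _ w => w) ?_ ?_
  · intro u w hu hw _ huw
    simp only [Finset.mem_singleton] at hu
    subst hu
    simp [hw, huw]
  · intro u w u' w' hu _ _ _ hu' _ _ _ h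
    simp only [Finset.mem_singleton] at hu hu'
    exact ⟨hu.trans hu'.symm, h⟩

theorem cutSize_eq_sum [DecidableEq V] {Z : Finset V} (hZ : Z ⊆ A) :
    H.cutSize A Z = ∑ u ∈ Z, H.degIn (A \ Z) u := by
  classical
  simp only [cutSize, cutEdges, degIn, Finset.card_filter, Finset.sum_product]
  rw [← Finset.sum_subset hZ (fun u _ hu => by simp [hu])]
  refine Finset.sum_congr rfl fun u hu => ?_
  rw [← Finset.sum_subset (Finset.sdiff_subset (s := A) (t := Z))]
  · refine Finset.sum_congr rfl fun v hv => ?_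
    simp [hu, (Finset.mem_sdiff.1 hv).2]
  · intro v hv hv'
    simp only [Finset.mem_sdiff, not_and, not_not] at hv'
    simp [hv' hv]

theorem degIn_le_degIn_sdiff_add [DecidableEq V] {Z : Finset V} {u : V} (hu : u ∈ Z) :
    H.degIn A u ≤ H.degIn (A \ Z) u + (Z.card - 1) := by
  classical
  rw [← Finset.card_erase_of_mem hu]
  refine le_trans (Finset.card_le_card fun v hv => ?_) (Finset.card_union_le _ _)
  simp only [Finset.mem_filter, Finset.mem_union, Finset.mem_sdiff, Finset.mem_erase] at hv ⊢
  by_cases h : v ∈ Z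
  · exact Or.inr ⟨hv.2.ne', h⟩
  · exact Or.inl ⟨⟨hv.1, h⟩, hv.2⟩

namespace Tight

variable [DecidableEq V] (hT : Tight H A)
include hT

theorem three_le_degIn {v : V} (hv : v ∈ A) : 3 ≤ H.degIn A v := by
  classical
  have hsub : H.nb A {v} ⊆ A.filter fun u => H.Adj v u := by
    intro u hu
    obtain ⟨h1, h2, w, hw, hwu⟩ := mem_nb.1 hu
    simp only [Finset.mem_singleton] at hw
    subst hw
    simp [h1, hwu]
  by_cases h : ∃ w ∈ A, w ∉ ({v} : Finset V) ∧ w ∉ H.nb A {v}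
  · exact (hT.conn {v} (by simpa using hv) (by simp) h).trans (Finset.card_le_card hsub)
  · push Not at h
    have h2 : A.erase v ⊆ A.filter fun u => H.Adj v u := by
      intro u hu
      rw [Finset.mem_erase] at hu
      exact hsub (h u hu.2 (by simpa using hu.1))
    have := Finset.card_le_card h2
    rw [Finset.card_erase_of_mem hv] at this
    have := hT.card
    unfold degIn
    omega

/-- Counting degrees: every vertex of `Z` has at least three neighbours, at most `Z.card - 1` of
them in `Z`. -/
theorem sum_bound {Z : Finset V} (hZ : Z ⊆ A) : 3 * Z.card ≤ H.cutSize A Z + Z.card * (Z.card - 1) := by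
  rw [cutSize_eq_sum hZ]
  have : ∑ _u ∈ Z, 3 ≤ ∑ u ∈ Z, (H.degIn (A \ Z) u + (Z.card - 1)) :=
    Finset.sum_le_sum fun u hu => (hT.three_le_degIn (hZ hu)).trans (degIn_le_degIn_sdiff_add hu)
  rw [Finset.sum_add_distrib] at this
  simp only [Finset.sum_const, smul_eq_mul] at this
  linarith

theorem sum_bound_lt {Z : Finset V} (hZ : Z ⊆ A) {g : V} (hg : g ∈ Z) (hd : 4 ≤ H.degIn A g) :
    3 * Z.card < H.cutSize A Z + Z.card * (Z.card - 1) := by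
  rw [cutSize_eq_sum hZ]
  have : ∑ _u ∈ Z, 3 < ∑ u ∈ Z, (H.degIn (A \ Z) u + (Z.card - 1)) := by
    refine Finset.sum_lt_sum (fun u hu => ?_) ⟨g, hg, ?_⟩
    · exact (hT.three_le_degIn (hZ hu)).trans (degIn_le_degIn_sdiff_add hu)
    · have := degIn_le_degIn_sdiff_add (H := H) (A := A) hg
      omega
  rw [Finset.sum_add_distrib] at this
  simp only [Finset.sum_const, smul_eq_mul] at this
  linarith

/-- The side of a cut with three edges is large if it contains a vertex of degree at least 4. -/
theorem four_le_card {Z : Finset V} (hZ : Z ⊆ A) {g : V} (hg : g ∈ Z) (hd : 4 ≤ H.degIn A g)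
    (h3 : H.cutSize A Z ≤ 3) : 4 ≤ Z.card := by
  have h := hT.sum_bound_lt hZ hg hd
  by_contra hc
  have : Z.card < 4 := by omega
  have := Finset.card_pos.2 ⟨g, hg⟩
  interval_cases Z.card <;> omega

theorem three_le_cutSize {Z : Finset V} (hZ : Z ⊆ A) (hne : Z.Nonempty)
    (hp : ∃ v ∈ A, v ∉ Z) : 3 ≤ H.cutSize A Z := by
  by_contra hlt
  have h1 := card_nb_le_cutSize (H := H) Z hZ
  have h2 : A \ Z ⊆ H.nb A Z := by
    intro v hv
    rw [Finset.mem_sdiff] at hv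
    by_contra hvn
    have := hT.conn Z hZ hne ⟨v, hv.1, hv.2, hvn⟩
    omega
  have h3 := Finset.card_le_card h2
  have h4 := hT.sum_bound (Finset.sdiff_subset (s := A) (t := Z))
  rw [cutSize_sdiff] at h4
  obtain ⟨v, hv, hvZ⟩ := hp
  have h5 : 0 < (A \ Z).card := Finset.card_pos.2 ⟨v, by simp [hv, hvZ]⟩
  have h6 : (A \ Z).card ≤ 2 := by omega
  interval_cases (A \ Z).card <;> omega

/-- A tight graph stays connected when two vertices are deleted. -/
theorem closed_eq {R : V → Prop} {p q t : V} (ht : t ∈ A) (htR : R t)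
    (hR : ∀ u ∈ A, ∀ v ∈ A, R u → H.Adj u v → R v ∨ v = p ∨ v = q)
    {v : V} (hv : v ∈ A) : R v ∨ v = p ∨ v = q := by
  classical
  by_contra hcon
  have hnb : ∀ w ∈ H.nb A (A.filter R), w = p ∨ w = q := by
    intro w hw
    obtain ⟨hwA, hwR, u, hu, huw⟩ := mem_nb.1 hw
    simp only [Finset.mem_filter] at hu hwR
    exact (hR u hu.1 w hwA hu.2 huw).resolve_left fun h => hwR ⟨hwA, h⟩
  have := hT.conn (A.filter R) (Finset.filter_subset _ _) ⟨t, by simp [ht, htR]⟩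
    ⟨v, hv, by simp; tauto, fun h => hcon (Or.inr (hnb v h))⟩
  have := card_le_of_subset_pair hnb
  omega

/-- A vertex `h` that is not dominating has a vertex `z` at distance two. -/
theorem exists_dist_two {h : V} (hh : h ∈ A) (hno : ∃ v ∈ A, v ≠ h ∧ ¬ H.Adj h v) :
    ∃ z t, z ∈ A ∧ t ∈ A ∧ z ≠ h ∧ ¬ H.Adj h z ∧ H.Adj h t ∧ H.Adj t z := by
  classical
  obtain ⟨v, hv, hvh, hhv⟩ := hno
  let Q := insert h (A.filter fun u => H.Adj h u)
  have hQA : Q ⊆ A := by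
    intro u hu
    rcases Finset.mem_insert.1 hu with rfl | hu
    exacts [hh, (Finset.mem_filter.1 hu).1]
  obtain ⟨z, hz⟩ : (H.nb A Q).Nonempty := by
    by_contra hne
    rw [Finset.not_nonempty_iff_eq_empty] at hne
    have := hT.conn Q hQA ⟨h, by simp [Q]⟩ ⟨v, hv, by simp [Q, hv, hvh, hhv], by simp [hne]⟩
    simp [hne] at this
  obtain ⟨hzA, hzQ, t, ht, htz⟩ := mem_nb.1 hz
  simp only [Q, Finset.mem_insert, Finset.mem_filter, not_or, not_and] at hzQ ht
  refine ⟨z, t, hzA, hT.mem htz, hzQ.1, hzQ.2 hzA, ?_, htz⟩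
  rcases ht with rfl | ht
  · exact absurd htz (hzQ.2 hzA)
  · exact ht.2

end Tight

end

/-! ### Splitting along a 3-edge cut -/

/-- The edges between `X` and `A \ X` are exactly the three disjoint edges `x j y j`. -/
structure IsMatchingCut {V : Type*} (H : SimpleGraph V) (A X : Finset V) (x y : Fin 3 → V) :
    Prop where
  sub : X ⊆ A
  x_mem : ∀ j, x j ∈ X
  y_mem : ∀ j, y j ∈ A
  y_notMem : ∀ j, y j ∉ X
  x_inj : Function.Injective x
  y_inj : Function.Injective y
  adj : ∀ j, H.Adj (x j) (y j)
  cut : ∀ u ∈ X, ∀ v ∈ A, v ∉ X → H.Adj u v → ∃ j, u = x j ∧ v = y j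

open Classical in
/-- The vertices that remain when `X` is cut down to the vertices `x j`. -/
noncomputable def splitSet {V : Type*} (A X : Finset V) (x : Fin 3 → V) : Finset V :=
  A.filter fun v => v ∉ X ∨ ∃ j, v = x j

/-- The graph `H` on `A` with `X` replaced by a triangle on the vertices `x j`. -/
def splitGraph {V : Type*} (H : SimpleGraph V) (A X : Finset V) (x : Fin 3 → V) :
    SimpleGraph V where
  Adj u v := (u ∈ splitSet A X x ∧ v ∈ splitSet A X x ∧ H.Adj u v) ∨
    (u ≠ v ∧ (∃ j, u = x j) ∧ ∃ j, v = x j)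
  symm := ⟨by
    rintro u v (⟨h1, h2, h3⟩ | ⟨h1, h2, h3⟩)
    · exact Or.inl ⟨h2, h1, h3.symm⟩
    · exact Or.inr ⟨h1.symm, h3, h2⟩⟩
  loopless := ⟨by
    rintro u (⟨-, -, h⟩ | ⟨h, -⟩)
    · exact H.loopless.irrefl u h
    · exact h rfl⟩

section

variable {V : Type*} {H : SimpleGraph V} {A X : Finset V} {x y : Fin 3 → V}

theorem mem_splitSet {v : V} : v ∈ splitSet A X x ↔ v ∈ A ∧ (v ∉ X ∨ ∃ j, v = x j) := by
  simp [splitSet]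

theorem splitGraph_adj {u v : V} : (splitGraph H A X x).Adj u v ↔
    (u ∈ splitSet A X x ∧ v ∈ splitSet A X x ∧ H.Adj u v) ∨
    (u ≠ v ∧ (∃ j, u = x j) ∧ ∃ j, v = x j) := Iff.rfl

namespace IsMatchingCut

/-- The two sides of a matching cut are interchangeable. -/
theorem symm [DecidableEq V] (hC : IsMatchingCut H A X x y) : IsMatchingCut H A (A \ X) y x where
  sub := Finset.sdiff_subset
  x_mem j := by simp [hC.y_mem j, hC.y_notMem j]
  y_mem j := hC.sub (hC.x_mem j)
  y_notMem j := by simp [hC.x_mem j]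
  x_inj := hC.y_inj
  y_inj := hC.x_inj
  adj j := (hC.adj j).symm
  cut u hu v hv hvX huv := by
    rw [Finset.mem_sdiff] at hu
    have : v ∈ X := by
      by_contra h
      exact hvX (by simp [hv, h])
    obtain ⟨j, h1, h2⟩ := hC.cut v this u hu.1 hu.2 huv.symm
    exact ⟨j, h2, h1⟩

variable (hC : IsMatchingCut H A X x y)
include hC

theorem x_mem_splitSet (j : Fin 3) : x j ∈ splitSet A X x :=
  mem_splitSet.2 ⟨hC.sub (hC.x_mem j), Or.inr ⟨j, rfl⟩⟩

theorem mem_of_adj {u v : V}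
    (h : (splitGraph H A X x).Adj u v) : u ∈ splitSet A X x := by
  rcases h with h | ⟨-, ⟨j, rfl⟩, -⟩
  exacts [h.1, hC.x_mem_splitSet j]

theorem adj_iff {u v : V} (hu : u ∈ A) (huX : u ∉ X) (hv : v ∈ A) :
    v ∈ splitSet A X x ∧ (splitGraph H A X x).Adj u v ↔ H.Adj u v := by
  have hu' : ¬ ∃ j, u = x j := by
    rintro ⟨j, rfl⟩
    exact huX (hC.x_mem j)
  rw [splitGraph_adj]
  constructor
  · rintro ⟨-, h | h⟩
    exacts [h.2.2, absurd h.2.1 hu']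
  · intro h
    have hv' : v ∈ splitSet A X x := by
      refine mem_splitSet.2 ⟨hv, ?_⟩
      by_cases hvX : v ∈ X
      · obtain ⟨j, h1, -⟩ := hC.cut v hvX u hu huX h.symm
        exact Or.inr ⟨j, h1⟩
      · exact Or.inl hvX
    exact ⟨hv', Or.inl ⟨mem_splitSet.2 ⟨hu, Or.inl huX⟩, hv', h⟩⟩

theorem adj_x_iff {j : Fin 3} {v : V} (hv : v ∈ A) (hvX : v ∉ X) :
    (splitGraph H A X x).Adj (x j) v ↔ v = y j := by
  rw [splitGraph_adj]
  constructor
  · rintro (h | ⟨-, -, i, rfl⟩)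
    · obtain ⟨i, h1, h2⟩ := hC.cut _ (hC.x_mem j) v hv hvX h.2.2
      rw [h2, hC.x_inj h1]
    · exact absurd (hC.x_mem i) hvX
  · rintro rfl
    exact Or.inl ⟨hC.x_mem_splitSet j, mem_splitSet.2 ⟨hv, Or.inl hvX⟩, hC.adj j⟩

theorem degIn_eq {v : V} (hv : v ∈ A) (hvX : v ∉ X) :
    (splitGraph H A X x).degIn (splitSet A X x) v = H.degIn A v := by
  classical
  unfold degIn
  congr 1
  ext u
  simp only [Finset.mem_filter]
  constructor
  · rintro ⟨h1, h2⟩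
    have := (mem_splitSet.1 h1).1
    exact ⟨this, (hC.adj_iff hv hvX this).1 ⟨h1, h2⟩⟩
  · rintro ⟨h1, h2⟩
    exact (hC.adj_iff hv hvX h1).2 h2

theorem degIn_x_le (j : Fin 3) : (splitGraph H A X x).degIn (splitSet A X x) (x j) ≤ 3 := by
  classical
  have : (splitSet A X x).filter (fun u => (splitGraph H A X x).Adj (x j) u) ⊆
      insert (y j) ((Finset.univ.erase j).image x) := by
    intro u hu
    simp only [Finset.mem_filter] at hu
    by_cases huX : u ∈ X
    · obtain ⟨i, rfl⟩ := (mem_splitSet.1 hu.1).2.resolve_left (not_not.2 huX)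
      refine Finset.mem_insert_of_mem (Finset.mem_image_of_mem _ ?_)
      simp only [Finset.mem_erase, Finset.mem_univ, and_true]
      rintro rfl
      exact hu.2.ne rfl
    · rw [(hC.adj_x_iff (mem_splitSet.1 hu.1).1 huX).1 hu.2]
      simp
  refine (Finset.card_le_card this).trans ((Finset.card_insert_le _ _).trans ?_)
  have := Finset.card_image_le (s := Finset.univ.erase j) (f := x)
  simp at this
  omega

/-- No vertex is adjacent to all others once `X` has been replaced by a triangle. -/
theorem exists_not_adj (h : V) : ∃ v ∈ splitSet A X x, v ≠ h ∧ ¬ (splitGraph H A X x).Adj h v := by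
  have hY : ∀ j, y j ∈ splitSet A X x := fun j => mem_splitSet.2 ⟨hC.y_mem j, Or.inl (hC.y_notMem j)⟩
  by_cases hh : ∃ i, h = x i
  · obtain ⟨i, rfl⟩ := hh
    obtain ⟨j, hj⟩ : ∃ j : Fin 3, j ≠ i := exists_ne i
    refine ⟨y j, hY j, fun h => hC.y_notMem j (h ▸ hC.x_mem i), fun h => hj ?_⟩
    exact hC.y_inj ((hC.adj_x_iff (hC.y_mem j) (hC.y_notMem j)).1 h)
  · obtain ⟨j, hj⟩ : ∃ j : Fin 3, y j ≠ h := by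
      by_contra! hall
      exact absurd (hC.y_inj ((hall 0).trans (hall 1).symm)) (by decide)
    refine ⟨x j, hC.x_mem_splitSet j, fun h => hh ⟨j, h.symm⟩, fun hadj => ?_⟩
    rcases hadj with hadj | hadj
    · have h1 := mem_splitSet.1 hadj.1
      have := (hC.adj_x_iff h1.1 (h1.2.resolve_right hh)).1 (Or.inl ⟨hadj.2.1, hadj.1, hadj.2.2.symm⟩)
      exact hj this.symm
    · exact hh hadj.2.1

/-- Replacing a side of a matching cut by a triangle keeps the graph 3-connected. -/
theorem conn_split [DecidableEq V] (hT : Tight H A) (Q : Finset V) (hQ : Q ⊆ splitSet A X x)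
    (hw : ∃ w ∈ splitSet A X x, w ∉ Q ∧ w ∉ (splitGraph H A X x).nb (splitSet A X x) Q)
    (hne : Q.Nonempty) :
    3 ≤ ((splitGraph H A X x).nb (splitSet A X x) Q).card := by
  classical
  set H' := splitGraph H A X x
  set A' := splitSet A X x
  have hA' : A' ⊆ A := fun v hv => (mem_splitSet.1 hv).1
  -- sets that avoid the triangle have the same boundary in both graphs
  have base : ∀ Q ⊆ A', Q.Nonempty → (∀ j, x j ∉ Q) → (∃ w ∈ A', w ∉ Q ∧ w ∉ H'.nb A' Q) →
      3 ≤ (H'.nb A' Q).card := by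
    intro Q hQ hne hx hw
    have hQX : ∀ u ∈ Q, u ∉ X := by
      intro u hu huX
      obtain ⟨j, rfl⟩ := (mem_splitSet.1 (hQ hu)).2.resolve_left (not_not.2 huX)
      exact hx j hu
    have : H'.nb A' Q = H.nb A Q := by
      ext v
      rw [mem_nb, mem_nb]
      constructor
      · rintro ⟨h1, h2, u, hu, huv⟩
        exact ⟨hA' h1, h2, u, hu, (hC.adj_iff (hA' (hQ hu)) (hQX u hu) (hA' h1)).1 ⟨h1, huv⟩⟩
      · rintro ⟨h1, h2, u, hu, huv⟩
        have := (hC.adj_iff (hA' (hQ hu)) (hQX u hu) h1).2 huv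
        exact ⟨this.1, h2, u, hu, this.2⟩
    obtain ⟨w, h1, h2, h3⟩ := hw
    rw [this] at h3 ⊢
    exact hT.conn Q (hQ.trans hA') hne ⟨w, hA' h1, h2, h3⟩
  by_cases hx : ∀ j, x j ∉ Q
  · exact base Q hQ hne hx hw
  · push Not at hx
    obtain ⟨i, hi⟩ := hx
    -- otherwise the vertices beyond the boundary of `Q` avoid the triangle
    let W := A'.filter fun v => v ∉ Q ∧ v ∉ H'.nb A' Q
    have hWnb : H'.nb A' W ⊆ H'.nb A' Q := by
      intro v hv
      obtain ⟨h1, h2, u, hu, huv⟩ := mem_nb.1 hv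
      simp only [W, Finset.mem_filter, not_and, not_not] at hu h2
      by_cases hvQ : v ∈ Q
      · exact absurd (mem_nb.2 ⟨hu.1, hu.2.1, v, hvQ, huv.symm⟩) hu.2.2
      · exact h2 h1 hvQ
    obtain ⟨w, h1, h2, h3⟩ := hw
    refine (base W (Finset.filter_subset _ _) ⟨w, by simp [W, *]⟩ ?_ ⟨x i, hQ hi, ?_, ?_⟩).trans
      (Finset.card_le_card hWnb)
    · intro j hj
      simp only [W, Finset.mem_filter] at hj
      refine hj.2.2 (mem_nb.2 ⟨hj.1, hj.2.1, x i, hi, Or.inr ⟨?_, ⟨i, rfl⟩, j, rfl⟩⟩)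
      intro h
      exact hj.2.1 (h ▸ hi)
    · simp [W, hi]
    · intro h
      exact (mem_nb.1 (hWnb h)).2.1 hi

/-- If the vertices `x j` do not all lie on the same side of `Z`, then `Z` cuts an edge inside
`X`. -/
theorem exists_adj_of_split (hT : Tight H A) {Z : Finset V} {i j : Fin 3} (hi : x i ∈ Z)
    (hj : x j ∉ Z) : ∃ u ∈ X, ∃ v ∈ X, u ∈ Z ∧ v ∉ Z ∧ H.Adj u v := by
  classical
  by_contra! hno
  let I := Finset.univ.filter fun k : Fin 3 => x k ∈ Z
  have hsub : H.nb A (X ∩ Z) ⊆ I.image y := by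
    intro v hv
    obtain ⟨h1, h2, u, hu, huv⟩ := mem_nb.1 hv
    simp only [Finset.mem_inter, not_and] at hu h2
    by_cases hvX : v ∈ X
    · exact absurd huv (hno u hu.1 v hvX hu.2 (h2 hvX))
    · obtain ⟨k, rfl, rfl⟩ := hC.cut u hu.1 v h1 hvX huv
      exact Finset.mem_image_of_mem _ (by simp [I, hu.2])
  have h3 := (hT.conn (X ∩ Z) (Finset.inter_subset_left.trans hC.sub)
    ⟨x i, by simp [hC.x_mem, hi]⟩ ⟨x j, hC.sub (hC.x_mem j), by simp [hj], fun h => ?_⟩).trans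
    ((Finset.card_le_card hsub).trans Finset.card_image_le)
  · have hI : I = Finset.univ := Finset.eq_univ_of_card _ (le_antisymm (Finset.card_le_univ _) h3)
    have : j ∈ I := hI ▸ Finset.mem_univ j
    exact hj (by simpa [I] using this)
  · obtain ⟨k, -, hk⟩ := Finset.mem_image.1 (hsub h)
    exact hC.y_notMem k (hk ▸ hC.x_mem j)

/-- Replacing a side of a matching cut by a triangle keeps the graph tight. Let `Z` be a cut with at
most three edges, `F` of them outside of `X`, that separates two of the remaining vertices outside
of `X`. If `F ≤ 2`, then the triangle is put to the side of `Z` that contains most of its three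
neighbours, which costs at most one edge. If `F = 3`, then `Z` does not split `X`. -/
theorem tight_split [DecidableEq V] (hT : Tight H A) :
    Tight (splitGraph H A X x) (splitSet A X x) := by
  classical
  have hA' : splitSet A X x ⊆ A := fun v hv => (mem_splitSet.1 hv).1
  refine ⟨hC.mem_of_adj, ?_, fun Q hQ hne hw => hC.conn_split hT Q hQ hw hne, ?_⟩
  · have hsub : Finset.univ.image x ∪ {y 0} ⊆ splitSet A X x := by
      intro v hv
      simp only [Finset.mem_union, Finset.mem_image, Finset.mem_univ, true_and,
        Finset.mem_singleton] at hv
      rcases hv with ⟨j, rfl⟩ | rfl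
      · exact hC.x_mem_splitSet j
      · exact mem_splitSet.2 ⟨hC.y_mem 0, Or.inl (hC.y_notMem 0)⟩
    have := Finset.card_le_card hsub
    rwa [Finset.card_union_of_disjoint, Finset.card_image_of_injective _ hC.x_inj, Finset.card_univ,
      Fintype.card_fin, Finset.card_singleton] at this
    simp only [Finset.disjoint_singleton_right, Finset.mem_image, not_exists]
    rintro j ⟨-, h⟩
    exact hC.y_notMem 0 (h ▸ hC.x_mem j)
  · intro a ha b hb hab
    by_cases hax : ∃ i, a = x i
    · obtain ⟨i, rfl⟩ := hax
      exact ⟨{x i}, by simpa using ha, by simp, by simpa using hab.symm,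
        (cutSize_singleton_le _).trans (hC.degIn_x_le i)⟩
    by_cases hbx : ∃ i, b = x i
    · obtain ⟨i, rfl⟩ := hbx
      refine ⟨splitSet A X x \ {x i}, Finset.sdiff_subset, by simp [ha, hab], by simp, ?_⟩
      rw [cutSize_sdiff]
      exact (cutSize_singleton_le _).trans (hC.degIn_x_le i)
    obtain ⟨haA, haX⟩ := mem_splitSet.1 ha
    obtain ⟨hbA, hbX⟩ := mem_splitSet.1 hb
    replace haX := haX.resolve_right hax
    replace hbX := hbX.resolve_right hbx
    obtain ⟨Z, hZA, haZ, hbZ, hZ⟩ := hT.cut a haA b hbA hab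
    -- the cut edges outside of `X`
    let F := (A ×ˢ A).filter fun p => p.1 ∈ Z ∧ p.1 ∉ X ∧ p.2 ∉ Z ∧ p.2 ∉ X ∧ H.Adj p.1 p.2
    let I := Finset.univ.filter fun j => y j ∈ Z
    let O := Finset.univ.filter fun j => y j ∉ Z
    have hcard : I.card + O.card = 3 :=
      Finset.card_filter_add_card_filter_not (s := Finset.univ) (fun k : Fin 3 => y k ∈ Z)
    have hFZ : F ⊆ H.cutEdges A Z := by
      intro p hp
      simp only [F, Finset.mem_filter, Finset.mem_product] at hp
      rw [mem_cutEdges]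
      tauto
    have hF3 : F.card ≤ 3 := (Finset.card_le_card hFZ).trans hZ
    have hadj : ∀ u v, u ∈ A → u ∉ X → v ∈ splitSet A X x → (splitGraph H A X x).Adj u v →
        H.Adj u v := fun u v hu huX hv h => (hC.adj_iff hu huX (hA' hv)).1 ⟨hv, h⟩
    have hI : (splitGraph H A X x).cutSize (splitSet A X x) (Z \ X) ≤ F.card + I.card := by
      refine le_trans (Finset.card_le_card (t := F ∪ I.image fun j => (y j, x j)) ?_)
        ((Finset.card_union_le _ _).trans (Nat.add_le_add_left Finset.card_image_le _))
      rintro ⟨u, v⟩ hp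
      simp only [mem_cutEdges, Finset.mem_sdiff, not_and, not_not] at hp
      obtain ⟨⟨hu, hv⟩, ⟨huZ, huX⟩, hvZ, huv⟩ := hp
      have huv' := hadj u v (hA' hu) huX hv huv
      by_cases hvX : v ∈ X
      · obtain ⟨j, rfl, rfl⟩ := hC.cut v hvX u (hA' hu) huX huv'.symm
        exact Finset.mem_union_right _ (Finset.mem_image.2 ⟨j, by simp [I, huZ], rfl⟩)
      · refine Finset.mem_union_left _ ?_
        simp only [F, Finset.mem_filter, Finset.mem_product]
        exact ⟨⟨hA' hu, hA' hv⟩, huZ, huX, fun h => hvX (hvZ h), hvX, huv'⟩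
    have hO : (splitGraph H A X x).cutSize (splitSet A X x) (Z \ X ∪ Finset.univ.image x) ≤
        F.card + O.card := by
      refine le_trans (Finset.card_le_card (t := F ∪ O.image fun j => (x j, y j)) ?_)
        ((Finset.card_union_le _ _).trans (Nat.add_le_add_left Finset.card_image_le _))
      rintro ⟨u, v⟩ hp
      simp only [mem_cutEdges, Finset.mem_union, Finset.mem_sdiff,
        Finset.mem_image, Finset.mem_univ, true_and, not_or, not_and, not_not, not_exists] at hp
      obtain ⟨⟨hu, hv⟩, huZ, ⟨hvZ, hvx⟩, huv⟩ := hp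
      have hvX : v ∉ X := by
        intro h
        obtain ⟨j, rfl⟩ := (mem_splitSet.1 hv).2.resolve_left (not_not.2 h)
        exact hvx j rfl
      have hvZ' : v ∉ Z := fun h => hvX (hvZ h)
      rcases huZ with ⟨huZ, huX⟩ | ⟨j, rfl⟩
      · refine Finset.mem_union_left _ ?_
        simp only [F, Finset.mem_filter, Finset.mem_product]
        exact ⟨⟨hA' hu, hA' hv⟩, huZ, huX, hvZ', hvX, hadj u v (hA' hu) huX hv huv⟩
      · have := (hC.adj_x_iff (hA' hv) hvX).1 huv
        subst this
        exact Finset.mem_union_right _ (Finset.mem_image.2 ⟨j, by simp [O, hvZ'], rfl⟩)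
    have use1 : (splitGraph H A X x).cutSize (splitSet A X x) (Z \ X) ≤ 3 →
        ∃ Z ⊆ splitSet A X x, a ∈ Z ∧ b ∉ Z ∧
          (splitGraph H A X x).cutSize (splitSet A X x) Z ≤ 3 := by
      intro h
      refine ⟨Z \ X, fun v hv => ?_, by simp [haZ, haX], by simp [hbZ], h⟩
      rw [Finset.mem_sdiff] at hv
      exact mem_splitSet.2 ⟨hZA hv.1, Or.inl hv.2⟩
    have use2 : (splitGraph H A X x).cutSize (splitSet A X x) (Z \ X ∪ Finset.univ.image x) ≤ 3 →
        ∃ Z ⊆ splitSet A X x, a ∈ Z ∧ b ∉ Z ∧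
          (splitGraph H A X x).cutSize (splitSet A X x) Z ≤ 3 := by
      intro h
      refine ⟨_, fun v hv => ?_, by simp [haZ, haX], ?_, h⟩
      · simp only [Finset.mem_union, Finset.mem_sdiff, Finset.mem_image, Finset.mem_univ,
          true_and] at hv
        rcases hv with hv | ⟨j, rfl⟩
        · exact mem_splitSet.2 ⟨hZA hv.1, Or.inl hv.2⟩
        · exact hC.x_mem_splitSet j
      · simp only [Finset.mem_union, Finset.mem_sdiff, Finset.mem_image, Finset.mem_univ,
          true_and, not_or, not_exists]
        exact ⟨fun h => hbZ h.1, fun j h => hbx ⟨j, h.symm⟩⟩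
    by_cases hF2 : F.card ≤ 2
    · by_cases hI1 : I.card ≤ 1
      · exact use1 (by omega)
      · exact use2 (by omega)
    · -- all cut edges lie outside of `X`, hence `Z` splits neither the triangle nor the matching
      have hFeq := Finset.eq_of_subset_of_card_le hFZ (by
        have : H.cutSize A Z ≤ F.card := by omega
        exact this)
      have hcutX : ∀ u v, u ∈ Z → v ∉ Z → H.Adj u v → u ∉ X ∧ v ∉ X := by
        intro u v hu hv huv
        have : (u, v) ∈ F := by
          rw [hFeq]
          simp [mem_cutEdges, hT.mem huv, hT.mem huv.symm, hu, hv, huv]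
        simp only [F, Finset.mem_filter] at this
        tauto
      have hxy : ∀ j, x j ∈ Z ↔ y j ∈ Z := by
        intro j
        by_cases h1 : x j ∈ Z <;> by_cases h2 : y j ∈ Z <;> simp only [h1, h2]
        · exact absurd (hC.x_mem j) (hcutX _ _ h1 h2 (hC.adj j)).1
        · exact absurd (hC.x_mem j) (hcutX _ _ h2 h1 (hC.adj j).symm).2
      have hside : ∀ i j, x i ∈ Z → x j ∈ Z := by
        intro i j hi
        by_contra hj
        obtain ⟨u, hu, v, hv, huZ, hvZ, huv⟩ := hC.exists_adj_of_split hT hi hj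
        exact (hcutX u v huZ hvZ huv).1 hu
      by_cases h0 : x 0 ∈ Z
      · have : O = ∅ := by
          refine Finset.filter_eq_empty_iff.2 fun j _ => not_not.2 ((hxy j).1 (hside 0 j h0))
        rw [this] at hO
        exact use2 (by simpa using hO.trans (by simpa using hF3))
      · have : I = ∅ := by
          refine Finset.filter_eq_empty_iff.2 fun j _ h => h0 (hside j 0 ((hxy j).2 h))
        rw [this] at hI
        exact use1 (by simpa using hI.trans (by simpa using hF3))

end IsMatchingCut

end

section

variable {V : Type*} [DecidableEq V] {H : SimpleGraph V} {A X : Finset V} {x y : Fin 3 → V}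

/-- The side `X` of a matching cut is connected. -/
theorem IsMatchingCut.closed_eq (hC : IsMatchingCut H A X x y) (hT : Tight H A) {R : V → Prop}
    {i : Fin 3} (hi : R (x i)) (hR : ∀ u ∈ X, ∀ v ∈ X, R u → H.Adj u v → R v) {v : V} (hv : v ∈ X) :
    R v := by
  classical
  have hx : ∀ j, R (x j) := by
    intro j
    by_contra hj
    obtain ⟨u, hu, w, hw, huR, hwR, huw⟩ := hC.exists_adj_of_split hT (Z := A.filter R) (i := i)
      (j := j) (by simp [hi, hC.sub (hC.x_mem i)]) (by simp [hj])
    simp only [Finset.mem_filter, not_and] at huR hwR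
    exact hwR (hC.sub hw) (hR u hu w hw huR.2 huw)
  by_contra hvR
  let Q := X.filter fun u => ¬ R u
  have hQ : H.nb A Q = ∅ := by
    rw [Finset.eq_empty_iff_forall_notMem]
    intro w hw
    obtain ⟨hwA, hwQ, u, hu, huw⟩ := mem_nb.1 hw
    simp only [Q, Finset.mem_filter, not_and, not_not] at hu hwQ
    by_cases hwX : w ∈ X
    · exact hu.2 (hR w hwX u hu.1 (hwQ hwX) huw.symm)
    · obtain ⟨j, rfl, -⟩ := hC.cut u hu.1 w hwA hwX huw
      exact hu.2 (hx j)
  have := hT.conn Q ((Finset.filter_subset _ _).trans hC.sub) ⟨v, by simp [Q, hv, hvR]⟩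
    ⟨x i, hC.sub (hC.x_mem i), by simp [Q, hi], by simp [hQ]⟩
  simp [hQ] at this

/-- The ends in `X` of the edges that leave `X` separate the rest of `X`, so there are three of
them. -/
theorem Tight.three_le_card_ends (hT : Tight H A) (hX : X ⊆ A) (h4 : 4 ≤ X.card)
    (hne : ∃ v ∈ A, v ∉ X) : 3 ≤ ((H.cutEdges A X).image Prod.fst).card := by
  by_contra hlt
  set B := (H.cutEdges A X).image Prod.fst with hB
  obtain ⟨g, hg, hgX⟩ := hne
  have hBX : B ⊆ X := by
    intro u hu
    obtain ⟨p, hp, rfl⟩ := Finset.mem_image.1 hu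
    exact (mem_cutEdges.1 hp).2.1
  have hnb : H.nb A (X \ B) ⊆ B := by
    intro w hw
    obtain ⟨hwA, hwQ, u, hu, huw⟩ := mem_nb.1 hw
    rw [Finset.mem_sdiff] at hu
    by_cases hwX : w ∈ X
    · by_contra hwB
      exact hwQ (Finset.mem_sdiff.2 ⟨hwX, hwB⟩)
    · exact absurd (Finset.mem_image.2 ⟨(u, w),
        mem_cutEdges.2 ⟨⟨hX hu.1, hwA⟩, hu.1, hwX, huw⟩, rfl⟩) hu.2
  have h1 := Finset.le_card_sdiff B X
  have := hT.conn (X \ B) (Finset.sdiff_subset.trans hX) (Finset.card_pos.1 (by omega))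
    ⟨g, hg, by simp [hgX], fun h => hgX (hBX (hnb h))⟩
  have := Finset.card_le_card hnb
  omega

/-- A cut with three edges and two large sides is a matching. -/
theorem Tight.exists_matchingCut (hT : Tight H A) (hX : X ⊆ A) (h3 : H.cutSize A X ≤ 3)
    (h4 : 4 ≤ X.card) (h4' : 4 ≤ (A \ X).card) : ∃ x y, IsMatchingCut H A X x y := by
  have hne : ∃ v ∈ A, v ∉ X := by
    obtain ⟨v, hv⟩ := Finset.card_pos.1 (show 0 < (A \ X).card by omega)
    exact ⟨v, by simpa using hv⟩
  have hne' : ∃ v ∈ A, v ∉ A \ X := by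
    obtain ⟨v, hv⟩ := Finset.card_pos.1 (show 0 < X.card by omega)
    exact ⟨v, hX hv, by simp [hv]⟩
  have hfst := hT.three_le_card_ends hX h4 hne
  have hsnd : 3 ≤ ((H.cutEdges A X).image Prod.snd).card := by
    refine (hT.three_le_card_ends Finset.sdiff_subset h4' hne').trans (Finset.card_le_card ?_)
    intro u hu
    obtain ⟨⟨u, w⟩, hp, rfl⟩ := Finset.mem_image.1 hu
    rw [mem_cutEdges] at hp
    simp only [Finset.mem_sdiff, not_and, not_not] at hp
    exact Finset.mem_image.2 ⟨(w, u), mem_cutEdges.2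
      ⟨⟨hp.1.2, hp.1.1⟩, hp.2.2.1 hp.1.2, hp.2.1.2, hp.2.2.2.symm⟩, rfl⟩
  have hcard : (H.cutEdges A X).card = 3 := le_antisymm h3 (hfst.trans Finset.card_image_le)
  have hinj1 : Set.InjOn Prod.fst (H.cutEdges A X : Set (V × V)) :=
    Finset.card_image_iff.1 (le_antisymm Finset.card_image_le (by omega))
  have hinj2 : Set.InjOn Prod.snd (H.cutEdges A X : Set (V × V)) :=
    Finset.card_image_iff.1 (le_antisymm Finset.card_image_le (by omega))
  let e := (Finset.equivFinOfCardEq hcard).symm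
  have he := fun j => mem_cutEdges.1 (e j).2
  refine ⟨fun j => (e j : V × V).1, fun j => (e j : V × V).2, hX, fun j => (he j).2.1,
    fun j => (he j).1.2, fun j => (he j).2.2.1, ?_, ?_, fun j => (he j).2.2.2, ?_⟩
  · intro i j h
    exact e.injective (Subtype.ext (hinj1 (e i).2 (e j).2 h))
  · intro i j h
    exact e.injective (Subtype.ext (hinj2 (e i).2 (e j).2 h))
  · intro u hu v hv hvX huv
    refine ⟨e.symm ⟨(u, v), mem_cutEdges.2 ⟨⟨hX hu, hv⟩, hu, hvX, huv⟩⟩, ?_, ?_⟩ <;> simp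

/-- A tight graph with two vertices of degree at least 4 has a matching cut with a side `X`
that contains exactly one such vertex: an inclusion-minimal one, by submodularity. -/
theorem Tight.exists_leaf (hT : Tight H A) {g g' : V} (hg : g ∈ A) (hg' : g' ∈ A) (hne : g ≠ g')
    (hd : 4 ≤ H.degIn A g) (hd' : 4 ≤ H.degIn A g') :
    ∃ X x y h, IsMatchingCut H A X x y ∧ h ∈ X ∧ (∀ v ∈ X, v ≠ h → H.degIn A v ≤ 3) ∧
      ∃ v ∈ X, ∀ j, v ≠ x j := by
  obtain ⟨Z, hZA, hgZ, hgZ', hZ3⟩ := hT.cut g hg g' hg' hne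
  obtain ⟨X, ⟨hXA, ⟨h, hhX, hh⟩, ⟨a, haA, haX, ha⟩, hX3⟩, hmin⟩ := WellFounded.has_min
    (measure (Finset.card : Finset V → ℕ)).wf {X | X ⊆ A ∧ (∃ h ∈ X, 4 ≤ H.degIn A h) ∧
      (∃ a ∈ A, a ∉ X ∧ 4 ≤ H.degIn A a) ∧ H.cutSize A X ≤ 3}
    ⟨Z, hZA, ⟨g, hgZ, hd⟩, ⟨g', hg', hgZ', hd'⟩, hZ3⟩
  have h4 := hT.four_le_card hXA hhX hh hX3
  have h4' := hT.four_le_card (Finset.sdiff_subset (s := A) (t := X)) (g := a) (by simp [haA, haX]) ha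
    (by rwa [cutSize_sdiff])
  obtain ⟨x, y, hC⟩ := hT.exists_matchingCut hXA hX3 h4 h4'
  refine ⟨X, x, y, h, hC, hhX, ?_, ?_⟩
  · intro v hv hvh
    by_contra hvd
    -- a cut that separates two such vertices of `X` can be uncrossed with `X`
    have key : ∀ Z ⊆ A, H.cutSize A Z ≤ 3 → a ∉ Z → (∃ p ∈ X, p ∈ Z ∧ 4 ≤ H.degIn A p) →
        (∃ q ∈ X, q ∉ Z) → False := by
      rintro Z hZA hZ haZ ⟨p, hpX, hpZ, hp⟩ ⟨q, hqX, hqZ⟩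
      have h1 := cutSize_submodular (H := H) (A := A) Z X
      have h2 := hT.three_le_cutSize (Finset.union_subset hZA hXA) ⟨p, by simp [hpX]⟩
        ⟨a, haA, by simp [haZ, haX]⟩
      refine hmin (Z ∩ X) ⟨Finset.inter_subset_left.trans hZA, ⟨p, by simp [hpX, hpZ], hp⟩,
        ⟨a, haA, by simp [haZ], ha⟩, by omega⟩ ?_
      refine Finset.card_lt_card (Finset.ssubset_iff_subset_ne.2 ⟨Finset.inter_subset_right, ?_⟩)
      intro h
      rw [← h] at hqX
      exact hqZ (Finset.mem_inter.1 hqX).1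
    obtain ⟨Z, hZA, hhZ, hvZ, hZ⟩ := hT.cut h (hXA hhX) v (hXA hv) hvh.symm
    by_cases haZ : a ∈ Z
    · refine key (A \ Z) Finset.sdiff_subset (by rwa [cutSize_sdiff]) (by simp [haZ])
        ⟨v, hv, by simp [hXA hv, hvZ], by omega⟩ ⟨h, hhX, by simp [hhZ]⟩
    · exact key Z hZA hZ haZ ⟨h, hhX, hhZ, hh⟩ ⟨v, hv, hvZ⟩
  · by_contra! hall
    have : X ⊆ Finset.univ.image x := by
      intro v hv
      obtain ⟨j, rfl⟩ := hall v hv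
      simp
    have := (Finset.card_le_card this).trans Finset.card_image_le
    simp at this
    omega

end

/-! ### Colourings with colours `1, …, k` -/

/-- `f` is a proper colouring of the graph `H` on `A` with colours `1, …, k`. -/
structure IsCol {V : Type*} (H : SimpleGraph V) (A : Finset V) (k : ℕ) (f : V → ℕ) : Prop where
  proper : ∀ u v, H.Adj u v → f u ≠ f v
  range : ∀ v ∈ A, 1 ≤ f v ∧ f v ≤ k

/-- The map of the colours `1, 2, 3` to `p, q, 6 - p - q`. -/
def permColour (p q c : ℕ) : ℕ := if c = 1 then p else if c = 2 then q else 6 - p - q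

/-- The pair `p`, `q` describes a permutation of the colours `1, 2, 3`. -/
def IsPerm (p q : ℕ) : Prop := 1 ≤ p ∧ p ≤ 3 ∧ 1 ≤ q ∧ q ≤ 3 ∧ p ≠ q

theorem IsPerm.permColour_inj {p q c d : ℕ} (h : IsPerm p q) (hc : 1 ≤ c ∧ c ≤ 3)
    (hd : 1 ≤ d ∧ d ≤ 3) (hcd : c ≠ d) : permColour p q c ≠ permColour p q d := by
  obtain ⟨h1, h2, h3, h4, h5⟩ := h
  unfold permColour
  split_ifs <;> omega

theorem IsPerm.permColour_mem {p q : ℕ} (h : IsPerm p q) (c : ℕ) :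
    1 ≤ permColour p q c ∧ permColour p q c ≤ 3 := by
  obtain ⟨h1, h2, h3, h4, h5⟩ := h
  unfold permColour
  split_ifs <;> omega

/-- Two colour patterns on the ends of three disjoint edges, neither of them constant, are made
compatible by a permutation of colours. -/
theorem exists_perm {a b : Fin 3 → ℕ} (ha : ∀ j, 1 ≤ a j ∧ a j ≤ 3) (hb : ∀ j, 1 ≤ b j ∧ b j ≤ 3)
    (ha' : ∃ i j, a i ≠ a j) (hb' : ∃ i j, b i ≠ b j) :
    ∃ p q, IsPerm p q ∧ ∀ j, permColour p q (a j) ≠ b j := by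
  have key : ∀ a₀ a₁ a₂ b₀ b₁ b₂ : Fin 3, (a₀ ≠ a₁ ∨ a₁ ≠ a₂) → (b₀ ≠ b₁ ∨ b₁ ≠ b₂) →
      ∃ p q : Fin 3, p ≠ q ∧
        permColour (p + 1) (q + 1) (a₀ + 1) ≠ b₀ + 1 ∧ permColour (p + 1) (q + 1) (a₁ + 1) ≠ b₁ + 1 ∧
        permColour (p + 1) (q + 1) (a₂ + 1) ≠ b₂ + 1 := by
    decide
  have lift : ∀ c : ℕ, 1 ≤ c ∧ c ≤ 3 → ∃ d : Fin 3, c = d + 1 := fun c hc =>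
    ⟨⟨c - 1, by omega⟩, by simp; omega⟩
  choose! l hl using lift
  have hne : ∀ a : Fin 3 → ℕ, (∀ j, 1 ≤ a j ∧ a j ≤ 3) → (∃ i j, a i ≠ a j) →
      l (a 0) ≠ l (a 1) ∨ l (a 1) ≠ l (a 2) := by
    intro a ha ha'
    by_contra! h
    have h1 : a 0 = a 1 := by rw [hl _ (ha 0), hl _ (ha 1), h.1]
    have h2 : a 1 = a 2 := by rw [hl _ (ha 1), hl _ (ha 2), h.2]
    obtain ⟨i, j, hij⟩ := ha'
    have hall : ∀ i, a i = a 0 := by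
      intro i
      fin_cases i
      exacts [rfl, h1.symm, (h1.trans h2).symm]
    exact hij ((hall i).trans (hall j).symm)
  obtain ⟨p, q, hpq, h0, h1, h2⟩ := key _ _ _ _ _ _ (hne a ha ha') (hne b hb hb')
  rw [← hl _ (ha 0), ← hl _ (hb 0)] at h0
  rw [← hl _ (ha 1), ← hl _ (hb 1)] at h1
  rw [← hl _ (ha 2), ← hl _ (hb 2)] at h2
  refine ⟨p + 1, q + 1, ⟨by omega, by omega, by omega, by omega, by omega⟩, ?_⟩
  intro j
  fin_cases j
  exacts [h0, h1, h2]

section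

variable {V : Type*} {H : SimpleGraph V} {A X : Finset V} {x y : Fin 3 → V} {c f : V → ℕ}

/-- Three pairwise adjacent vertices together with their partners: the partners cannot all have
the same colour. -/
theorem IsMatchingCut.exists_ne (hC : IsMatchingCut H A X x y)
    (hf : IsCol (splitGraph H A X x) (splitSet A X x) 3 f) : ∃ i j, f (y i) ≠ f (y j) := by
  by_contra! hall
  have hx : ∀ i j, i ≠ j → f (x i) ≠ f (x j) := fun i j hij =>
    hf.proper _ _ (Or.inr ⟨fun h => hij (hC.x_inj h), ⟨i, rfl⟩, j, rfl⟩)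
  have hxy : ∀ j, f (x j) ≠ f (y 0) := fun j => by
    rw [hall 0 j]
    exact hf.proper _ _ ((hC.adj_x_iff (hC.y_mem j) (hC.y_notMem j)).2 rfl)
  have hr := fun j => hf.range _ (hC.x_mem_splitSet j)
  have hr0 := hf.range (y 0) (mem_splitSet.2 ⟨hC.y_mem 0, Or.inl (hC.y_notMem 0)⟩)
  have := hx 0 1 (by decide)
  have := hx 0 2 (by decide)
  have := hx 1 2 (by decide)
  have := hxy 0
  have := hxy 1
  have := hxy 2
  have := hr 0
  have := hr 1
  have := hr 2
  omega

variable [DecidableEq V]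

/-- Colourings of the two torsos of a matching cut can be made compatible. -/
theorem IsMatchingCut.exists_perm (hC : IsMatchingCut H A X x y)
    (hc : IsCol (splitGraph H A (A \ X) y) (splitSet A (A \ X) y) 3 c)
    (hf : IsCol (splitGraph H A X x) (splitSet A X x) 3 f) :
    ∃ p q, IsPerm p q ∧ ∀ j, permColour p q (c (x j)) ≠ f (y j) := by
  refine SimpleGraph.exists_perm (fun j => hc.range _ ?_) (fun j => hf.range _ ?_) ?_ ?_
  · exact mem_splitSet.2 ⟨hC.sub (hC.x_mem j), Or.inl (by simp [hC.x_mem j])⟩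
  · exact mem_splitSet.2 ⟨hC.y_mem j, Or.inl (hC.y_notMem j)⟩
  · exact hC.symm.exists_ne hc
  · exact hC.exists_ne hf

/-- Compatible colourings of the two torsos of a matching cut give a colouring of the graph. -/
theorem IsMatchingCut.isCol_glue (hT : ∀ {u v}, H.Adj u v → u ∈ A) (hC : IsMatchingCut H A X x y)
    (hc : IsCol (splitGraph H A (A \ X) y) (splitSet A (A \ X) y) 3 c)
    (hf : IsCol (splitGraph H A X x) (splitSet A X x) 3 f) {p q : ℕ} (hp : IsPerm p q)
    (hpq : ∀ j, permColour p q (c (x j)) ≠ f (y j)) :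
    IsCol H A 3 fun v => if v ∈ X then permColour p q (c v) else f v := by
  have hout : ∀ v ∈ A, v ∉ X → v ∈ splitSet A X x := fun v hv hvX => mem_splitSet.2 ⟨hv, Or.inl hvX⟩
  have hin : ∀ v ∈ X, v ∈ splitSet A (A \ X) y := fun v hv =>
    mem_splitSet.2 ⟨hC.sub hv, Or.inl (by simp [hv])⟩
  constructor
  · intro u v huv
    have hu := hT huv
    have hv := hT huv.symm
    by_cases huX : u ∈ X <;> by_cases hvX : v ∈ X <;> simp only [huX, hvX, if_true, if_false]
    · exact hp.permColour_inj (hc.range _ (hin u huX)) (hc.range _ (hin v hvX))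
        (hc.proper _ _ (Or.inl ⟨hin u huX, hin v hvX, huv⟩))
    · obtain ⟨j, rfl, rfl⟩ := hC.cut u huX v hv hvX huv
      exact hpq j
    · obtain ⟨j, rfl, rfl⟩ := hC.cut v hvX u hu huX huv.symm
      exact (hpq j).symm
    · exact hf.proper _ _ (Or.inl ⟨hout u hu huX, hout v hv hvX, huv⟩)
  · intro v hv
    by_cases hvX : v ∈ X <;> simp only [hvX, if_true, if_false]
    · exact hp.permColour_mem _
    · exact hf.range _ (hout v hv hvX)

end

/-! ### Wheels -/

section

variable {V : Type*} [DecidableEq V] {H : SimpleGraph V} {A : Finset V}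

/-- In a tight graph with a dominating vertex `h`, all other vertices have degree three. -/
theorem Tight.degIn_of_dominating (hT : Tight H A) {h : V} (hh : h ∈ A)
    (hdom : ∀ v ∈ A, v ≠ h → H.Adj h v) {v : V} (hv : v ∈ A) (hvh : v ≠ h) :
    H.degIn A v = 3 := by
  refine le_antisymm ?_ (hT.three_le_degIn hv)
  by_contra hd
  obtain ⟨Z, hZA, hvZ, hhZ, hZ⟩ := hT.cut v hv h hh hvh
  have h4 := hT.four_le_card hZA hvZ (by omega) hZ
  have : Z.card ≤ H.cutSize A Z := by
    refine Finset.card_le_card_of_injOn (fun u => (u, h)) ?_ fun u _ u' _ h => (Prod.ext_iff.1 h).1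
    intro u hu
    have hu' : u ∈ Z := hu
    rw [Finset.mem_coe, mem_cutEdges]
    exact ⟨⟨hZA hu', hh⟩, hu', hhZ, (hdom u (hZA hu') fun h => hhZ (h ▸ hu')).symm⟩
  omega

/-- A tight graph with a dominating vertex `h` is a wheel: the other vertices form a cycle
`w 0, …, w (m - 1)`. It is found as a longest path that avoids `h`. -/
theorem Tight.exists_cycle (hT : Tight H A) {h : V} (hh : h ∈ A)
    (hdom : ∀ v ∈ A, v ≠ h → H.Adj h v) :
    ∃ (m : ℕ) (w : ℕ → V), 3 ≤ m ∧ (∀ i < m, w i ∈ A ∧ w i ≠ h) ∧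
      (∀ i < m, ∀ j < m, w i = w j → i = j) ∧ (∀ v ∈ A, v ≠ h → ∃ i < m, w i = v) ∧
      ∀ i < m, ∀ j < m, H.Adj (w i) (w j) ↔
        (j = i + 1 ∨ i = j + 1 ∨ (i = 0 ∧ j = m - 1) ∨ (j = 0 ∧ i = m - 1)) := by
  classical
  have hrim : ∀ v ∈ A, v ≠ h → (A.filter fun u => u ≠ h ∧ H.Adj v u).card = 2 := by
    intro v hv hvh
    have h1 := hT.degIn_of_dominating hh hdom hv hvh
    have h2 : A.filter (fun u => H.Adj v u) = insert h (A.filter fun u => u ≠ h ∧ H.Adj v u) := by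
      ext u
      simp only [Finset.mem_filter, Finset.mem_insert]
      by_cases huh : u = h
      · subst huh
        simp [hh, (hdom v hv hvh).symm]
      · simp [huh]
    have h3 : (A.filter fun u => H.Adj v u).card = 3 := h1
    rw [h2, Finset.card_insert_of_notMem (by simp)] at h3
    omega
  have hthird : ∀ v ∈ A, v ≠ h → ∀ a b c, a ∈ A → b ∈ A → c ∈ A → a ≠ h → b ≠ h → c ≠ h →
      H.Adj v a → H.Adj v b → H.Adj v c → a ≠ b → c = a ∨ c = b := by
    intro v hv hvh a b c ha hb hc hah hbh hch hva hvb hvc hab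
    by_contra! hne
    have : ({c, a, b} : Finset V) ⊆ A.filter fun u => u ≠ h ∧ H.Adj v u := by
      intro u hu
      simp only [Finset.mem_insert, Finset.mem_singleton] at hu
      rcases hu with rfl | rfl | rfl <;> simp [*]
    have h2 := Finset.card_le_card this
    rw [hrim v hv hvh, Finset.card_insert_of_notMem (by simp [hne.1, hne.2]),
      Finset.card_pair hab] at h2
    omega
  -- there is a path with `m` vertices that avoids `h`
  let P : ℕ → Prop := fun m => ∃ w : ℕ → V, (∀ i < m, w i ∈ A ∧ w i ≠ h) ∧
    (∀ i < m, ∀ j < m, w i = w j → i = j) ∧ ∀ i, i + 1 < m → H.Adj (w i) (w (i + 1))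
  have hPle : ∀ m, P m → m ≤ A.card := by
    rintro m ⟨w, h1, h2, -⟩
    have := Finset.card_le_card_of_injOn (s := Finset.range m) (t := A) w
      (fun i hi => (h1 i (by simpa using hi)).1)
      (fun i hi j hj hij => h2 i (by simpa using hi) j (by simpa using hj) hij)
    simpa using this
  obtain ⟨v₀, hv₀, hv₀h⟩ : ∃ v ∈ A, v ≠ h := by
    by_contra! hall
    have := Finset.card_le_one.2 fun a ha b hb => (hall a ha).trans (hall b hb).symm
    have := hT.card
    omega
  have hP1 : P 1 := ⟨fun _ => v₀, fun _ _ => ⟨hv₀, hv₀h⟩, by omega, by omega⟩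
  obtain ⟨w, h1, h2, h3⟩ := Nat.findGreatest_spec (P := P) (hPle 1 hP1) hP1
  set m := Nat.findGreatest P A.card with hm
  have hm1 : 1 ≤ m := Nat.le_findGreatest (hPle 1 hP1) hP1
  have hmax : ∀ m', P m' → m' ≤ m := fun m' h => Nat.le_findGreatest (hPle m' h) h
  have hlast : ∀ u ∈ A, u ≠ h → H.Adj (w (m - 1)) u → ∃ i < m, w i = u := by
    intro u hu huh hadj
    by_contra! hno
    have := hmax (m + 1) ⟨fun i => if i < m then w i else u, ?_, ?_, ?_⟩
    · omega
    · intro i _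
      dsimp only
      split_ifs with hi
      exacts [h1 i hi, ⟨hu, huh⟩]
    · intro i hi j hj hij
      dsimp only at hij
      split_ifs at hij with h5 h6 h6
      · exact h2 i h5 j h6 hij
      · exact absurd hij (hno i h5)
      · exact absurd hij.symm (hno j h6)
      · omega
    · intro i hi
      dsimp only
      rw [if_pos (by omega)]
      split_ifs with h5
      · exact h3 i h5
      · have : i = m - 1 := by omega
        rw [this]; exact hadj
  -- the last vertex of the path has no neighbours on the path but its predecessor and `w 0`
  have hback : ∀ i < m, H.Adj (w (m - 1)) (w i) → i = 0 ∨ i + 2 = m := by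
    intro i hi hadj
    by_contra! hne
    have him : i ≠ m - 1 := by
      rintro rfl
      exact hadj.ne rfl
    have e1 : i - 1 + 1 = i := by omega
    have hp := h3 (i - 1) (by omega)
    rw [e1] at hp
    have hn := h3 i (by omega)
    rcases hthird (w i) (h1 i hi).1 (h1 i hi).2 (w (i - 1)) (w (i + 1)) (w (m - 1))
      (h1 _ (by omega)).1 (h1 _ (by omega)).1 (h1 _ (by omega)).1 (h1 _ (by omega)).2
      (h1 _ (by omega)).2 (h1 _ (by omega)).2 hp.symm hn hadj.symm
      (fun h => by have := h2 _ (by omega) _ (by omega) h; omega) with h | h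
    · have := h2 _ (by omega) _ (by omega) h; omega
    · have := h2 _ (by omega) _ (by omega) h; omega
  have hclose : 3 ≤ m ∧ H.Adj (w (m - 1)) (w 0) := by
    have hc := hrim (w (m - 1)) (h1 _ (by omega)).1 (h1 _ (by omega)).2
    obtain ⟨a, b, hab, hab'⟩ := Finset.card_eq_two.1 hc
    have ha : a ∈ A.filter fun u => u ≠ h ∧ H.Adj (w (m - 1)) u := by simp [hab']
    have hb : b ∈ A.filter fun u => u ≠ h ∧ H.Adj (w (m - 1)) u := by simp [hab']
    rw [Finset.mem_filter] at ha hb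
    obtain ⟨i, hi, rfl⟩ := hlast a ha.1 ha.2.1 ha.2.2
    obtain ⟨j, hj, rfl⟩ := hlast b hb.1 hb.2.1 hb.2.2
    have hij : i ≠ j := fun h => hab (h ▸ rfl)
    have hi' : i ≠ m - 1 := fun h => ha.2.2.ne (by rw [h])
    have hj' : j ≠ m - 1 := fun h => hb.2.2.ne (by rw [h])
    rcases hback i hi ha.2.2 with h5 | h5 <;> rcases hback j hj hb.2.2 with h6 | h6
    · omega
    · exact ⟨by omega, h5 ▸ ha.2.2⟩
    · exact ⟨by omega, h6 ▸ hb.2.2⟩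
    · omega
  obtain ⟨hm3, hcl⟩ := hclose
  -- every vertex of the cycle has its two neighbours on the cycle
  have hnext : ∀ i < m, ∀ u ∈ A, u ≠ h → H.Adj (w i) u → u = w (if i = m - 1 then 0 else i + 1) ∨
      u = w (if i = 0 then m - 1 else i - 1) := by
    intro i hi u hu huh hadj
    have e1 : (if i = m - 1 then 0 else i + 1) < m := by split_ifs <;> omega
    have e2 : (if i = 0 then m - 1 else i - 1) < m := by split_ifs <;> omega
    refine hthird (w i) (h1 i hi).1 (h1 i hi).2 _ _ u (h1 _ e1).1 (h1 _ e2).1 hu (h1 _ e1).2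
      (h1 _ e2).2 huh ?_ ?_ hadj ?_
    · split_ifs with h5
      · rw [h5]; exact hcl
      · exact h3 i (by omega)
    · split_ifs with h5
      · rw [h5]; exact hcl.symm
      · have := h3 (i - 1) (by omega)
        rw [show i - 1 + 1 = i by omega] at this
        exact this.symm
    · intro h5
      have := h2 _ e1 _ e2 h5
      split_ifs at this <;> omega
  refine ⟨m, w, hm3, h1, h2, ?_, ?_⟩
  · intro v hv hvh
    have := hT.closed_eq (R := fun v => v ≠ h ∧ ∃ i < m, w i = v) (p := h) (q := h) (t := w 0)
      (h1 0 (by omega)).1 ⟨(h1 0 (by omega)).2, 0, by omega, rfl⟩ ?_ hv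
    · simp only [hvh, or_false] at this
      exact this.2
    · rintro u hu v hv ⟨huh, i, hi, rfl⟩ hadj
      by_cases hvh : v = h
      · exact Or.inr (Or.inl hvh)
      · left
        refine ⟨hvh, ?_⟩
        rcases hnext i hi v hv hvh hadj with h5 | h5
        · exact ⟨_, by split_ifs <;> omega, h5.symm⟩
        · exact ⟨_, by split_ifs <;> omega, h5.symm⟩
  · intro i hi j hj
    constructor
    · intro hadj
      rcases hnext i hi _ (h1 j hj).1 (h1 j hj).2 hadj with h5 | h5
      · have := h2 _ hj _ (by split_ifs <;> omega) h5
        split_ifs at this <;> omega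
      · have := h2 _ hj _ (by split_ifs <;> omega) h5
        split_ifs at this <;> omega
    · rintro (rfl | rfl | ⟨rfl, rfl⟩ | ⟨rfl, rfl⟩)
      · exact h3 i hj
      · exact (h3 j hi).symm
      · exact hcl.symm
      · exact hcl

end

end SimpleGraph

namespace RAM

/-! ### Programs with bounded loops -/

/-- Programs whose only loops run through `0, …, n - 1`, where `n` is the content of register
`0`. -/
inductive Cmd : Type
  | skip
  | set (x : ℕ) (e : Expr)
  | write (a : ℕ) (i e : Expr)
  | seq (P Q : Cmd)
  | ite (e : Expr) (P Q : Cmd)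
  | forN (x : ℕ) (P : Cmd)

namespace Cmd

/-- The effect of a program on the memory. -/
def exec : Cmd → State → State
  | skip, σ => σ
  | set x e, σ => σ.setReg x (e.eval σ)
  | write a i e, σ => σ.setArr a (i.eval σ) (e.eval σ)
  | seq P Q, σ => Q.exec (P.exec σ)
  | ite e P Q, σ => if e.eval σ ≠ 0 then P.exec σ else Q.exec σ
  | forN x P, σ => Nat.rec (σ.setReg x 0) (fun i τ => (P.exec τ).setReg x (i + 1)) (σ.reg 0)

/-- The registers that the program may change. -/
def regs : Cmd → List ℕ
  | skip => []
  | set x _ => [x]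
  | write _ _ _ => []
  | seq P Q => P.regs ++ Q.regs
  | ite _ P Q => P.regs ++ Q.regs
  | forN x P => x :: P.regs

/-- The arrays that the program may change. -/
def arrs : Cmd → List ℕ
  | skip => []
  | set _ _ => []
  | write a _ _ => [a]
  | seq P Q => P.arrs ++ Q.arrs
  | ite _ P Q => P.arrs ++ Q.arrs
  | forN _ P => P.arrs

/-- Register `0` and the loop counters are changed by nothing but the loops themselves. -/
def WF : Cmd → Bool
  | skip => true
  | set x _ => x != 0
  | write _ _ _ => true
  | seq P Q => P.WF && Q.WF
  | ite _ P Q => P.WF && Q.WF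
  | forN x P => x != 0 && !P.regs.elem x && P.WF

/-- Translation to the machine. -/
def compile : Cmd → Prog
  | skip => .skip
  | set x e => .set x e
  | write a i e => .write a i e
  | seq P Q => .seq P.compile Q.compile
  | ite e P Q => .ite e P.compile Q.compile
  | forN x P => .seq (.set x (.const 0)) (.loop (.lt (.reg x) (.reg 0))
      (.seq P.compile (.set x (.add (.reg x) (.const 1)))))

open Polynomial in
/-- A polynomial in the content of register `0` that bounds the running time. -/
noncomputable def time : Cmd → Polynomial ℕ
  | skip => 1
  | set _ e => C (e.cost + 1)
  | write _ i e => C (i.cost + e.cost + 1)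
  | seq P Q => P.time + Q.time
  | ite e P Q => C (e.cost + 1) + (P.time + Q.time)
  | forN _ P => C 6 + X * (P.time + C 8)

theorem exec_reg {P : Cmd} {y : ℕ} (h : y ∉ P.regs) (σ : State) :
    (P.exec σ).reg y = σ.reg y := by
  induction P generalizing σ with
  | skip => rfl
  | set x e =>
    have : y ≠ x := by simpa [regs] using h
    simp [exec, State.setReg, this]
  | write a i e => rfl
  | seq P Q ihP ihQ =>
    simp only [regs, List.mem_append, not_or] at h
    rw [exec, ihQ h.2, ihP h.1]
  | ite e P Q ihP ihQ =>
    simp only [regs, List.mem_append, not_or] at h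
    rw [exec]
    split_ifs
    exacts [ihP h.1 σ, ihQ h.2 σ]
  | forN x P ih =>
    simp only [regs, List.mem_cons, not_or] at h
    rw [exec]
    generalize σ.reg 0 = n
    induction n with
    | zero => simp [State.setReg, h.1]
    | succ n ihn =>
      rw [← ihn]
      simp [State.setReg, h.1, ih h.2]

theorem exec_arr {P : Cmd} {b : ℕ} (h : b ∉ P.arrs) (σ : State) :
    (P.exec σ).arr b = σ.arr b := by
  induction P generalizing σ with
  | skip => rfl
  | set x e => rfl
  | write a i e =>
    have : b ≠ a := by simpa [arrs] using h
    funext j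
    simp [exec, State.setArr, this]
  | seq P Q ihP ihQ =>
    simp only [arrs, List.mem_append, not_or] at h
    rw [exec, ihQ h.2, ihP h.1]
  | ite e P Q ihP ihQ =>
    simp only [arrs, List.mem_append, not_or] at h
    rw [exec]
    split_ifs
    exacts [ihP h.1 σ, ihQ h.2 σ]
  | forN x P ih =>
    simp only [arrs] at h
    rw [exec]
    generalize σ.reg 0 = n
    induction n with
    | zero => rfl
    | succ n ihn =>
      rw [← ihn]
      exact ih h _

theorem zero_notMem_regs {P : Cmd} (h : P.WF = true) : 0 ∉ P.regs := by
  induction P with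
  | skip => simp [regs]
  | set x e =>
    have : x ≠ 0 := by simpa [WF] using h
    simp [regs, this.symm]
  | write a i e => simp [regs]
  | seq P Q ihP ihQ =>
    simp only [WF, Bool.and_eq_true] at h
    simp [regs, ihP h.1, ihQ h.2]
  | ite e P Q ihP ihQ =>
    simp only [WF, Bool.and_eq_true] at h
    simp [regs, ihP h.1, ihQ h.2]
  | forN x P ih =>
    simp only [WF, Bool.and_eq_true] at h
    have : x ≠ 0 := by simpa using h.1.1
    simp [regs, ih h.2, this.symm]

theorem exec_reg_zero {P : Cmd} (h : P.WF = true) (σ : State) : (P.exec σ).reg 0 = σ.reg 0 :=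
  exec_reg (zero_notMem_regs h) σ

/-- The translated program runs in polynomial time and has the intended effect. -/
theorem runs_compile {P : Cmd} (h : P.WF = true) (σ : State) :
    ∃ t, t ≤ P.time.eval (σ.reg 0) ∧ Runs P.compile σ t (P.exec σ) := by
  induction P generalizing σ with
  | skip => exact ⟨1, by simp [time], Runs.skip σ⟩
  | set x e => exact ⟨_, by simp [time], Runs.set σ x e⟩
  | write a i e => exact ⟨_, by simp [time], Runs.write σ a i e⟩
  | seq P Q ihP ihQ =>
    simp only [WF, Bool.and_eq_true] at h
    obtain ⟨s, hs, hP⟩ := ihP h.1 σ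
    obtain ⟨t, ht, hQ⟩ := ihQ h.2 (P.exec σ)
    rw [exec_reg_zero h.1] at ht
    exact ⟨s + t, by simpa [time] using add_le_add hs ht, hP.seq hQ⟩
  | ite e P Q ihP ihQ =>
    simp only [WF, Bool.and_eq_true] at h
    rw [exec]
    split_ifs with he
    · obtain ⟨s, hs, hP⟩ := ihP h.1 σ
      refine ⟨_, ?_, Runs.ite_true he hP⟩
      simp [time]
      omega
    · obtain ⟨s, hs, hQ⟩ := ihQ h.2 σ
      refine ⟨_, ?_, Runs.ite_false (not_not.1 he) hQ⟩
      simp [time]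
      omega
  | forN x P ih =>
    simp only [WF, Bool.and_eq_true, bne_iff_ne, Bool.not_eq_eq_eq_not, Bool.not_true,
      List.elem_eq_contains, List.contains_eq_mem, decide_eq_false_iff_not] at h
    obtain ⟨⟨hx, hPx⟩, hP⟩ := h
    set n := σ.reg 0 with hn
    let f : ℕ → State := fun k =>
      Nat.rec (σ.setReg x 0) (fun i τ => (P.exec τ).setReg x (i + 1)) k
    have hf : ∀ k, (f k).reg x = k ∧ (f k).reg 0 = n := by
      intro k
      induction k with
      | zero => simp [f, State.setReg, hx.symm, hn]
      | succ k ihk =>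
        refine ⟨by simp [f, State.setReg], ?_⟩
        rw [← ihk.2, ← exec_reg_zero hP (f k)]
        simp [f, State.setReg, hx.symm]
    have key : ∀ j k, j + k = n → ∃ t, t ≤ j * (P.time.eval n + 8) + 4 ∧
        Runs (.loop (.lt (.reg x) (.reg 0))
          (.seq P.compile (.set x (.add (.reg x) (.const 1))))) (f k) t (f n) := by
      intro j
      induction j with
      | zero =>
        intro k hk
        have hk' : k = n := by omega
        subst hk'
        refine ⟨_, ?_, Runs.loop_false ?_⟩
        · simp [Expr.cost]
        · simp [Expr.eval, hf]
      | succ j ihj =>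
        intro k hk
        obtain ⟨t, ht, hr⟩ := ihj (k + 1) (by omega)
        obtain ⟨s, hs, hPr⟩ := ih hP (f k)
        have hset := Runs.set (P.exec (f k)) x (.add (.reg x) (.const 1))
        have he : Expr.eval (P.exec (f k)) (.add (.reg x) (.const 1)) = k + 1 := by
          simp [Expr.eval, exec_reg hPx, hf]
        rw [he] at hset
        refine ⟨_, ?_, Runs.loop_true ?_ (hPr.seq hset) hr⟩
        · rw [(hf k).2] at hs
          simp only [Expr.cost]
          rw [Nat.succ_mul]
          omega
        · simp [Expr.eval, hf]
          omega
    obtain ⟨t, ht, hr⟩ := key n 0 (by omega)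
    refine ⟨_, ?_, (Runs.set σ x (.const 0)).seq hr⟩
    simp only [Expr.cost, time, Polynomial.eval_add, Polynomial.eval_mul, Polynomial.eval_C,
      Polynomial.eval_X]
    omega

end Cmd

/-- The states `σ` and `τ` agree except in the registers `R` and the arrays `B`. -/
structure Frame (R B : List ℕ) (σ τ : State) : Prop where
  reg : ∀ {y}, y ∉ R → τ.reg y = σ.reg y
  arr : ∀ {b}, b ∉ B → τ.arr b = σ.arr b

theorem Frame.refl (R B : List ℕ) (σ : State) : Frame R B σ σ := ⟨fun _ => rfl, fun _ => rfl⟩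

theorem Frame.mono {R B R' B' : List ℕ} {σ τ : State} (h : Frame R B σ τ)
    (hR : R.all R'.elem = true) (hB : B.all B'.elem = true) : Frame R' B' σ τ := by
  simp only [List.all_eq_true, List.elem_eq_contains, List.contains_eq_mem, decide_eq_true_eq] at hR hB
  exact ⟨fun hy => h.reg fun h => hy (hR _ h), fun hb => h.arr fun h => hb (hB _ h)⟩

theorem Frame.trans {R B : List ℕ} {σ τ ρ : State} (h : Frame R B σ τ) (h' : Frame R B τ ρ) :
    Frame R B σ ρ :=
  ⟨fun hy => (h'.reg hy).trans (h.reg hy), fun hb => (h'.arr hb).trans (h.arr hb)⟩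

theorem Frame.setReg {R B : List ℕ} {σ τ : State} (h : Frame R B σ τ) {x : ℕ} (hx : R.elem x = true)
    (k : ℕ) : Frame R B σ (τ.setReg x k) := by
  refine ⟨fun {y} hy => ?_, fun hb => h.arr hb⟩
  have : y ≠ x := by
    rintro rfl
    exact hy (by simpa using hx)
  simpa [State.setReg, this] using h.reg hy

namespace Cmd

theorem frame (P : Cmd) (σ : State) : Frame P.regs P.arrs σ (P.exec σ) :=
  ⟨fun h => exec_reg h σ, fun h => exec_arr h σ⟩

theorem frame_of {P : Cmd} {R B : List ℕ} (hR : P.regs.all R.elem = true)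
    (hB : P.arrs.all B.elem = true) (σ : State) : Frame R B σ (P.exec σ) :=
  (P.frame σ).mono hR hB

/-- The loop rule. The invariant `I i` holds before the `i`-th iteration; the loop body may use
that registers and arrays which it does not change are as they were before the loop. -/
theorem forN_inv {x : ℕ} {P : Cmd} (h : (forN x P).WF = true) {σ : State} (I : ℕ → State → Prop)
    (h0 : I 0 (σ.setReg x 0))
    (hs : ∀ i < σ.reg 0, ∀ τ : State, I i τ → τ.reg x = i → Frame (x :: P.regs) P.arrs σ τ →
      I (i + 1) ((P.exec τ).setReg x (i + 1))) :
    I (σ.reg 0) ((forN x P).exec σ) := by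
  simp only [WF, Bool.and_eq_true, bne_iff_ne, Bool.not_eq_eq_eq_not, Bool.not_true] at h
  obtain ⟨⟨hx, hPx⟩, hP⟩ := h
  let f : ℕ → State := fun k =>
    Nat.rec (σ.setReg x 0) (fun i τ => (P.exec τ).setReg x (i + 1)) k
  have key : ∀ k ≤ σ.reg 0, I k (f k) ∧ (f k).reg x = k ∧ Frame (x :: P.regs) P.arrs σ (f k) := by
    intro k
    induction k with
    | zero =>
      exact fun _ => ⟨h0, by simp [f, State.setReg], (Frame.refl _ _ _).setReg (by simp) 0⟩
    | succ k ih =>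
      intro hk
      obtain ⟨h1, h2, h3⟩ := ih (by omega)
      refine ⟨hs k (by omega) _ h1 h2 h3, by simp [f, State.setReg], Frame.setReg ?_ (by simp) _⟩
      exact h3.trans ⟨fun hy => exec_reg (fun h => hy (List.mem_cons_of_mem _ h)) _,
        fun hb => exec_arr hb _⟩
  exact (key _ le_rfl).1

end Cmd

/-! ### Logical expressions -/

namespace Expr

/-- The test `e` succeeds. -/
def Holds (e : Expr) (σ : State) : Prop := e.eval σ ≠ 0

/-- Negation. -/
def not (e : Expr) : Expr := .eq e (.const 0)

/-- Disjunction. -/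
def or (e f : Expr) : Expr := .add e f

/-- Conjunction. -/
def and (e f : Expr) : Expr := (e.not.or f.not).not

/-- The entry in row `i` and column `j` of the matrix in array `a`; array `2` holds the
multiples of the row length. -/
def mat (a : ℕ) (i j : Expr) : Expr := .read a (.add (.read 2 i) j)

variable {e f : Expr} {σ : State}

theorem holds_def : e.eval σ ≠ 0 ↔ e.Holds σ := Iff.rfl

@[simp] theorem holds_not : e.not.Holds σ ↔ ¬ e.Holds σ := by
  by_cases h : e.eval σ = 0 <;> simp [Holds, not, eval, h]

@[simp] theorem holds_or : (e.or f).Holds σ ↔ e.Holds σ ∨ f.Holds σ := by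
  by_cases h : e.eval σ = 0 <;> simp [Holds, or, eval, h]

@[simp] theorem holds_and : (e.and f).Holds σ ↔ e.Holds σ ∧ f.Holds σ := by
  rw [and, holds_not, holds_or, holds_not, holds_not, not_or, not_not, not_not]

@[simp] theorem holds_eq : (Expr.eq e f).Holds σ ↔ e.eval σ = f.eval σ := by simp [Holds, eval]

@[simp] theorem holds_lt : (Expr.lt e f).Holds σ ↔ e.eval σ < f.eval σ := by simp [Holds, eval]

theorem holds_read {a : ℕ} : (Expr.read a e).Holds σ ↔ σ.arr a (e.eval σ) ≠ 0 := Iff.rfl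

end Expr

namespace Cmd

theorem exec_ite {e : Expr} {P Q : Cmd} {σ : State} [Decidable (e.Holds σ)] :
    (Cmd.ite e P Q).exec σ = if e.Holds σ then P.exec σ else Q.exec σ := by
  simp only [exec, Expr.holds_def]

end Cmd

/-! ### Building blocks: filling arrays, scanning, searching -/

theorem index_inj {n u v u' v' : ℕ} (hv : v < n) (hv' : v' < n) (h : u * n + v = u' * n + v') :
    u = u' ∧ v = v' := by
  have h1 : u = u' := by
    rcases lt_trichotomy u u' with h1 | h1 | h1
    · have := Nat.mul_le_mul_right n (show u + 1 ≤ u' from h1)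
      rw [Nat.succ_mul] at this
      omega
    · exact h1
    · have := Nat.mul_le_mul_right n (show u' + 1 ≤ u from h1)
      rw [Nat.succ_mul] at this
      omega
  subst h1
  exact ⟨rfl, by omega⟩

/-- Register `0` holds `n`, and array `2` holds the multiples of `n`. -/
structure Rows (n : ℕ) (σ : State) : Prop where
  size : σ.reg 0 = n
  row : ∀ i < n, σ.arr 2 i = i * n

theorem Rows.of_frame {n : ℕ} {R B : List ℕ} {σ τ : State} (h : Rows n σ) (hF : Frame R B σ τ)
    (hR : R.elem 0 = false) (hB : B.elem 2 = false) : Rows n τ := by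
  have h0 : 0 ∉ R := by simpa using hR
  have h2 : 2 ∉ B := by simpa using hB
  exact ⟨(hF.reg h0).trans h.size, fun i hi => by rw [hF.arr h2, h.row i hi]⟩

namespace Cmd

/-- Write the value of `e` into cell `v` of array `a`, for all `v < n`. -/
def fill (a v : ℕ) (e : Expr) : Cmd := forN v (write a (.reg v) e)

theorem exec_fill {a v : ℕ} {e : Expr} {σ : State} (hv : v ≠ 0) (F : ℕ → ℕ)
    (hF : ∀ i < σ.reg 0, ∀ τ, Frame [v] [a] σ τ → τ.reg v = i → τ.arr a i = σ.arr a i →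
      e.eval τ = F i) (i : ℕ) :
    ((fill a v e).exec σ).arr a i = if i < σ.reg 0 then F i else σ.arr a i := by
  refine forN_inv (P := write a (.reg v) e) (x := v) (by simp [WF, hv, regs])
    (fun k τ => ∀ i, τ.arr a i = if i < k then F i else σ.arr a i) (by simp [State.setReg]) ?_ i
  intro k hk τ hI hvk hFr i
  have he := hF k hk τ (hFr.mono (by simp [regs]) (by simp [arrs])) hvk (by simp [hI])
  simp only [exec, Expr.eval, State.setArr, State.setReg, hvk, he, true_and, hI]
  split_ifs <;> first | rfl | omega | (subst_vars; rfl)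

/-- Write the value of `e` into the entry in row `u` and column `v` of the matrix in array `a`, for
all `u, v < n`. -/
def fillMat (a u v : ℕ) (e : Expr) : Cmd :=
  forN u (forN v (write a (.add (.read 2 (.reg u)) (.reg v)) e))

theorem exec_fillMat {a u v n : ℕ} {e : Expr} {σ : State} (hσ : Rows n σ) (hu : u ≠ 0) (hv : v ≠ 0)
    (huv : u ≠ v) (ha : a ≠ 2) (F : ℕ → ℕ → ℕ)
    (hF : ∀ i < n, ∀ j < n, ∀ τ, Frame [u, v] [a] σ τ → τ.reg u = i → τ.reg v = j →
      τ.arr a (i * n + j) = σ.arr a (i * n + j) → e.eval τ = F i j) {i j : ℕ} (hi : i < n)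
    (hj : j < n) : ((fillMat a u v e).exec σ).arr a (i * n + j) = F i j := by
  have := forN_inv (P := forN v (write a (.add (.read 2 (.reg u)) (.reg v)) e)) (x := u) (σ := σ)
    (by simp [WF, hu, hv, regs, huv])
    (fun k τ => ∀ i < n, ∀ j < n, τ.arr a (i * n + j) = if i < k then F i j else σ.arr a (i * n + j))
    (by simp [State.setReg]) ?_ i hi j hj
  · rw [hσ.size, if_pos hi] at this
    exact this
  intro k hk τ hI huk hFr i hi j hj
  rw [hσ.size] at hk
  have hFr' : Frame [u, v] [a] σ τ := hFr.mono (by simp [regs]) (by simp [arrs])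
  have hτ : Rows n τ := hσ.of_frame hFr' (by simp [hu.symm, hv.symm]) (by simp [ha.symm])
  have := forN_inv (P := write a (.add (.read 2 (.reg u)) (.reg v)) e) (x := v) (σ := τ)
    (by simp [WF, hv, regs])
    (fun l ρ => ∀ i < n, ∀ j < n, ρ.arr a (i * n + j) =
      if i < k ∨ i = k ∧ j < l then F i j else σ.arr a (i * n + j))
    (by simpa [State.setReg] using hI) ?_ i hi j hj
  · simp only [State.setReg]
    rw [this, hτ.size]
    congr 1
    simp only [eq_iff_iff]
    omega
  intro l hl ρ hI' hvl hFr2 i hi j hj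
  rw [hτ.size] at hl
  have hFr2' : Frame [u, v] [a] τ ρ := hFr2.mono (by simp [regs]) (by simp [arrs])
  have huk' : ρ.reg u = k := by
    rw [hFr2.reg (by simp [regs, huv]), huk]
  have hrow : ρ.arr 2 k = k * n := (hτ.of_frame hFr2' (by simp [hu.symm, hv.symm])
    (by simp [ha.symm])).row k hk
  have he := hF k hk l hl ρ (hFr'.trans hFr2') huk' hvl (by simp [hI' k hk l hl])
  simp only [exec, Expr.eval, State.setArr, State.setReg, huk', hvl, hrow, he, true_and]
  by_cases hij : i = k ∧ j = l
  · obtain ⟨rfl, rfl⟩ := hij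
    simp
  · have hne : ¬ i * n + j = k * n + l := fun h => hij (index_inj hj hl h)
    rw [if_neg hne, hI' i hi j hj]
    congr 1
    simp only [eq_iff_iff]
    omega

/-- Set the flag `r` if the test `e` succeeds for some `v < n`. -/
def scan (v r : ℕ) (e : Expr) : Cmd := forN v (ite e (set r (.const 1)) skip)

theorem exec_scan {v r : ℕ} {e : Expr} {σ : State} (hv : v ≠ 0) (hr : r ≠ 0) (hvr : v ≠ r)
    (P : ℕ → Prop) (hP : ∀ i < σ.reg 0, ∀ τ, Frame [v, r] [] σ τ → τ.reg v = i → (e.Holds τ ↔ P i)) :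
    ((scan v r e).exec σ).reg r ≠ 0 ↔ σ.reg r ≠ 0 ∨ ∃ i < σ.reg 0, P i := by
  classical
  refine forN_inv (P := ite e (set r (.const 1)) skip) (x := v) (σ := σ)
    (by simp [WF, hv, hr, regs, hvr])
    (fun k τ => τ.reg r ≠ 0 ↔ σ.reg r ≠ 0 ∨ ∃ i < k, P i) (by simp [State.setReg, hvr.symm]) ?_
  intro k hk τ hI hvk hFr
  have hP' := hP k hk τ (hFr.mono (by simp [regs]) (by simp [arrs])) hvk
  rw [exec_ite]
  have hex : (∃ i < k + 1, P i) ↔ (∃ i < k, P i) ∨ P k := by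
    constructor
    · rintro ⟨i, hi, h⟩
      by_cases hik : i = k
      · exact Or.inr (hik ▸ h)
      · exact Or.inl ⟨i, by omega, h⟩
    · rintro (⟨i, hi, h⟩ | h)
      exacts [⟨i, by omega, h⟩, ⟨k, by omega, h⟩]
  rw [hex]
  by_cases hk' : P k
  · rw [if_pos (hP'.2 hk')]
    simp [exec, State.setReg, hvr.symm, hk', Expr.eval]
  · rw [if_neg (fun h => hk' (hP'.1 h))]
    simp only [exec, State.setReg, hvr.symm, if_false, hk', or_false]
    exact hI

/-- Set the flag `r` if the test `e` succeeds for some `u, v < n`. -/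
def scanMat (u v r : ℕ) (e : Expr) : Cmd := forN u (scan v r e)

theorem exec_scanMat {u v r : ℕ} {e : Expr} {σ : State} (hu : u ≠ 0) (hv : v ≠ 0) (hr : r ≠ 0)
    (huv : u ≠ v) (hur : u ≠ r) (hvr : v ≠ r) (P : ℕ → ℕ → Prop)
    (hP : ∀ i < σ.reg 0, ∀ j < σ.reg 0, ∀ τ, Frame [u, v, r] [] σ τ → τ.reg u = i → τ.reg v = j →
      (e.Holds τ ↔ P i j)) :
    ((scanMat u v r e).exec σ).reg r ≠ 0 ↔ σ.reg r ≠ 0 ∨ ∃ i < σ.reg 0, ∃ j < σ.reg 0, P i j := by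
  refine forN_inv (P := scan v r e) (x := u) (σ := σ)
    (by simp [scan, WF, hv, hr, hu, regs, hvr, huv, hur])
    (fun k τ => τ.reg r ≠ 0 ↔ σ.reg r ≠ 0 ∨ ∃ i < k, ∃ j < σ.reg 0, P i j)
    (by simp [State.setReg, hur.symm]) ?_
  intro k hk τ hI huk hFr
  have hFr' : Frame [u, v, r] [] σ τ := hFr.mono (by simp [regs, scan]) (by simp [arrs, scan])
  have h0 : τ.reg 0 = σ.reg 0 := hFr'.reg (by simp [hu.symm, hv.symm, hr.symm])
  have := exec_scan (σ := τ) (e := e) hv hr hvr (P k) (fun j hj ρ hρ hvj =>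
    hP k hk j (h0 ▸ hj) ρ (hFr'.trans (hρ.mono (by simp) (by simp)))
      (by rw [hρ.reg (by simp [huv, hur]), huk]) hvj)
  simp only [State.setReg, hur.symm, if_false]
  rw [this, hI, h0]
  constructor
  · rintro ((h | ⟨i, hi, h⟩) | h)
    exacts [Or.inl h, Or.inr ⟨i, by omega, h⟩, Or.inr ⟨k, by omega, h⟩]
  · rintro (h | ⟨i, hi, h⟩)
    · exact Or.inl (Or.inl h)
    · by_cases hik : i = k
      · exact Or.inr (hik ▸ h)
      · exact Or.inl (Or.inr ⟨i, by omega, h⟩)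

/-- The program preserves `Win`. -/
def Keeps (P : Cmd) (Win : State → Prop) : Prop := ∀ σ, Win σ → Win (P.exec σ)

/-- Started in a state with `Base`, the program either reaches `Win` or comes back to `Base`, the
latter only if `good` fails. -/
def Search (P : Cmd) (Base Win : State → Prop) (good : Prop) : Prop :=
  ∀ σ, Base σ → Win (P.exec σ) ∨ Base (P.exec σ) ∧ ¬ good

theorem Keeps.forN {x : ℕ} {P : Cmd} {Win : State → Prop} (hWF : (Cmd.forN x P).WF = true)
    (hW : ∀ σ k, Win σ → Win (σ.setReg x k)) (h : Keeps P Win) : Keeps (Cmd.forN x P) Win :=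
  fun _ hσ => forN_inv hWF (fun _ τ => Win τ) (hW _ _ hσ) fun _ _ _ hI _ _ => hW _ _ (h _ hI)

/-- A loop searches for a value of the counter for which its body succeeds. -/
theorem Search.forN {x : ℕ} {P : Cmd} {Base Win : State → Prop} {good : ℕ → Prop} {n : ℕ}
    (hWF : (Cmd.forN x P).WF = true) (hn : ∀ σ, Base σ → σ.reg 0 = n)
    (hB : ∀ σ k, Base σ → Base (σ.setReg x k)) (hW : ∀ σ k, Win σ → Win (σ.setReg x k))
    (hK : Keeps P Win) (h : ∀ i < n, Search P (fun σ => Base σ ∧ σ.reg x = i) Win (good i)) :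
    Search (Cmd.forN x P) Base Win (∃ i < n, good i) := by
  intro σ hσ
  have := forN_inv hWF (σ := σ)
    (fun k τ => Win τ ∨ Base τ ∧ ¬ ∃ i < k, good i) (Or.inr ⟨hB _ _ hσ, by simp⟩) ?_
  · rwa [hn σ hσ] at this
  · rintro k hk τ (hI | ⟨hI, hno⟩) hxk -
    · exact Or.inl (hW _ _ (hK _ hI))
    · rcases h k (hn σ hσ ▸ hk) τ ⟨hI, hxk⟩ with h' | ⟨⟨h', -⟩, hg⟩
      · exact Or.inl (hW _ _ h')
      · refine Or.inr ⟨hB _ _ h', ?_⟩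
        rintro ⟨i, hi, hgi⟩
        by_cases hik : i = k
        · exact hg (hik ▸ hgi)
        · exact hno ⟨i, by omega, hgi⟩

end Cmd

/-! ### Breadth-first search -/

/-- `D` assigns to the vertices that are reachable from `t` along the relation `b` a level, `1` for
`t` itself and otherwise one more than the level of some predecessor; the other vertices have level
`0`. -/
structure Levels (n : ℕ) (b : ℕ → ℕ → Prop) (t : ℕ) (D : ℕ → ℕ) : Prop where
  root : D t = 1
  pred : ∀ v < n, D v ≠ 0 → v ≠ t → ∃ u < n, D u + 1 = D v ∧ D u ≠ 0 ∧ b u v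
  closed : ∀ u < n, D u ≠ 0 → ∀ v < n, b u v → D v ≠ 0
  le : ∀ v < n, D v ≤ n

/-- The state of the search in round `k`, after the vertices `u < i` of level `k + 1` have been
processed. -/
structure PartialLevels (n : ℕ) (b : ℕ → ℕ → Prop) (t k i : ℕ) (D : ℕ → ℕ) : Prop where
  root : D t = 1
  pred : ∀ v < n, D v ≠ 0 → v ≠ t → ∃ u < n, D u + 1 = D v ∧ D u ≠ 0 ∧ b u v
  closed : ∀ u < n, D u ≠ 0 → (D u ≤ k ∨ D u = k + 1 ∧ u < i) → ∀ v < n, b u v → D v ≠ 0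
  le : ∀ v < n, D v ≤ k + 2

theorem PartialLevels.update {n : ℕ} {b : ℕ → ℕ → Prop} {t k i : ℕ} {D : ℕ → ℕ}
    (h : PartialLevels n b t k i D) {u v : ℕ} (hu : u < n) (hDu : D u = k + 1)
    (hDv : D v = 0) (hb : b u v) : PartialLevels n b t k i (Function.update D v (k + 2)) := by
  have hne : ∀ w, D w ≠ 0 → Function.update D v (k + 2) w = D w := fun w hw =>
    Function.update_of_ne (by rintro rfl; exact hw hDv) _ _
  have hne0 : ∀ w, D w ≠ 0 → Function.update D v (k + 2) w ≠ 0 := fun w hw => by rwa [hne w hw]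
  refine ⟨?_, ?_, ?_, ?_⟩
  · rw [hne t (by rw [h.root]; omega), h.root]
  · intro w hw hDw hwt
    by_cases hwv : w = v
    · subst hwv
      refine ⟨u, hu, ?_, hne0 u (by omega), hb⟩
      rw [hne u (by omega), Function.update_self, hDu]
    · rw [Function.update_of_ne hwv] at hDw ⊢
      obtain ⟨u', hu', h1, h2, h3⟩ := h.pred w hw hDw hwt
      exact ⟨u', hu', by rw [hne u' h2, h1], hne0 u' h2, h3⟩
  · intro w hw hDw hor x hx hbx
    by_cases hwv : w = v
    · subst hwv
      rw [Function.update_self] at hor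
      omega
    · rw [Function.update_of_ne hwv] at hDw hor
      exact hne0 x (h.closed w hw hDw hor x hx hbx)
  · intro w hw
    by_cases hwv : w = v
    · subst hwv; rw [Function.update_self]
    · rw [Function.update_of_ne hwv]; exact h.le w hw

theorem exists_level {n : ℕ} {b : ℕ → ℕ → Prop} {t : ℕ} {D : ℕ → ℕ} (hroot : D t = 1)
    (hpred : ∀ v < n, D v ≠ 0 → v ≠ t → ∃ u < n, D u + 1 = D v ∧ D u ≠ 0 ∧ b u v) :
    ∀ m, ∀ v < n, D v = m → ∀ j, 1 ≤ j → j ≤ m → ∃ w < n, D w = j := by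
  intro m
  induction m with
  | zero => intro v _ _ j h1 h2; omega
  | succ m ih =>
    intro v hv hm j h1 h2
    by_cases hj : j = m + 1
    · exact ⟨v, hv, hm.trans hj.symm⟩
    · have hvt : v ≠ t := by rintro rfl; omega
      obtain ⟨u, hu, h3, h4, -⟩ := hpred v hv (by omega) hvt
      exact ih u hu (by omega) j h1 (by omega)

/-! The registers and arrays of the program. The array `aIn` holds the input and `aOut` the output;
`aRow` holds the row offsets of matrices; `aE` and `aLive` the graph that remains to be coloured;
`aS` the part to be peeled off, `aX` its ends of the cut edges, each with the other end plus one as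
its value, and `aY` these other ends; `aM` and `aW` the torso of the part; `aB` the relation along
which it is searched, `aD` the levels and `aC` the colours; `aRC`, `aRX` and `aRS` the records of
`aC`, `aX` and `aS` for each round; `aP` is a small table. -/

notation "rN" => 0
notation "rX₀" => 1
notation "rX₁" => 2
notation "rX₂" => 3
notation "rY₀" => 4
notation "rY₁" => 5
notation "rY₂" => 6
notation "rH" => 7
notation "rZ" => 8
notation "rT" => 9
notation "rFound" => 10
notation "rU" => 11
notation "rV" => 12
notation "rK" => 13
notation "rA" => 14
notation "rB" => 15
notation "rBad" => 16
notation "rP" => 17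
notation "rQ" => 18
notation "rMax" => 19
notation "rLev" => 20
notation "aIn" => 0
notation "aOut" => 1
notation "aRow" => 2
notation "aE" => 3
notation "aLive" => 4
notation "aS" => 5
notation "aM" => 6
notation "aB" => 7
notation "aD" => 8
notation "aC" => 9
notation "aX" => 10
notation "aY" => 11
notation "aW" => 12
notation "aP" => 13
notation "aRC" => 14
notation "aRX" => 15
notation "aRS" => 16

theorem setArr_arr_self (σ : State) (a i v : ℕ) :
    (σ.setArr a i v).arr a = Function.update (σ.arr a) i v := by
  funext j
  simp [State.setArr, Function.update]

open Cmd RAM.Expr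

/-- Breadth-first search from the vertex in register `rT` along the relation in `aB`; the
levels are written to `aD`. -/
def bfs : Cmd :=
  .seq (fill aD rV (const 0)) <| .seq (.write aD (reg rT) (const 1)) <|
    .forN rK (.forN rU (.ite (.eq (.read aD (reg rU)) (.add (reg rK) (const 1)))
      (.forN rV (.ite ((mat aB (reg rU) (reg rV)).and (.eq (.read aD (reg rV)) (const 0)))
        (.write aD (reg rV) (.add (reg rK) (const 2))) .skip)) .skip))

theorem exec_bfs {n : ℕ} {σ : State} (hσ : Rows n σ) :
    Levels n (fun u v => σ.arr aB (u * n + v) ≠ 0) (σ.reg rT) ((bfs.exec σ).arr aD) := by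
  set b : ℕ → ℕ → Prop := fun u v => σ.arr aB (u * n + v) ≠ 0 with hb
  set t := σ.reg rT
  have hfill := exec_fill (a := aD) (v := rV) (e := const 0) (σ := σ) (by decide) (fun _ => 0)
    (fun _ _ _ _ _ _ => rfl)
  set σ₁ := (fill aD rV (const 0)).exec σ with hσ₁
  have hF₁ : Frame [rV] [aD] σ σ₁ := frame_of (by decide) (by decide) σ
  set σ₂ := (Cmd.write aD (reg rT) (const 1)).exec σ₁ with hσ₂
  have hF₂ : Frame [rV] [aD] σ σ₂ := hF₁.trans (frame_of (by decide) (by decide) σ₁)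
  have hD₂ : σ₂.arr aD = Function.update (σ₁.arr aD) t 1 := by
    rw [hσ₂]
    show (σ₁.setArr aD (σ₁.reg rT) 1).arr aD = _
    rw [setArr_arr_self, hF₁.reg (by decide)]
  have h0 : PartialLevels n b t 0 0 (σ₂.arr aD) ∧ ∀ v < n, σ₂.arr aD v ≤ 1 := by
    have hv : ∀ v < n, v ≠ t → σ₂.arr aD v = 0 := by
      intro v hv hvt
      rw [hD₂, Function.update_of_ne hvt, hfill v, if_pos (hσ.size ▸ hv)]
    have h1 : σ₂.arr aD t = 1 := by rw [hD₂, Function.update_self]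
    have hle : ∀ v < n, σ₂.arr aD v ≤ 1 := by
      intro v hvn
      by_cases hvt : v = t
      · rw [hvt, h1]
      · rw [hv v hvn hvt]; omega
    refine ⟨⟨h1, fun v hvn h hvt => absurd (hv v hvn hvt) h, ?_,
      fun v hv => (hle v hv).trans (by omega)⟩, hle⟩
    intro u hu hne hor
    omega
  have hr₂ : Rows n σ₂ := hσ.of_frame hF₂ (by decide) (by decide)
  have key := forN_inv (x := rK) (σ := σ₂) (P := .forN rU (.ite (.eq (.read aD (reg rU))
      (.add (reg rK) (const 1)))
      (.forN rV (.ite ((mat aB (reg rU) (reg rV)).and (.eq (.read aD (reg rV)) (const 0)))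
        (.write aD (reg rV) (.add (reg rK) (const 2))) .skip)) .skip)) (by decide)
    (fun k τ => PartialLevels n b t k 0 (τ.arr aD) ∧ ∀ v < n, τ.arr aD v ≤ k + 1) h0 ?_
  · rw [hr₂.size] at key
    obtain ⟨hP, hle⟩ := key
    change PartialLevels n b t n 0 ((bfs.exec σ).arr aD) at hP
    change ∀ v < n, (bfs.exec σ).arr aD v ≤ n + 1 at hle
    have hle' : ∀ v < n, (bfs.exec σ).arr aD v ≤ n := by
      intro v hv
      have hsub : Finset.Icc 1 ((bfs.exec σ).arr aD v) ⊆
          (Finset.range n).image ((bfs.exec σ).arr aD) := by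
        intro j hj
        rw [Finset.mem_Icc] at hj
        obtain ⟨w, hw, h⟩ := exists_level hP.root hP.pred _ v hv rfl j hj.1 hj.2
        exact Finset.mem_image.2 ⟨w, by simpa using hw, h⟩
      have := (Finset.card_le_card hsub).trans Finset.card_image_le
      simpa using this
    exact ⟨hP.root, hP.pred, fun u hu h v hv => hP.closed u hu h (Or.inl (hle' u hu)) v hv, hle'⟩
  rintro k hk τ ⟨hI, hle⟩ hτk hFr
  rw [hr₂.size] at hk
  have hFr' : Frame [rK, rU, rV] [aD] σ₂ τ := hFr.mono (by decide) (by decide)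
  have hτ : Rows n τ := hr₂.of_frame hFr' (by decide) (by decide)
  have key2 := forN_inv (x := rU) (σ := τ) (P := (.ite (.eq (.read aD (reg rU))
      (.add (reg rK) (const 1)))
      (.forN rV (.ite ((mat aB (reg rU) (reg rV)).and (.eq (.read aD (reg rV)) (const 0)))
        (.write aD (reg rV) (.add (reg rK) (const 2))) .skip)) .skip)) (by decide)
    (fun i ρ => PartialLevels n b t k i (ρ.arr aD)) hI ?_
  · rw [hτ.size] at key2
    show PartialLevels n b t (k + 1) 0 ((Cmd.exec _ τ).arr aD) ∧
      ∀ v < n, (Cmd.exec _ τ).arr aD v ≤ k + 1 + 1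
    refine ⟨⟨key2.root, key2.pred, ?_, ?_⟩, ?_⟩
    · intro u hu hne hor v hv hbv
      refine key2.closed u hu hne ?_ v hv hbv
      omega
    · intro v hv
      exact (key2.le v hv).trans (by omega)
    · exact key2.le
  rintro i hi ρ hIρ hρi hFρ
  rw [hτ.size] at hi
  have hFρ' : Frame [rU, rV] [aD] τ ρ := hFρ.mono (by decide) (by decide)
  have hρ : Rows n ρ := hτ.of_frame hFρ' (by decide) (by decide)
  have hρk : ρ.reg rK = k := (hFρ'.reg (by decide)).trans hτk
  show PartialLevels n b t k (i + 1) ((Cmd.exec _ ρ).arr aD)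
  classical
  rw [exec_ite]
  by_cases hlev : ρ.arr aD i = k + 1
  · rw [if_pos (by simp [Expr.eval, hρi, hρk, hlev])]
    have key3 := forN_inv (x := rV) (σ := ρ) (P := .ite ((mat aB (reg rU) (reg rV)).and
      (.eq (.read aD (reg rV)) (const 0)))
        (.write aD (reg rV) (.add (reg rK) (const 2))) .skip) (by decide)
      (fun j ν => PartialLevels n b t k i (ν.arr aD) ∧ ν.arr aD i = k + 1 ∧
        ∀ v < j, v < n → b i v → ν.arr aD v ≠ 0) ⟨hIρ, hlev, by omega⟩ ?_
    · rw [hρ.size] at key3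
      obtain ⟨h1, h2, h3⟩ := key3
      refine ⟨h1.root, h1.pred, ?_, h1.le⟩
      intro u hu hne hor v hv hbv
      by_cases hui : u = i
      · subst hui; exact h3 v hv hv hbv
      · exact h1.closed u hu hne (by omega) v hv hbv
    rintro j hj ν ⟨h1, h2, h3⟩ hνj hFν
    rw [hρ.size] at hj
    have hFν' : Frame [rV] [aD] ρ ν := hFν.mono (by decide) (by decide)
    have hν : Rows n ν := hρ.of_frame hFν' (by decide) (by decide)
    have hνu : ν.reg rU = i := (hFν'.reg (by decide)).trans hρi
    have hνk : ν.reg rK = k := (hFν'.reg (by decide)).trans hρk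
    have hνB : ν.arr aB = σ.arr aB := by
      rw [hFν'.arr (by decide), hFρ'.arr (by decide), hFr'.arr (by decide), hF₂.arr (by decide)]
    have hcond : ((mat aB (reg rU) (reg rV)).and (.eq (.read aD (reg rV)) (const 0))).Holds ν ↔
        b i j ∧ ν.arr aD j = 0 := by
      simp [mat, holds_read, Expr.eval, hνu, hνj, hν.row i hi, hνB, hb]
    show PartialLevels n b t k i ((Cmd.exec _ ν).arr aD) ∧ (Cmd.exec _ ν).arr aD i = k + 1 ∧
      ∀ v < j + 1, v < n → b i v → (Cmd.exec _ ν).arr aD v ≠ 0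
    rw [exec_ite]
    by_cases hc : b i j ∧ ν.arr aD j = 0
    · rw [if_pos (hcond.2 hc)]
      have hD : ((Cmd.write aD (reg rV) (.add (reg rK) (const 2))).exec ν).arr aD =
          Function.update (ν.arr aD) j (k + 2) := by
        show (ν.setArr aD (ν.reg rV) (ν.reg rK + 2)).arr aD = _
        rw [setArr_arr_self, hνj, hνk]
      rw [hD]
      have hij : i ≠ j := by rintro rfl; omega
      refine ⟨h1.update hi h2 hc.2 hc.1, by rw [Function.update_of_ne hij, h2], ?_⟩
      intro v hv hvn hbv
      by_cases hvj : v = j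
      · subst hvj; rw [Function.update_self]; omega
      · rw [Function.update_of_ne hvj]; exact h3 v (by omega) hvn hbv
    · rw [if_neg (fun h => hc (hcond.1 h))]
      refine ⟨h1, h2, ?_⟩
      intro v hv hvn hbv
      by_cases hvj : v = j
      · subst hvj; exact fun h => hc ⟨hbv, h⟩
      · exact h3 v (by omega) hvn hbv
  · rw [if_neg (by simp [Expr.eval, hρi, hρk, hlev])]
    refine ⟨hIρ.root, hIρ.pred, ?_, hIρ.le⟩
    intro u hu hne hor v hv hbv
    refine hIρ.closed u hu hne ?_ v hv hbv
    rcases hor with h | ⟨h, h'⟩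
    · exact Or.inl h
    · by_cases hui : u = i
      · subst hui; exact absurd h hlev
      · exact Or.inr ⟨h, by omega⟩

/-! ### Colouring passes -/

/-- The row-by-row matrix `a` is the adjacency matrix of `H` on `0, …, n - 1`. -/
def IsMat (n : ℕ) (a : ℕ → ℕ) (H : SimpleGraph ℕ) : Prop :=
  ∀ u < n, ∀ v < n, a (u * n + v) ≠ 0 ↔ H.Adj u v

/-- The nonzero cells of `a` with an index below `n` are those of the set `A`. -/
def IsSet (n : ℕ) (a : ℕ → ℕ) (A : Finset ℕ) : Prop := ∀ v < n, a v ≠ 0 ↔ v ∈ A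

/-- The truth value of a test, as `0` or `1`. -/
def Expr.flag (e : Expr) : Expr := e.not.not

open Classical in
theorem Expr.eval_flag (e : Expr) (σ : State) : e.flag.eval σ = if e.Holds σ then 1 else 0 := by
  by_cases h : e.eval σ = 0 <;> simp [flag, Expr.not, Holds, eval, h]

namespace Cmd

theorem exec_fill_flag {a v n : ℕ} {e : Expr} {σ : State} (hn : σ.reg 0 = n) (hv : v ≠ 0)
    (P : ℕ → Prop)
    (hP : ∀ i < n, ∀ τ, Frame [v] [a] σ τ → τ.reg v = i → τ.arr a i = σ.arr a i →
      (e.Holds τ ↔ P i)) {i : ℕ} (hi : i < n) :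
    ((fill a v e.flag).exec σ).arr a i ≠ 0 ↔ P i := by
  classical
  rw [exec_fill hv (fun i => if P i then 1 else 0) (fun i hi τ h1 h2 h3 => by
    rw [eval_flag, if_congr (hP i (hn ▸ hi) τ h1 h2 h3) rfl rfl]), if_pos (hn ▸ hi)]
  simp

theorem exec_fillMat_flag {a u v n : ℕ} {e : Expr} {σ : State} (hσ : Rows n σ) (hu : u ≠ 0)
    (hv : v ≠ 0) (huv : u ≠ v) (ha : a ≠ 2) (P : ℕ → ℕ → Prop)
    (hP : ∀ i < n, ∀ j < n, ∀ τ, Frame [u, v] [a] σ τ → τ.reg u = i → τ.reg v = j →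
      τ.arr a (i * n + j) = σ.arr a (i * n + j) → (e.Holds τ ↔ P i j)) {i j : ℕ} (hi : i < n)
    (hj : j < n) : ((fillMat a u v e.flag).exec σ).arr a (i * n + j) ≠ 0 ↔ P i j := by
  classical
  rw [exec_fillMat hσ hu hv huv ha (fun i j => if P i j then 1 else 0) (fun i hi j hj τ h1 h2 h3 h4 => by
    rw [eval_flag, if_congr (hP i hi j hj τ h1 h2 h3 h4) rfl rfl]) hi hj]
  simp

end Cmd

/-- The adjacency matrix of the graph in `aM` without the vertices in `rH` and `rZ` is written to
`aB`. -/
def buildB : Cmd :=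
  fillMat aB rU rV ((mat aM (reg rU) (reg rV)).and
    (((Expr.eq (reg rU) (reg rH)).or (.eq (reg rU) (reg rZ))).or
      ((Expr.eq (reg rV) (reg rH)).or (.eq (reg rV) (reg rZ)))).not).flag

theorem exec_buildB {n : ℕ} {σ : State} {M : SimpleGraph ℕ} (hσ : Rows n σ)
    (hM : IsMat n (σ.arr aM) M) {u v : ℕ} (hu : u < n) (hv : v < n) :
    (buildB.exec σ).arr aB (u * n + v) ≠ 0 ↔
      M.Adj u v ∧ (u ≠ σ.reg rH ∧ u ≠ σ.reg rZ) ∧ v ≠ σ.reg rH ∧ v ≠ σ.reg rZ := by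
  refine exec_fillMat_flag (a := aB) (u := rU) (v := rV) hσ (by decide) (by decide) (by decide)
    (by decide) (fun u v => M.Adj u v ∧ (u ≠ σ.reg rH ∧ u ≠ σ.reg rZ) ∧ v ≠ σ.reg rH ∧ v ≠ σ.reg rZ)
    ?_ hu hv
  intro i hi j hj τ hF h1 h2 _
  simp [mat, holds_read, eval, h1, h2, hF.reg, hF.arr, hσ.row i hi, ← hM i hi j hj]

/-- Check whether `aC` is a proper colouring of the graph in `aM` on the vertex set in `aW` with
colours `1, …, k`, where `k` is in register `rMax`. -/
def check : Cmd :=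
  .seq (.set rBad (const 0)) <|
  .seq (scanMat rU rV rBad ((mat aM (reg rU) (reg rV)).and
    (.eq (.read aC (reg rU)) (.read aC (reg rV))))) <|
  scan rV rBad ((Expr.read aW (reg rV)).and
    ((Expr.eq (.read aC (reg rV)) (const 0)).or (.lt (reg rMax) (.read aC (reg rV)))))

theorem exec_check {n : ℕ} {σ : State} {M : SimpleGraph ℕ} {W : Finset ℕ} (hσ : Rows n σ)
    (hM : IsMat n (σ.arr aM) M) (hT : ∀ {u v}, M.Adj u v → u ∈ W) (hW : IsSet n (σ.arr aW) W)
    (hWn : ∀ v ∈ W, v < n) :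
    (check.exec σ).reg rBad = 0 ↔ SimpleGraph.IsCol M W (σ.reg rMax) (σ.arr aC) := by
  set σ₁ := (Cmd.set rBad (const 0)).exec σ with h₁
  have hF₁ : Frame [rU, rV, rBad] [] σ σ₁ := frame_of (by decide) (by decide) σ
  have hr₁ : Rows n σ₁ := hσ.of_frame hF₁ (by decide) (by decide)
  have hs₂ := exec_scanMat (u := rU) (v := rV) (r := rBad) (σ := σ₁)
    (e := (mat aM (reg rU) (reg rV)).and (.eq (.read aC (reg rU)) (.read aC (reg rV))))
    (by decide) (by decide) (by decide) (by decide) (by decide) (by decide)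
    (fun u v => M.Adj u v ∧ σ.arr aC u = σ.arr aC v) (by
      rw [hr₁.size]
      intro i hi j hj τ hF h1 h2
      simp [mat, holds_read, eval, h1, h2, hF.arr, hF₁.arr, hσ.row i hi, ← hM i hi j hj])
  set σ₂ := Cmd.exec _ σ₁ with h₂
  have hF₂ : Frame [rU, rV, rBad] [] σ σ₂ := hF₁.trans (frame_of (by decide) (by decide) σ₁)
  have hr₂ : Rows n σ₂ := hσ.of_frame hF₂ (by decide) (by decide)
  have hs₃ := exec_scan (v := rV) (r := rBad) (σ := σ₂)
    (e := (Expr.read aW (reg rV)).and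
      ((Expr.eq (.read aC (reg rV)) (const 0)).or (.lt (reg rMax) (.read aC (reg rV)))))
    (by decide) (by decide) (by decide)
    (fun v => v ∈ W ∧ (σ.arr aC v = 0 ∨ σ.reg rMax < σ.arr aC v)) (by
      rw [hr₂.size]
      intro i hi τ hF h1
      simp [holds_read, eval, h1, hF.arr, hF.reg, hF₂.arr, hF₂.reg, ← hW i hi])
  change (check.exec σ).reg rBad ≠ 0 ↔ _ at hs₃
  rw [hs₂, hr₁.size, hr₂.size] at hs₃
  have h0 : σ₁.reg rBad = 0 := rfl
  rw [← not_iff_not, ← ne_eq, hs₃, h0]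
  constructor
  · rintro ((h | ⟨u, hu, v, hv, h, h'⟩) | ⟨v, hv, h, h'⟩) hC
    · exact h rfl
    · exact hC.proper u v h h'
    · have := hC.range v h
      omega
  · intro h
    by_contra! hno
    refine h ⟨fun u v huv => ?_, fun v hv => ?_⟩
    · exact hno.1.2 u (hWn u (hT huv)) v (hWn v (hT huv.symm)) huv
    · have := hno.2 v (hWn v hv) hv
      omega

/-- Colour the vertices with level `d` by `1 + d % 2`, then the vertex in `rH` by `3` and the one in
`rZ` by `4`. -/
def colourParity : Cmd :=
  .seq (.write aP (const 0) (const 0)) <|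
  .seq (.forN rK (.write aP (.add (reg rK) (const 1)) (.sub (const 1) (.read aP (reg rK))))) <|
  .seq (fill aC rV (.add (const 1) (.read aP (.read aD (reg rV))))) <|
  .seq (.write aC (reg rH) (const 3)) (.write aC (reg rZ) (const 4))

theorem exec_colourParity {n : ℕ} {σ : State} (hn : σ.reg 0 = n) (hD : ∀ v < n, σ.arr aD v ≤ n)
    {v : ℕ} (hv : v < n) : (colourParity.exec σ).arr aC v =
      if v = σ.reg rZ then 4 else if v = σ.reg rH then 3 else 1 + σ.arr aD v % 2 := by
  set σ₁ := (Cmd.write aP (const 0) (const 0)).exec σ with h₁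
  have hF₁ : Frame [rK] [aP] σ σ₁ := frame_of (by decide) (by decide) σ
  have hs₂ := forN_inv (x := rK) (σ := σ₁)
    (P := .write aP (.add (reg rK) (const 1)) (.sub (const 1) (.read aP (reg rK))))
    (by decide) (fun k τ => ∀ i ≤ k, τ.arr aP i = i % 2) (by
      intro i hi
      obtain rfl : i = 0 := by omega
      simp [State.setReg, h₁, exec, State.setArr, eval]) (by
      intro k hk τ hI hτk hF i hi
      simp only [exec, State.setReg, State.setArr, eval, hτk, hI k le_rfl, true_and]
      split_ifs with h
      · omega
      · exact hI i (by omega))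
  set σ₂ := Cmd.exec _ σ₁ with h₂
  have hF₂ : Frame [rK] [aP] σ σ₂ := hF₁.trans (frame_of (by decide) (by decide) σ₁)
  rw [hF₁.reg (by decide), hn] at hs₂
  have hs₃ := exec_fill (a := aC) (v := rV) (σ := σ₂)
    (e := .add (const 1) (.read aP (.read aD (reg rV)))) (by decide)
    (fun v => 1 + σ.arr aD v % 2) (by
      intro i hi τ hF h1 _
      rw [hF₂.reg (by decide), hn] at hi
      simp [eval, h1, hF.arr, hF₂.arr (b := aD), hs₂ _ (hD i hi)]) v
  rw [hF₂.reg (by decide), hn, if_pos hv] at hs₃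
  set σ₃ := Cmd.exec _ σ₂ with h₃
  have hF₃ : Frame [rK, rV] [aP, aC] σ₂ σ₃ := frame_of (by decide) (by decide) σ₂
  show ((σ₃.setArr aC (σ₃.reg rH) 3).setArr aC (σ₃.reg rZ) 4).arr aC v = _
  simp [State.setArr, hF₃.reg, hF₂.reg, hs₃]

/-- Give the vertex in `rV` the least colour among `1` and `2` that does not occur among its
neighbours, and otherwise the colour `3`. -/
def pick : Cmd :=
  .seq (.set rA (const 0)) <|
  .seq (scan rU rA ((mat aM (reg rV) (reg rU)).and (.eq (.read aC (reg rU)) (const 1)))) <|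
  .seq (.set rB (const 0)) <|
  .seq (scan rU rB ((mat aM (reg rV) (reg rU)).and (.eq (.read aC (reg rU)) (const 2)))) <|
  .ite (reg rA) (.ite (reg rB) (.write aC (reg rV) (const 3)) (.write aC (reg rV) (const 2)))
    (.write aC (reg rV) (const 1))

/-- The colour that `pick` chooses is at most `3`, all smaller ones occur among the neighbours, and
it does not itself occur there unless it is `3`. -/
theorem exec_pick {n : ℕ} {σ : State} {M : SimpleGraph ℕ} (hσ : Rows n σ)
    (hM : IsMat n (σ.arr aM) M) (hv : σ.reg rV < n) :
    ∃ c, (pick.exec σ).arr aC = Function.update (σ.arr aC) (σ.reg rV) c ∧ 1 ≤ c ∧ c ≤ 3 ∧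
      (∀ d, 1 ≤ d → d < c → ∃ u < n, M.Adj (σ.reg rV) u ∧ σ.arr aC u = d) ∧
      (c < 3 → ∀ u < n, M.Adj (σ.reg rV) u → σ.arr aC u ≠ c) := by
  set v := σ.reg rV with hvdef
  set σ₁ := (Cmd.set rA (const 0)).exec σ with h₁
  have hF₁ : Frame [rU, rA] [] σ σ₁ := frame_of (by decide) (by decide) σ
  have hs₂ := exec_scan (v := rU) (r := rA) (σ := σ₁)
    (e := (mat aM (reg rV) (reg rU)).and (.eq (.read aC (reg rU)) (const 1)))
    (by decide) (by decide) (by decide) (fun u => M.Adj v u ∧ σ.arr aC u = 1) (by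
      rw [hF₁.reg (y := rN) (by decide), hσ.size]
      intro i hi τ hF h1
      simp [mat, holds_read, eval, h1, hF.arr, hF.reg, hF₁.arr, hF₁.reg, hσ.row v hv, ← hM v hv i hi,
        ← hvdef])
  set σ₂ := Cmd.exec _ σ₁ with h₂
  have hF₂ : Frame [rU, rA] [] σ σ₂ := hF₁.trans (frame_of (by decide) (by decide) σ₁)
  set σ₃ := (Cmd.set rB (const 0)).exec σ₂ with h₃
  have hF₃ : Frame [rU, rA, rB] [] σ σ₃ :=
    (hF₂.mono (by decide) (by decide)).trans (frame_of (by decide) (by decide) σ₂)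
  have hs₄ := exec_scan (v := rU) (r := rB) (σ := σ₃)
    (e := (mat aM (reg rV) (reg rU)).and (.eq (.read aC (reg rU)) (const 2)))
    (by decide) (by decide) (by decide) (fun u => M.Adj v u ∧ σ.arr aC u = 2) (by
      rw [hF₃.reg (y := rN) (by decide), hσ.size]
      intro i hi τ hF h1
      simp [mat, holds_read, eval, h1, hF.arr, hF.reg, hF₃.arr, hF₃.reg, hσ.row v hv, ← hM v hv i hi,
        ← hvdef])
  set σ₄ := Cmd.exec _ σ₃ with h₄
  have hA : σ₄.reg rA = σ₂.reg rA := exec_reg (by decide) σ₃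
  have hF₄ : Frame [rU, rA, rB] [] σ σ₄ := hF₃.trans (frame_of (by decide) (by decide) σ₃)
  rw [hF₁.reg (y := rN) (by decide), hσ.size, ← hA] at hs₂
  rw [hF₃.reg (y := rN) (by decide), hσ.size] at hs₄
  have hv₄ : σ₄.reg rV = v := hF₄.reg (by decide)
  have hC₄ : σ₄.arr aC = σ.arr aC := hF₄.arr (by decide)
  have e1 : σ₁.reg rA = 0 := rfl
  have e3 : σ₃.reg rB = 0 := rfl
  rw [e1] at hs₂
  rw [e3] at hs₄
  simp only [ne_eq, not_true_eq_false, false_or] at hs₂ hs₄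
  have hw : ∀ c, ((Cmd.write aC (reg rV) (const c)).exec σ₄).arr aC =
      Function.update (σ.arr aC) v c := by
    intro c
    show (σ₄.setArr aC (σ₄.reg rV) c).arr aC = _
    rw [setArr_arr_self, hv₄, hC₄]
  have hex : pick.exec σ = (Cmd.ite (reg rA) (.ite (reg rB) (.write aC (reg rV) (const 3))
    (.write aC (reg rV) (const 2))) (.write aC (reg rV) (const 1))).exec σ₄ := rfl
  rw [hex]
  by_cases hA0 : σ₄.reg rA = 0
  · rw [hA0] at hs₂
    refine ⟨1, ?_, by omega, by omega, fun d _ _ => by omega, fun _ u hu h h' => ?_⟩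
    · rw [← hw 1]
      simp [exec, eval, hA0]
    · exact hs₂.2 ⟨u, hu, h, h'⟩ rfl
  by_cases hB0 : σ₄.reg rB = 0
  · rw [hB0] at hs₄
    refine ⟨2, ?_, by omega, by omega, fun d _ _ => ?_, fun _ u hu h h' => ?_⟩
    · rw [← hw 2]
      simp [exec, eval, hA0, hB0]
    · obtain rfl : d = 1 := by omega
      exact hs₂.1 hA0
    · exact hs₄.2 ⟨u, hu, h, h'⟩ rfl
  · refine ⟨3, ?_, by omega, by omega, fun d _ _ => ?_, fun h => by omega⟩
    · rw [← hw 3]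
      simp [exec, eval, hA0, hB0]
    · obtain rfl | rfl : d = 1 ∨ d = 2 := by omega
      exacts [hs₂.1 hA0, hs₄.1 hB0]

/-- Colour the vertices in `rH` and `rZ` by `1` and the others greedily, in the order of decreasing
levels. -/
def colourGreedy : Cmd :=
  .seq (fill aC rV (const 0)) <|
  .seq (.write aC (reg rH) (const 1)) <|
  .seq (.write aC (reg rZ) (const 1)) <|
  .forN rK (.forN rV (.ite (.eq (.add (.read aD (reg rV)) (reg rK)) (reg rN)) pick .skip))

/-- The vertices that are coloured by `colourGreedy` in round `k` before vertex `i`. -/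
def Done (n : ℕ) (h z : ℕ) (D : ℕ → ℕ) (k i v : ℕ) : Prop :=
  v = h ∨ v = z ∨ D v ≠ 0 ∧ (n < D v + k ∨ D v + k = n ∧ v < i)

/-- A partial greedy colouring. -/
structure PartialCol (n : ℕ) (M : SimpleGraph ℕ) (h z : ℕ) (D : ℕ → ℕ) (k i : ℕ) (C : ℕ → ℕ) :
    Prop where
  left : C h = 1
  right : C z = 1
  done : ∀ v < n, C v ≠ 0 ↔ Done n h z D k i v
  le : ∀ v < n, C v ≤ 3
  proper : ∀ u v, M.Adj u v → C u ≠ 0 → C v ≠ 0 → C u ≠ C v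

/-- The greedy step never needs a fourth colour: a vertex other than `t` has an uncoloured
neighbour, and `t` has two neighbours of the same colour. -/
theorem PartialCol.update {n : ℕ} {M : SimpleGraph ℕ} {W : Finset ℕ} {h z t k v c : ℕ} {D C : ℕ → ℕ}
    (hT : ∀ {u v}, M.Adj u v → u ∈ W) (hWn : ∀ v ∈ W, v < n) (hhz : h ≠ z) (hth : M.Adj t h)
    (htz : M.Adj t z) (hdeg : ∀ v ∈ W, v ≠ h → M.degIn W v ≤ 3)
    (hD : Levels n (fun u v => M.Adj u v ∧ (u ≠ h ∧ u ≠ z) ∧ v ≠ h ∧ v ≠ z) t D)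
    (hC : PartialCol n M h z D k v C) (hv : v < n) (hk : D v + k = n) (hkn : k < n) (h1 : 1 ≤ c)
    (h3 : c ≤ 3) (hlt : ∀ d, 1 ≤ d → d < c → ∃ u < n, M.Adj v u ∧ C u = d)
    (hne : c < 3 → ∀ u < n, M.Adj v u → C u ≠ c) :
    PartialCol n M h z D k (v + 1) (Function.update C v c) := by
  have hDv : D v ≠ 0 := by omega
  have hvhz : v ≠ h ∧ v ≠ z := by
    by_cases hvt : v = t
    · rw [hvt]; exact ⟨hth.ne, htz.ne⟩
    · obtain ⟨u, -, -, -, h5⟩ := hD.pred v hv hDv hvt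
      exact h5.2.2
  have hne' : ∀ u, M.Adj v u → C u ≠ c := by
    intro u hu hcu
    have hvW : v ∈ W := hT hu
    have huW : u ∈ W := hT hu.symm
    by_cases hc : c < 3
    · exact hne hc u (hWn u huW) hu hcu
    obtain rfl : c = 3 := by omega
    obtain ⟨a, ha, hav, ha1⟩ := hlt 1 le_rfl (by omega)
    obtain ⟨b, hb, hbv, hb2⟩ := hlt 2 (by omega) (by omega)
    -- besides `u` and two neighbours with colours `1` and `2` there would be a fourth neighbour
    have hex : ∃ w, w ≠ a ∧ w ≠ b ∧ w ≠ u ∧ M.Adj v w := by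
      by_cases hvt : v = t
      · subst hvt
        have hz1 := hC.right
        have hh1 := hC.left
        by_cases hah : a = h
        · exact ⟨z, by rintro rfl; exact hhz hah.symm, by rintro rfl; omega, by rintro rfl; omega, htz⟩
        · exact ⟨h, fun h => hah h.symm, by rintro rfl; omega, by rintro rfl; omega, hth⟩
      · obtain ⟨w, hw, h5, h6, h7⟩ := hD.pred v hv hDv hvt
        have hw0 : C w = 0 := by
          by_contra hw0
          rcases (hC.done w hw).1 hw0 with h8 | h8 | ⟨-, h8⟩
          · exact h7.2.1.1 h8
          · exact h7.2.1.2 h8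
          · omega
        exact ⟨w, by rintro rfl; omega, by rintro rfl; omega, by rintro rfl; omega, h7.1.symm⟩
    obtain ⟨w, hwa, hwb, hwu, hvw⟩ := hex
    have := SimpleGraph.le_degIn (H := M) (A := W) (l := {w, a, b, u}) v (by
      intro x hx
      simp only [Finset.mem_insert, Finset.mem_singleton] at hx
      rcases hx with rfl | rfl | rfl | rfl
      exacts [⟨hT hvw.symm, hvw⟩, ⟨hT hav.symm, hav⟩, ⟨hT hbv.symm, hbv⟩, ⟨huW, hu⟩])
    have hab : a ≠ b := by rintro rfl; omega
    have hau : a ≠ u := by rintro rfl; omega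
    have hbu : b ≠ u := by rintro rfl; omega
    rw [Finset.card_insert_of_notMem (by simp [hwa, hwb, hwu]),
      Finset.card_insert_of_notMem (by simp [hab, hau]),
      Finset.card_insert_of_notMem (by simp [hbu]), Finset.card_singleton] at this
    have := hdeg v hvW hvhz.1
    omega
  constructor
  · rw [Function.update_of_ne hvhz.1.symm, hC.left]
  · rw [Function.update_of_ne hvhz.2.symm, hC.right]
  · intro w hw
    by_cases hwv : w = v
    · subst hwv
      rw [Function.update_self]
      exact ⟨fun _ => Or.inr (Or.inr ⟨hDv, Or.inr ⟨hk, by omega⟩⟩), fun _ => by omega⟩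
    · rw [Function.update_of_ne hwv, hC.done w hw]
      unfold Done
      have : w < v + 1 ↔ w < v := by omega
      rw [this]
  · intro w hw
    by_cases hwv : w = v
    · subst hwv; rwa [Function.update_self]
    · rw [Function.update_of_ne hwv]; exact hC.le w hw
  · intro a b hab
    by_cases hav : a = v
    · subst hav
      rw [Function.update_self, Function.update_of_ne hab.ne']
      exact fun _ _ => (hne' b hab).symm
    · by_cases hbv : b = v
      · subst hbv
        rw [Function.update_self, Function.update_of_ne hav]
        exact fun _ _ => hne' a hab.symm
      · rw [Function.update_of_ne hav, Function.update_of_ne hbv]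
        exact hC.proper a b hab

/-- If all vertices but `h` have degree at most three, and `h`, `z` are two nonadjacent neighbours
of `t` such that all other vertices are reachable from `t` without them, then the greedy colouring
towards `t` is proper. -/
theorem exec_colourGreedy {n : ℕ} {σ : State} {M : SimpleGraph ℕ} {W : Finset ℕ} {h z t : ℕ}
    (hσ : Rows n σ) (hM : IsMat n (σ.arr aM) M) (hh : σ.reg rH = h) (hz : σ.reg rZ = z)
    (hT : ∀ {u v}, M.Adj u v → u ∈ W) (hWn : ∀ v ∈ W, v < n) (hhz : h ≠ z) (hnhz : ¬ M.Adj h z)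
    (hth : M.Adj t h) (htz : M.Adj t z) (hdeg : ∀ v ∈ W, v ≠ h → M.degIn W v ≤ 3)
    (hD : Levels n (fun u v => M.Adj u v ∧ (u ≠ h ∧ u ≠ z) ∧ v ≠ h ∧ v ≠ z) t (σ.arr aD))
    (hreach : ∀ v ∈ W, σ.arr aD v ≠ 0 ∨ v = h ∨ v = z) :
    SimpleGraph.IsCol M W 3 ((colourGreedy.exec σ).arr aC) := by
  classical
  set D := σ.arr aD with hDdef
  have hs₁ := exec_fill (a := aC) (v := rV) (e := const 0) (σ := σ) (by decide) (fun _ => 0)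
    (fun _ _ _ _ _ _ => rfl)
  set σ₁ := (fill aC rV (const 0)).exec σ with h₁
  have hF₁ : Frame [rV] [aC] σ σ₁ := frame_of (by decide) (by decide) σ
  set σ₂ := (Cmd.write aC (reg rH) (const 1)).exec σ₁ with h₂
  have hF₂ : Frame [rV] [aC] σ σ₂ := hF₁.trans (frame_of (by decide) (by decide) σ₁)
  set σ₃ := (Cmd.write aC (reg rZ) (const 1)).exec σ₂ with h₃
  have hF₃ : Frame [rV] [aC] σ σ₃ := hF₂.trans (frame_of (by decide) (by decide) σ₂)
  have hr₃ : Rows n σ₃ := hσ.of_frame hF₃ (by decide) (by decide)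
  have hC₃ : σ₃.arr aC = Function.update (Function.update (σ₁.arr aC) h 1) z 1 := by
    show ((σ₁.setArr aC (σ₁.reg rH) 1).setArr aC (σ₂.reg rZ) 1).arr aC = _
    rw [setArr_arr_self, setArr_arr_self, hF₁.reg (by decide), hF₂.reg (by decide), hh, hz]
  have h0 : PartialCol n M h z D 0 0 (σ₃.arr aC) := by
    have hval : ∀ v < n, σ₃.arr aC v = if v = h ∨ v = z then 1 else 0 := by
      intro v hv
      rw [hC₃]
      by_cases hvz : v = z
      · subst hvz; simp
      · rw [Function.update_of_ne hvz]
        by_cases hvh : v = h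
        · subst hvh; simp
        · rw [Function.update_of_ne hvh, hs₁, if_pos (by rwa [hσ.size])]
          simp [hvh, hvz]
    refine ⟨?_, ?_, ?_, ?_, ?_⟩
    · rw [hval h (hWn h (hT hth.symm))]; simp
    · rw [hval z (hWn z (hT htz.symm))]; simp
    · intro v hv
      rw [hval v hv]
      have := hD.le v hv
      unfold Done
      constructor
      · intro h5
        by_cases h6 : v = h ∨ v = z
        · rcases h6 with h6 | h6
          exacts [Or.inl h6, Or.inr (Or.inl h6)]
        · exact absurd (if_neg h6) h5
      · rintro (h5 | h5 | ⟨-, h5⟩)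
        · simp [h5]
        · simp [h5]
        · omega
    · intro v hv
      rw [hval v hv]
      split_ifs <;> omega
    · intro u v huv hu hv
      rw [hval u (hWn u (hT huv))] at hu
      rw [hval v (hWn v (hT huv.symm))] at hv
      have hu' : u = h ∨ u = z := by
        by_contra h6; exact hu (if_neg h6)
      have hv' : v = h ∨ v = z := by
        by_contra h6; exact hv (if_neg h6)
      rcases hu' with rfl | rfl <;> rcases hv' with rfl | rfl
      exacts [absurd rfl huv.ne, absurd huv hnhz, absurd huv.symm hnhz, absurd rfl huv.ne]
  have key := forN_inv (x := rK) (σ := σ₃) (P := .forN rV (.ite (.eq (.add (.read aD (reg rV))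
      (reg rK)) (reg rN)) pick .skip)) (by decide)
    (fun k τ => PartialCol n M h z D k 0 (τ.arr aC)) h0 ?_
  · rw [hr₃.size] at key
    change PartialCol n M h z D n 0 ((colourGreedy.exec σ).arr aC) at key
    have hpos : ∀ v ∈ W, (colourGreedy.exec σ).arr aC v ≠ 0 := by
      intro v hv
      refine (key.done v (hWn v hv)).2 ?_
      rcases hreach v hv with h5 | h5 | h5
      · exact Or.inr (Or.inr ⟨h5, by omega⟩)
      · exact Or.inl h5
      · exact Or.inr (Or.inl h5)
    exact ⟨fun u v huv => key.proper u v huv (hpos u (hT huv)) (hpos v (hT huv.symm)),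
      fun v hv => ⟨Nat.one_le_iff_ne_zero.2 (hpos v hv), key.le v (hWn v hv)⟩⟩
  intro k hk τ hI hτk hF
  rw [hr₃.size] at hk
  have hF' : Frame [rU, rV, rK, rA, rB] [aC] σ₃ τ := hF.mono (by decide) (by decide)
  have hτ : Rows n τ := hr₃.of_frame hF' (by decide) (by decide)
  have key2 := forN_inv (x := rV) (σ := τ) (P := .ite (.eq (.add (.read aD (reg rV))
      (reg rK)) (reg rN)) pick .skip) (by decide)
    (fun i ρ => PartialCol n M h z D k i (ρ.arr aC)) hI ?_
  · rw [hτ.size] at key2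
    show PartialCol n M h z D (k + 1) 0 ((Cmd.exec _ τ).arr aC)
    refine ⟨key2.left, key2.right, fun v hv => ?_, key2.le, key2.proper⟩
    rw [key2.done v hv]
    unfold Done
    have : (n < D v + k ∨ D v + k = n ∧ v < n) ↔ (n < D v + (k + 1) ∨ D v + (k + 1) = n ∧ v < 0) := by
      omega
    rw [this]
  intro v hv ρ hIρ hρv hFρ
  rw [hτ.size] at hv
  have hFρ' : Frame [rU, rV, rA, rB] [aC] τ ρ := hFρ.mono (by decide) (by decide)
  have hρ : Rows n ρ := hτ.of_frame hFρ' (by decide) (by decide)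
  have hρk : ρ.reg rK = k := (hFρ'.reg (by decide)).trans hτk
  have hDρ : ρ.arr aD = D := by
    rw [hFρ'.arr (by decide), hF'.arr (by decide), hF₃.arr (by decide)]
  have hMρ : IsMat n (ρ.arr aM) M := by
    rwa [hFρ'.arr (by decide), hF'.arr (by decide), hF₃.arr (by decide)]
  show PartialCol n M h z D k (v + 1) ((Cmd.exec _ ρ).arr aC)
  rw [exec_ite]
  have hcond : (Expr.eq (.add (.read aD (reg rV)) (reg rK)) (reg rN)).Holds ρ ↔ D v + k = n := by
    simp [eval, hρv, hρk, hDρ, hρ.size]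
  by_cases hlev : D v + k = n
  · rw [if_pos (hcond.2 hlev)]
    obtain ⟨c, hc, h5, h6, h7, h8⟩ := exec_pick hρ hMρ (hρv ▸ hv)
    rw [hρv] at hc h7 h8
    rw [hc]
    exact hIρ.update hT hWn hhz hth htz hdeg hD hv hlev hk h5 h6 h7 h8
  · rw [if_neg (fun h => hlev (hcond.1 h))]
    refine ⟨hIρ.left, hIρ.right, fun w hw => ?_, hIρ.le, hIρ.proper⟩
    rw [show Cmd.skip.exec ρ = ρ from rfl, hIρ.done w hw]
    unfold Done
    have : (D w + k = n ∧ w < v) ↔ (D w + k = n ∧ w < v + 1) := by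
      constructor
      · rintro ⟨h5, h6⟩; exact ⟨h5, by omega⟩
      · rintro ⟨h5, h6⟩
        refine ⟨h5, lt_of_le_of_ne (by omega) ?_⟩
        rintro rfl
        exact hlev h5
    rw [this]

/-- If `M` without `h` and `z` is bipartite and reachable from `t`, then the levels modulo two give
a colouring. -/
theorem exec_colourParity_isCol {n cb : ℕ} {σ : State} {M : SimpleGraph ℕ} {W : Finset ℕ} {h z t : ℕ}
    (hn : σ.reg 0 = n) (hh : σ.reg rH = h) (hz : σ.reg rZ = z)
    (hT : ∀ {u v}, M.Adj u v → u ∈ W) (hWn : ∀ v ∈ W, v < n) (hcb : 2 ≤ cb)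
    (hhW : h ∈ W → 3 ≤ cb) (hzW : z ∈ W → 4 ≤ cb) {g : ℕ → Bool} (hth : t ≠ h) (htz : t ≠ z)
    (hg : ∀ u v, M.Adj u v → u ≠ h → u ≠ z → v ≠ h → v ≠ z → g u ≠ g v)
    (hD : Levels n (fun u v => M.Adj u v ∧ (u ≠ h ∧ u ≠ z) ∧ v ≠ h ∧ v ≠ z) t (σ.arr aD))
    (hreach : ∀ v ∈ W, σ.arr aD v ≠ 0 ∨ v = h ∨ v = z) :
    SimpleGraph.IsCol M W cb ((colourParity.exec σ).arr aC) := by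
  set D := σ.arr aD with hDdef
  have hpar : ∀ m, ∀ v < n, v ≠ h → v ≠ z → D v = m → D v ≠ 0 →
      (g v = g t ↔ D v % 2 = 1) := by
    intro m
    induction m with
    | zero => intro v _ _ _ h1 h2; exact absurd h1 h2
    | succ m ih =>
      intro v hv hvh hvz hm h0
      by_cases hvt : v = t
      · subst hvt; simp [hD.root]
      · obtain ⟨u, hu, h1, h2, h3, h4, -⟩ := hD.pred v hv h0 hvt
        have h5 := ih u hu h4.1 h4.2 (by omega) h2
        have h6 := hg u v h3 h4.1 h4.2 hvh hvz
        have h7 : g v = g t ↔ ¬ g u = g t := by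
          revert h6
          cases g u <;> cases g v <;> cases g t <;> simp
        rw [h7, h5]
        omega
  have hval : ∀ v ∈ W, (colourParity.exec σ).arr aC v =
      if v = z then 4 else if v = h then 3 else 1 + D v % 2 := by
    intro v hv
    rw [exec_colourParity hn hD.le (hWn v hv), hh, hz]
  constructor
  · intro u v huv
    have huW := hT huv
    have hvW := hT huv.symm
    rw [hval u huW, hval v hvW]
    have hne := huv.ne
    by_cases huz : u = z
    · have hvz : v ≠ z := fun h => hne (huz.trans h.symm)
      rw [if_pos huz, if_neg hvz]
      split_ifs <;> omega
    · by_cases hvz : v = z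
      · rw [if_pos hvz, if_neg huz]
        split_ifs <;> omega
      · rw [if_neg huz, if_neg hvz]
        by_cases huh : u = h
        · have hvh : v ≠ h := fun h => hne (huh.trans h.symm)
          rw [if_pos huh, if_neg hvh]
          omega
        · rw [if_neg huh]
          by_cases hvh : v = h
          · rw [if_pos hvh]; omega
          · rw [if_neg hvh]
            have h1 := hpar _ u (hWn u huW) huh huz rfl ((hreach u huW).resolve_right (by tauto))
            have h2 := hpar _ v (hWn v hvW) hvh hvz rfl ((hreach v hvW).resolve_right (by tauto))
            have h3 := hg u v huv huh huz hvh hvz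
            intro h4
            have h5 : g u = g t ↔ g v = g t := by rw [h1, h2]; omega
            revert h3 h5
            cases g u <;> cases g v <;> cases g t <;> simp
  · intro v hv
    rw [hval v hv]
    split_ifs with h1 h2
    · subst h1; have := hzW hv; omega
    · subst h2; have := hhW hv; omega
    · omega

open Cmd RAM.Expr SimpleGraph

/-! ### Peeling off one side of a cut -/

/-- The arrays `e` and `a` hold the adjacency matrix and the vertex set of a graph `H` on
`A ⊆ {0, …, n - 1}`. -/
structure IsGraph (n : ℕ) (e a : ℕ → ℕ) (H : SimpleGraph ℕ) (A : Finset ℕ) : Prop where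
  mat : IsMat n e H
  set : IsSet n a A
  mem : ∀ {u v}, H.Adj u v → u ∈ A
  lt : ∀ v ∈ A, v < n

/-- One attempt to colour the graph in `aM` by the colouring pass `col`, followed by `fin` if it
succeeds. -/
def attempt (col fin : Cmd) : Cmd :=
  .ite (reg rFound).not (.seq buildB <| .seq bfs <| .seq col <| .seq check <|
    .ite (reg rBad) .skip fin) .skip

/-- An attempt that is skipped after a success does not spoil the success. -/
theorem keeps_guard {P : Cmd} {Win : State → Prop} (h : ∀ σ, Win σ → σ.reg rFound ≠ 0) :
    Keeps (.ite (reg rFound).not P .skip) Win := by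
  intro σ hσ
  have := h σ hσ
  have he : (reg rFound).not.eval σ = 0 := by simp [Expr.not, eval, this]
  simpa [exec, he] using hσ

/-- An attempt succeeds if the colouring pass yields a colouring, given correct levels. Since every
colouring is checked, nothing is needed about the pass otherwise. -/
theorem search_attempt {col fin : Cmd} {n cb : ℕ} {M : SimpleGraph ℕ} {W : Finset ℕ}
    {Base Win : State → Prop} {good : Prop}
    (hcR : col.regs.all [rU, rV, rK, rA, rB, rBad].elem = true)
    (hcB : col.arrs.all [aB, aD, aC, aP].elem = true)
    (hstable : ∀ σ τ, Base σ → Frame [rU, rV, rK, rA, rB, rBad] [aB, aD, aC, aP] σ τ → Base τ)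
    (hBase : ∀ σ, Base σ → Rows n σ ∧ σ.reg rFound = 0 ∧ σ.reg rMax = cb ∧
      IsGraph n (σ.arr aM) (σ.arr aW) M W)
    (hWin : ∀ σ, Base σ → IsCol M W cb (σ.arr aC) → Win (fin.exec σ))
    (hgood : good → ∀ σ, Base σ →
      Levels n (fun u v => M.Adj u v ∧ (u ≠ σ.reg rH ∧ u ≠ σ.reg rZ) ∧ v ≠ σ.reg rH ∧ v ≠ σ.reg rZ)
        (σ.reg rT) (σ.arr aD) → IsCol M W cb ((col.exec σ).arr aC)) :
    Search (attempt col fin) Base Win good := by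
  intro σ hσ
  obtain ⟨hr, hf, hcb, hG⟩ := hBase σ hσ
  have he : (reg rFound).not.eval σ ≠ 0 := by simp [Expr.not, eval, hf]
  set σ₁ := buildB.exec σ with h₁
  have hF₁ : Frame [rU, rV, rK, rA, rB, rBad] [aB, aD, aC, aP] σ σ₁ :=
    frame_of (by decide) (by decide) σ
  have hr₁ := hr.of_frame hF₁ (by decide) (by decide)
  have hL := exec_bfs hr₁
  set σ₂ := bfs.exec σ₁ with h₂
  have hF₁₂ : Frame [rU, rV, rK, rA, rB, rBad] [aD] σ₁ σ₂ := frame_of (by decide) (by decide) σ₁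
  have hF₂ : Frame [rU, rV, rK, rA, rB, rBad] [aB, aD, aC, aP] σ σ₂ :=
    hF₁.trans (hF₁₂.mono (by decide) (by decide))
  set σ₃ := col.exec σ₂ with h₃
  have hF₃ : Frame [rU, rV, rK, rA, rB, rBad] [aB, aD, aC, aP] σ σ₃ :=
    hF₂.trans (frame_of hcR hcB σ₂)
  obtain ⟨hr₃, -, hcb₃, hG₃⟩ := hBase σ₃ (hstable _ _ hσ hF₃)
  have hch := exec_check hr₃ hG₃.mat hG₃.mem hG₃.set hG₃.lt
  set σ₄ := check.exec σ₃ with h₄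
  have hF₃₄ : Frame [rU, rV, rK, rA, rB, rBad] [] σ₃ σ₄ := frame_of (by decide) (by decide) σ₃
  have hF₄ : Frame [rU, rV, rK, rA, rB, rBad] [aB, aD, aC, aP] σ σ₄ :=
    hF₃.trans (hF₃₄.mono (by decide) (by decide))
  have hB₄ := hstable _ _ hσ hF₄
  rw [hcb₃] at hch
  have hex : (attempt col fin).exec σ = (Cmd.ite (reg rBad) .skip fin).exec σ₄ := by
    rw [attempt, exec, if_pos he]
    rfl
  rw [hex]
  by_cases hb : σ₄.reg rBad = 0
  · left
    have : (Cmd.ite (reg rBad) .skip fin).exec σ₄ = fin.exec σ₄ := by simp [exec, eval, hb]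
    rw [this]
    refine hWin _ hB₄ ?_
    rw [hF₃₄.arr (by decide)]
    exact hch.1 hb
  · right
    have : (Cmd.ite (reg rBad) .skip fin).exec σ₄ = σ₄ := by simp [exec, eval, hb]
    rw [this]
    refine ⟨hB₄, fun hg => hb (hch.2 (hgood hg σ₂ (hstable _ _ hσ hF₂) ?_))⟩
    rw [hF₁₂.reg (by decide), hF₁₂.reg (by decide), hF₁₂.reg (by decide)]
    have hrH : σ₁.reg rH = σ.reg rH := hF₁.reg (by decide)
    have hrZ : σ₁.reg rZ = σ.reg rZ := hF₁.reg (by decide)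
    have key : ∀ u < n, ∀ v < n, σ₁.arr aB (u * n + v) ≠ 0 ↔ _ := fun u hu v hv =>
      exec_buildB hr hG.mat hu hv
    rw [hrH, hrZ]
    refine ⟨hL.root, fun v hv h1 h2 => ?_, fun u hu h1 v hv h2 => hL.closed u hu h1 v hv
      ((key u hu v hv).2 h2), hL.le⟩
    obtain ⟨u, hu, h3, h4, h5⟩ := hL.pred v hv h1 h2
    exact ⟨u, hu, h3, h4, (key u hu v hv).1 h5⟩

/-- The torso of the set in `aS`: the edges of the graph in `aE` inside `aS` and the vertices in
`aY`, together with all edges between vertices in `aY`. It is written to `aM` and `aW`. -/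
def buildM : Cmd :=
  .seq (fill aW rV ((Expr.read aLive (reg rV)).and
    ((Expr.read aS (reg rV)).or (.read aY (reg rV)))).flag)
  (fillMat aM rU rV ((((Expr.read aW (reg rU)).and (.read aW (reg rV))).and
      (mat aE (reg rU) (reg rV))).or
    ((Expr.eq (reg rU) (reg rV)).not.and
      ((Expr.read aY (reg rU)).and (.read aY (reg rV))))).flag)

/-- Copy the array `s` to the row with index `rLev` of the matrix `a`. -/
def copyRow (a s : ℕ) : Cmd :=
  .forN rV (.write a (.add (.read aRow (reg rLev)) (reg rV)) (.read s (reg rV)))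

theorem exec_copyRow {a s n l : ℕ} {σ : State} (hσ : Rows n σ) (ha : a ≠ 2) (has : s ≠ a)
    (hl : σ.reg rLev = l) (hln : l < n) {i j : ℕ} (hj : j < n) :
    ((copyRow a s).exec σ).arr a (i * n + j) =
      if i = l then σ.arr s j else σ.arr a (i * n + j) := by
  have := forN_inv (x := rV) (σ := σ)
    (P := .write a (.add (.read aRow (reg rLev)) (reg rV)) (.read s (reg rV))) (by simp [WF, regs])
    (fun k τ => ∀ j < n, τ.arr a (i * n + j) =
      if i = l ∧ j < k then σ.arr s j else σ.arr a (i * n + j)) (by simp [State.setReg]) ?_ j hj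
  · rw [hσ.size] at this
    simpa [hj, copyRow] using this
  intro k hk τ hI hτk hF j hj
  rw [hσ.size] at hk
  have hF' : Frame [rV] [a] σ τ := hF.mono (by simp [regs]) (by simp [arrs])
  have e1 : τ.reg rLev = l := by rw [hF'.reg (by decide), hl]
  have e2 : τ.arr aRow l = l * n := by rw [hF'.arr (by simp [ha.symm]), hσ.row l hln]
  have e3 : τ.arr s = σ.arr s := hF'.arr (by simp [has])
  simp only [exec, eval, State.setArr, State.setReg, e1, e2, e3, hτk, true_and]
  by_cases hij : i = l ∧ j = k
  · obtain ⟨rfl, rfl⟩ := hij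
    simp
  · have hne : ¬ i * n + j = l * n + k := fun h => hij (index_inj hj hk h)
    rw [if_neg hne, hI j hj]
    congr 1
    simp only [eq_iff_iff]
    omega

/-- Record the colouring of the part in `aS` and replace this part of the graph in `aE` by a
complete graph on the vertices in `aX`. -/
def commit : Cmd :=
  .seq (.set rFound (const 1)) <|
  .seq (copyRow aRC aC) <| .seq (copyRow aRX aX) <| .seq (copyRow aRS aS) <|
  .seq (fill aLive rV ((Expr.read aLive (reg rV)).and
    ((Expr.read aS (reg rV)).not.or (.read aX (reg rV)))).flag)
  (fillMat aE rU rV ((((Expr.read aLive (reg rU)).and (.read aLive (reg rV))).and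
      (mat aE (reg rU) (reg rV))).or
    ((Expr.eq (reg rU) (reg rV)).not.and
      ((Expr.read aX (reg rU)).and (.read aX (reg rV))))).flag)

/-- A graph that arises in the course of the algorithm: it is used up, or it is tight and has no
dominating vertex. -/
def Good (H : SimpleGraph ℕ) (A : Finset ℕ) : Prop :=
  A = ∅ ∨ Tight H A ∧ ∀ h ∈ A, ∃ v ∈ A, v ≠ h ∧ ¬ H.Adj h v

/-- Every `3`-colouring `f` of `H'` extends to `H`: the part `S` is coloured by `c` up to a
permutation of the colours, which has to be such that `v` and `w v - 1` get different colours if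
`w v ≠ 0`. -/
def Extends (n : ℕ) (c w : ℕ → ℕ) (S : ℕ → Prop) (H : SimpleGraph ℕ) (A : Finset ℕ)
    (H' : SimpleGraph ℕ) (A' : Finset ℕ) : Prop :=
  ∀ f, IsCol H' A' 3 f →
    (∃ p q, IsPerm p q ∧ ∀ v < n, w v ≠ 0 → permColour p q (c v) ≠ f (w v - 1)) ∧
    ∀ p q, IsPerm p q → (∀ v < n, w v ≠ 0 → permColour p q (c v) ≠ f (w v - 1)) →
      ∀ f', (∀ v < n, S v → f' v = permColour p q (c v)) → (∀ v < n, ¬ S v → f' v = f v) →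
        IsCol H A 3 f'

/-- The graph `H` on `A` is split into the torso `M` on `W` of the part `X` and the remaining graph
`H'` on `A'`. The edges between the two sides join `v` and `w v - 1` for `w v ≠ 0`. -/
structure Peel (n : ℕ) (H : SimpleGraph ℕ) (A X : Finset ℕ) (w : ℕ → ℕ) (Y : ℕ → Prop)
    (M : SimpleGraph ℕ) (W : Finset ℕ) (H' : SimpleGraph ℕ) (A' : Finset ℕ) : Prop where
  memW : ∀ v < n, v ∈ W ↔ v ∈ A ∧ (v ∈ X ∨ Y v)
  adjM : ∀ u < n, ∀ v < n, M.Adj u v ↔ u ∈ W ∧ v ∈ W ∧ H.Adj u v ∨ u ≠ v ∧ Y u ∧ Y v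
  memA : ∀ v < n, v ∈ A' ↔ v ∈ A ∧ (v ∉ X ∨ w v ≠ 0)
  adjH : ∀ u < n, ∀ v < n, H'.Adj u v ↔ u ∈ A' ∧ v ∈ A' ∧ H.Adj u v ∨ u ≠ v ∧ w u ≠ 0 ∧ w v ≠ 0
  memM : ∀ {u v}, M.Adj u v → u ∈ W
  subW : W ⊆ A
  memH : ∀ {u v}, H'.Adj u v → u ∈ A'
  subA : A' ⊆ A
  card : A' = ∅ ∨ A'.card < A.card
  good : Good H' A'
  ext : ∀ c, IsCol M W 3 c → Extends n c w (· ∈ X) H A H' A'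

theorem exec_buildM {n : ℕ} {σ : State} {H M H' : SimpleGraph ℕ} {A X W A' : Finset ℕ} {w : ℕ → ℕ}
    {Y : ℕ → Prop} (hσ : Rows n σ) (hG : IsGraph n (σ.arr aE) (σ.arr aLive) H A)
    (hX : IsSet n (σ.arr aS) X) (hY : ∀ v < n, σ.arr aY v ≠ 0 ↔ Y v)
    (hP : Peel n H A X w Y M W H' A') :
    IsGraph n ((buildM.exec σ).arr aM) ((buildM.exec σ).arr aW) M W := by
  have hs₁ : ∀ v < n, _ ↔ _ := fun v hv => exec_fill_flag (a := aW) (v := rV) (n := n) (σ := σ)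
    (e := (Expr.read aLive (reg rV)).and ((Expr.read aS (reg rV)).or (.read aY (reg rV))))
    hσ.size (by decide) (fun v => v ∈ A ∧ (v ∈ X ∨ Y v)) (by
      intro i hi τ hF h1 _
      simp [holds_read, eval, h1, hF.arr, ← hG.set i hi, ← hX i hi, ← hY i hi]) (i := v) hv
  set σ₁ := (fill aW rV ((Expr.read aLive (reg rV)).and
    ((Expr.read aS (reg rV)).or (.read aY (reg rV)))).flag).exec σ with h₁
  have hF₁ : Frame [rV] [aW] σ σ₁ := frame_of (by decide) (by decide) σ
  have hr₁ := hσ.of_frame hF₁ (by decide) (by decide)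
  have hs₂ : ∀ u < n, ∀ v < n, _ ↔ _ := fun u hu v hv => exec_fillMat_flag (a := aM) (u := rU)
    (v := rV) (n := n) (σ := σ₁) (e := ((((Expr.read aW (reg rU)).and (.read aW (reg rV))).and
      (mat aE (reg rU) (reg rV))).or
    ((Expr.eq (reg rU) (reg rV)).not.and
      ((Expr.read aY (reg rU)).and (.read aY (reg rV)))))) hr₁
    (by decide) (by decide) (by decide) (by decide)
    (fun u v => (u ∈ W ∧ v ∈ W ∧ H.Adj u v) ∨ (u ≠ v ∧ Y u ∧ Y v)) (by
      intro i hi j hj τ hF h1 h2 _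
      have e1 := hs₁ i hi
      have e2 := hs₁ j hj
      rw [← hP.memW i hi] at e1
      rw [← hP.memW j hj] at e2
      simp [mat, holds_read, eval, h1, h2, hF.arr, hF₁.arr (b := aE), hF₁.arr (b := aRow),
        hF₁.arr (b := aY), hσ.row i hi, ← e1, ← e2, ← hG.mat i hi j hj, ← hY i hi, ← hY j hj,
        and_assoc]) (i := u) (j := v) hu hv
  have hF₂ : Frame [rU, rV] [aM] σ₁ (buildM.exec σ) := frame_of (by decide) (by decide) σ₁
  refine ⟨fun u hu v hv => ?_, fun v hv => ?_, hP.memM, fun v hv => hG.lt v (hP.subW hv)⟩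
  · rw [hP.adjM u hu v hv]
    exact hs₂ u hu v hv
  · rw [hF₂.arr (by decide), hs₁ v hv, hP.memW v hv]

/-- The outcome of round `l` of the algorithm: the graph in `aE`, previously `H`, has been replaced
by a smaller graph whose colourings extend to `H` by means of row `l` of the records. -/
structure Peeled (n l : ℕ) (H : SimpleGraph ℕ) (A : Finset ℕ) (ρ σ : State) : Prop where
  found : σ.reg rFound ≠ 0
  graph : ∃ H' A', IsGraph n (σ.arr aE) (σ.arr aLive) H' A' ∧ Good H' A' ∧
    (A' = ∅ ∨ A'.card < A.card) ∧
    Extends n (fun v => σ.arr aRC (l * n + v)) (fun v => σ.arr aRX (l * n + v))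
      (fun v => σ.arr aRS (l * n + v) ≠ 0) H A H' A'
  keep : ∀ i ≠ l, ∀ v < n, σ.arr aRC (i * n + v) = ρ.arr aRC (i * n + v) ∧
    σ.arr aRX (i * n + v) = ρ.arr aRX (i * n + v) ∧ σ.arr aRS (i * n + v) = ρ.arr aRS (i * n + v)

theorem exec_commit {n l : ℕ} {ρ σ : State} {H M H' : SimpleGraph ℕ} {A X W A' : Finset ℕ}
    {Y : ℕ → Prop} (hσ : Rows n σ) (hl : σ.reg rLev = l) (hln : l < n)
    (hG : IsGraph n (σ.arr aE) (σ.arr aLive) H A)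
    (hX : IsSet n (σ.arr aS) X) (hP : Peel n H A X (σ.arr aX) Y M W H' A')
    (hC : IsCol M W 3 (σ.arr aC)) (hRC : σ.arr aRC = ρ.arr aRC) (hRX : σ.arr aRX = ρ.arr aRX)
    (hRS : σ.arr aRS = ρ.arr aRS) : Peeled n l H A ρ (commit.exec σ) := by
  set σ₁ := (Cmd.set rFound (const 1)).exec σ with h₁
  have hF₁ : Frame [rFound] [] σ σ₁ := frame_of (by decide) (by decide) σ
  have hr₁ := hσ.of_frame hF₁ (by decide) (by decide)
  have hs₂ : ∀ i, ∀ j < n, _ = _ := fun i j hj => exec_copyRow (a := aRC) (s := aC) (σ := σ₁) (i := i)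
    hr₁ (by decide) (by decide) ((hF₁.reg (by decide)).trans hl) hln hj
  set σ₂ := (copyRow aRC aC).exec σ₁ with h₂
  have hF₂ : Frame [rFound, rV] [aRC] σ σ₂ :=
    (hF₁.mono (by decide) (by decide)).trans (frame_of (by decide) (by decide) σ₁)
  have hr₂ := hσ.of_frame hF₂ (by decide) (by decide)
  have hs₃ : ∀ i, ∀ j < n, _ = _ := fun i j hj => exec_copyRow (a := aRX) (s := aX) (σ := σ₂) (i := i)
    hr₂ (by decide) (by decide) ((hF₂.reg (by decide)).trans hl) hln hj
  set σ₃ := (copyRow aRX aX).exec σ₂ with h₃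
  have hF₂₃ : Frame [rV] [aRX] σ₂ σ₃ := frame_of (by decide) (by decide) σ₂
  have hF₃ : Frame [rFound, rV] [aRC, aRX] σ σ₃ :=
    (hF₂.mono (by decide) (by decide)).trans (hF₂₃.mono (by decide) (by decide))
  have hr₃ := hσ.of_frame hF₃ (by decide) (by decide)
  have hs₄ : ∀ i, ∀ j < n, _ = _ := fun i j hj => exec_copyRow (a := aRS) (s := aS) (σ := σ₃) (i := i)
    hr₃ (by decide) (by decide) ((hF₃.reg (by decide)).trans hl) hln hj
  set σ₄ := (copyRow aRS aS).exec σ₃ with h₄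
  have hF₃₄ : Frame [rV] [aRS] σ₃ σ₄ := frame_of (by decide) (by decide) σ₃
  have hF₄ : Frame [rFound, rV] [aRC, aRX, aRS] σ σ₄ :=
    (hF₃.mono (by decide) (by decide)).trans (hF₃₄.mono (by decide) (by decide))
  have hr₄ := hσ.of_frame hF₄ (by decide) (by decide)
  have hs₅ : ∀ v < n, _ ↔ _ := fun v hv => exec_fill_flag (a := aLive) (v := rV) (n := n) (σ := σ₄)
    (e := (Expr.read aLive (reg rV)).and ((Expr.read aS (reg rV)).not.or (.read aX (reg rV))))
    hr₄.size (by decide) (fun v => v ∈ A ∧ (v ∉ X ∨ σ.arr aX v ≠ 0)) (by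
      intro i hi τ hF h1 h2
      simp [holds_read, eval, h1, h2, hF.arr, hF₄.arr, ← hG.set i hi, ← hX i hi]) (i := v) hv
  set σ₅ := Cmd.exec _ σ₄ with h₅
  have hF₄₅ : Frame [rV] [aLive] σ₄ σ₅ := frame_of (by decide) (by decide) σ₄
  have hF₅ : Frame [rFound, rV] [aRC, aRX, aRS, aLive] σ σ₅ :=
    (hF₄.mono (by decide) (by decide)).trans (hF₄₅.mono (by decide) (by decide))
  have hr₅ := hσ.of_frame hF₅ (by decide) (by decide)
  have hs₆ : ∀ u < n, ∀ v < n, _ ↔ _ := fun u hu v hv => exec_fillMat_flag (a := aE) (u := rU)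
    (v := rV) (n := n) (σ := σ₅) (e := ((((Expr.read aLive (reg rU)).and (.read aLive (reg rV))).and
      (mat aE (reg rU) (reg rV))).or
    ((Expr.eq (reg rU) (reg rV)).not.and
      ((Expr.read aX (reg rU)).and (.read aX (reg rV)))))) hr₅
    (by decide) (by decide) (by decide) (by decide)
    (fun u v => (u ∈ A' ∧ v ∈ A' ∧ H.Adj u v) ∨ (u ≠ v ∧ σ.arr aX u ≠ 0 ∧ σ.arr aX v ≠ 0)) (by
      intro i hi j hj τ hF h1 h2 h3
      have e1 := hs₅ i hi
      have e2 := hs₅ j hj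
      rw [← hP.memA i hi] at e1
      rw [← hP.memA j hj] at e2
      simp [mat, holds_read, eval, h1, h2, h3, hF.arr, hF₅.arr (b := aE), hF₅.arr (b := aRow),
        hF₅.arr (b := aX), hσ.row i hi, ← e1, ← e2, ← hG.mat i hi j hj, and_assoc])
      (i := u) (j := v) hu hv
  have hF₅₆ : Frame [rU, rV] [aE] σ₅ (commit.exec σ) := frame_of (by decide) (by decide) σ₅
  have eC : ∀ i, ∀ j < n, (commit.exec σ).arr aRC (i * n + j) =
      if i = l then σ.arr aC j else ρ.arr aRC (i * n + j) := by
    intro i j hj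
    rw [hF₅₆.arr (by decide), hF₄₅.arr (by decide), hF₃₄.arr (by decide), hF₂₃.arr (by decide),
      hs₂ i j hj, hF₁.arr (by decide), hF₁.arr (by decide), hRC]
  have eX : ∀ i, ∀ j < n, (commit.exec σ).arr aRX (i * n + j) =
      if i = l then σ.arr aX j else ρ.arr aRX (i * n + j) := by
    intro i j hj
    rw [hF₅₆.arr (by decide), hF₄₅.arr (by decide), hF₃₄.arr (by decide),
      hs₃ i j hj, hF₂.arr (by decide), hF₂.arr (by decide), hRX]
  have eS : ∀ i, ∀ j < n, (commit.exec σ).arr aRS (i * n + j) =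
      if i = l then σ.arr aS j else ρ.arr aRS (i * n + j) := by
    intro i j hj
    rw [hF₅₆.arr (by decide), hF₄₅.arr (by decide),
      hs₄ i j hj, hF₃.arr (by decide), hF₃.arr (by decide), hRS]
  refine ⟨?_, ⟨H', A', ⟨fun u hu v hv => ?_, fun v hv => ?_, hP.memH, fun v hv => hG.lt v (hP.subA hv)⟩,
    hP.good, hP.card, ?_⟩, fun i hi v hv => ?_⟩
  · rw [hF₅₆.reg (by decide), hF₄₅.reg (by decide), hF₃₄.reg (by decide), hF₂₃.reg (by decide)]
    rw [h₂, exec_reg (by decide)]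
    exact one_ne_zero
  · rw [hP.adjH u hu v hv]
    exact hs₆ u hu v hv
  · rw [hF₅₆.arr (by decide), hs₅ v hv, hP.memA v hv]
  · intro f hf
    obtain ⟨⟨p, q, hpq, h⟩, hext⟩ := hP.ext _ hC f hf
    refine ⟨⟨p, q, hpq, fun v hv => ?_⟩, fun p q hpq h f' h1 h2 => hext p q hpq (fun v hv => ?_) f'
      (fun v hv hS => ?_) fun v hv hS => ?_⟩
    · simpa [eC l v hv, eX l v hv] using h v hv
    · simpa [eC l v hv, eX l v hv] using h v hv
    · rw [h1 v hv (by simpa [eS l v hv] using (hX v hv).2 hS)]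
      simp [eC l v hv]
    · exact h2 v hv (by simpa [eS l v hv] using (not_congr (hX v hv)).2 hS)
  · rw [eC i v hv, eX i v hv, eS i v hv, if_neg hi, if_neg hi, if_neg hi]
    exact ⟨rfl, rfl, rfl⟩

/-- The whole graph may be peeled off. -/
theorem whole_peel {n : ℕ} {H : SimpleGraph ℕ} {A : Finset ℕ} {w : ℕ → ℕ}
    (hT : ∀ {u v}, H.Adj u v → u ∈ A) (hlt : ∀ v ∈ A, v < n) (hw : ∀ v < n, w v = 0) :
    Peel n H A A w (fun _ => False) H A ⊥ ∅ where
  memW v _ := by simp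
  adjM u _ v _ := by
    simp only [and_false, or_false]
    exact ⟨fun h => ⟨hT h, hT h.symm, h⟩, fun h => h.2.2⟩
  memA v hv := by simp [hw v hv]
  adjH u hu v hv := by simp [hw u hu]
  memM := hT
  subW := subset_rfl
  memH h := h.elim
  subA := by simp
  card := Or.inl rfl
  good := Or.inl rfl
  ext c hc f _ := by
    refine ⟨⟨1, 2, by unfold IsPerm; omega, fun v hv h => absurd (hw v hv) h⟩, fun p q hpq _ f' h1 _ => ?_⟩
    refine ⟨fun u v huv => ?_, fun v hv => ?_⟩
    · have hu := hT huv
      have hv := hT huv.symm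
      rw [h1 u (hlt u hu) hu, h1 v (hlt v hv) hv]
      exact hpq.permColour_inj (hc.range u hu) (hc.range v hv) (hc.proper u v huv)
    · rw [h1 v (hlt v hv) hv]
      exact hpq.permColour_mem _

/-- The side `X` of a matching cut may be peeled off: its torso and the remaining graph are those
in which the other side is replaced by a triangle. -/
theorem cut_peel {n : ℕ} {H : SimpleGraph ℕ} {A X : Finset ℕ} {w : ℕ → ℕ} {x y : Fin 3 → ℕ}
    (hT : Tight H A) (hlt : ∀ v ∈ A, v < n) (hC : IsMatchingCut H A X x y)
    (hX : ∃ v ∈ X, ∀ j, v ≠ x j) (hw : ∀ v < n, w v ≠ 0 ↔ ∃ j, v = x j)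
    (hwx : ∀ j, w (x j) = y j + 1) :
    Peel n H A X w (fun v => ∃ j, v = y j) (splitGraph H A (A \ X) y) (splitSet A (A \ X) y)
      (splitGraph H A X x) (splitSet A X x) where
  memW v _ := by
    rw [mem_splitSet, Finset.mem_sdiff]
    tauto
  adjM u _ v _ := splitGraph_adj
  memA v hv := by rw [mem_splitSet, hw v hv]
  adjH u hu v hv := by rw [splitGraph_adj, hw u hu, hw v hv]
  memM := hC.symm.mem_of_adj
  subW v hv := (mem_splitSet.1 hv).1
  memH := hC.mem_of_adj
  subA v hv := (mem_splitSet.1 hv).1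
  card := by
    obtain ⟨v, hv, hvx⟩ := hX
    refine Or.inr (Finset.card_lt_card ⟨fun v hv => (mem_splitSet.1 hv).1, fun h => ?_⟩)
    rcases (mem_splitSet.1 (h (hC.sub hv))).2 with h | ⟨j, h⟩
    exacts [h hv, hvx j h]
  good := Or.inr ⟨hC.tight_split hT, fun h _ => hC.exists_not_adj h⟩
  ext c hc f hf := by
    have hiff : ∀ p q, (∀ v < n, w v ≠ 0 → permColour p q (c v) ≠ f (w v - 1)) ↔
        ∀ j, permColour p q (c (x j)) ≠ f (y j) := by
      intro p q
      constructor
      · intro h j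
        have := h (x j) (hlt _ (hC.sub (hC.x_mem j))) (by rw [hwx j]; omega)
        rwa [hwx j] at this
      · intro h v hv hv0
        obtain ⟨j, rfl⟩ := (hw v hv).1 hv0
        rw [hwx j]
        exact h j
    refine ⟨?_, fun p q hpq h f' h1 h2 => ?_⟩
    · obtain ⟨p, q, hpq, h⟩ := hC.exists_perm hc hf
      exact ⟨p, q, hpq, (hiff p q).2 h⟩
    · have hg := hC.isCol_glue hT.mem hc hf hpq ((hiff p q).1 h)
      have hf' : ∀ v ∈ A, f' v = if v ∈ X then permColour p q (c v) else f v := by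
        intro v hv
        split_ifs with hvX
        exacts [h1 v (hlt v hv) hvX, h2 v (hlt v hv) hvX]
      refine ⟨fun u v huv => ?_, fun v hv => ?_⟩
      · rw [hf' u (hT.mem huv), hf' v (hT.mem huv.symm)]
        exact hg.proper u v huv
      · rw [hf' v hv]
        exact hg.range v hv

/-! ### Searching for a vertex pair and a cut -/

/-- Try all choices of two vertices `h`, `z` of the same colour and of a start vertex `t`. -/
def tryAll : Cmd := .forN rH (.forN rZ (.forN rT (attempt colourGreedy commit)))

/-- The vertices `h`, `z`, `t` allow a greedy colouring. -/
def Greedy (M : SimpleGraph ℕ) (W : Finset ℕ) (h z t : ℕ) : Prop :=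
  W = ∅ ∨ Tight M W ∧ h ≠ z ∧ ¬ M.Adj h z ∧ M.Adj t h ∧ M.Adj t z ∧
    ∀ v ∈ W, v ≠ h → M.degIn W v ≤ 3

/-- The vertices of a tight graph other than `h` and `z` are all reached from `t`, as the graph is
3-connected. -/
theorem Levels.reach {n h z t : ℕ} {M : SimpleGraph ℕ} {W : Finset ℕ} {D : ℕ → ℕ}
    (hD : Levels n (fun u v => M.Adj u v ∧ (u ≠ h ∧ u ≠ z) ∧ v ≠ h ∧ v ≠ z) t D)
    (hM : Tight M W) (hlt : ∀ v ∈ W, v < n) (ht : t ∈ W) (hth : t ≠ h) (htz : t ≠ z) :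
    ∀ v ∈ W, D v ≠ 0 ∨ v = h ∨ v = z := by
  intro v hv
  have := hM.closed_eq (R := fun v => D v ≠ 0 ∧ v ≠ h ∧ v ≠ z) (p := h) (q := z) (t := t) ht
    ⟨by rw [hD.root]; omega, hth, htz⟩ ?_ hv
  · tauto
  · rintro a ha b hb ⟨h1, h2, h3⟩ hab
    by_cases hb' : b = h ∨ b = z
    · exact Or.inr hb'
    · rw [not_or] at hb'
      exact Or.inl ⟨hD.closed a (hlt a ha) h1 b (hlt b hb) ⟨hab, ⟨h2, h3⟩, hb'⟩, hb'⟩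

theorem search_tryAll {n : ℕ} {σ₀ : State} {M : SimpleGraph ℕ} {W : Finset ℕ} {Win : State → Prop}
    (hr : Rows n σ₀) (hf : σ₀.reg rFound = 0) (hmax : σ₀.reg rMax = 3)
    (hG : IsGraph n (σ₀.arr aM) (σ₀.arr aW) M W)
    (hWin : ∀ σ, Frame [rH, rZ, rT, rU, rV, rK, rA, rB, rBad] [aB, aD, aC, aP] σ₀ σ →
      IsCol M W 3 (σ.arr aC) → Win (commit.exec σ))
    (hWf : ∀ σ, Win σ → σ.reg rFound ≠ 0)
    (hWr : ∀ σ x k, x ≠ rFound → Win σ → Win (σ.setReg x k)) :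
    Search tryAll (Frame [rH, rZ, rT, rU, rV, rK, rA, rB, rBad] [aB, aD, aC, aP] σ₀) Win
      (∃ h < n, ∃ z < n, ∃ t < n, Greedy M W h z t) := by
  have hsize : ∀ σ, Frame [rH, rZ, rT, rU, rV, rK, rA, rB, rBad] [aB, aD, aC, aP] σ₀ σ →
    σ.reg 0 = n := fun σ hσ => (hσ.reg (by decide)).trans hr.size
  have k1 : Keeps (attempt colourGreedy commit) Win := keeps_guard hWf
  have k2 : Keeps (.forN rT (attempt colourGreedy commit)) Win :=
    k1.forN (by decide) fun σ k => hWr σ _ k (by decide)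
  have k3 : Keeps (.forN rZ (.forN rT (attempt colourGreedy commit))) Win :=
    k2.forN (by decide) fun σ k => hWr σ _ k (by decide)
  refine Search.forN (x := rH) (by decide) hsize (fun σ k h => h.setReg (by decide) k)
    (fun σ k => hWr σ _ k (by decide)) k3 fun h hh => ?_
  refine Search.forN (x := rZ) (by decide) (fun σ h => hsize σ h.1)
    (fun σ k h => ⟨h.1.setReg (by decide) k, h.2⟩)
    (fun σ k => hWr σ _ k (by decide)) k2 fun z hz => ?_
  refine Search.forN (x := rT) (by decide) (fun σ h => hsize σ h.1.1)
    (fun σ k h => ⟨⟨h.1.1.setReg (by decide) k, h.1.2⟩, h.2⟩)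
    (fun σ k => hWr σ _ k (by decide)) k1 fun t ht => ?_
  have hBase : ∀ σ, Frame [rH, rZ, rT, rU, rV, rK, rA, rB, rBad] [aB, aD, aC, aP] σ₀ σ →
      Rows n σ ∧ σ.reg rFound = 0 ∧ σ.reg rMax = 3 ∧ IsGraph n (σ.arr aM) (σ.arr aW) M W := by
    intro σ hσ
    refine ⟨hr.of_frame hσ (by decide) (by decide), (hσ.reg (by decide)).trans hf,
      (hσ.reg (by decide)).trans hmax, ?_⟩
    rwa [hσ.arr (by decide), hσ.arr (by decide)]
  refine search_attempt (cb := 3) (M := M) (W := W) (n := n) (by decide) (by decide) ?_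
    (fun σ h => hBase σ h.1.1.1) (fun σ h => hWin σ h.1.1.1) ?_
  · rintro σ τ ⟨⟨⟨h1, h2⟩, h3⟩, h4⟩ hF
    exact ⟨⟨⟨h1.trans (hF.mono (by decide) (by decide)), (hF.reg (by decide)).trans h2⟩,
      (hF.reg (by decide)).trans h3⟩, (hF.reg (by decide)).trans h4⟩
  · rintro hg σ ⟨⟨⟨h1, h2⟩, h3⟩, h4⟩ hL
    obtain ⟨hrσ, -, -, hGσ⟩ := hBase σ h1
    rcases hg with rfl | ⟨hM, h5, h6, h7, h8, h9⟩
    · exact ⟨fun u v huv => absurd (hG.mem huv) (by simp), fun v hv => absurd hv (by simp)⟩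
    · rw [h2, h3, h4] at hL
      exact exec_colourGreedy hrσ hGσ.mat h2 h3 hG.mem hG.lt h5 h6 h7 h8 h9 hL
        (hL.reach hM hG.lt (hG.mem h7) h7.ne h8.ne)

/-- The vertices in `rX₀`, `rX₁`, `rX₂`. -/
def xs (σ : State) : Fin 3 → ℕ := ![σ.reg rX₀, σ.reg rX₁, σ.reg rX₂]

/-- The vertices in `rY₀`, `rY₁`, `rY₂`. -/
def ys (σ : State) : Fin 3 → ℕ := ![σ.reg rY₀, σ.reg rY₁, σ.reg rY₂]

/-- The test for the edge of the registers `x` and `y`, in either direction. -/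
def isEdge (x y : ℕ) : Expr :=
  ((Expr.eq (reg rU) (reg x)).and (.eq (reg rV) (reg y))).or
    ((Expr.eq (reg rU) (reg y)).and (.eq (reg rV) (reg x)))

/-- Determine the part of the graph in `aE` that is reachable from `rX₀` without the edges from `rX`
to `rY`, and set `rA` if it contains a further vertex. -/
def side : Cmd :=
  .seq (fillMat aB rU rV ((mat aE (reg rU) (reg rV)).and
    ((isEdge rX₀ rY₀).or ((isEdge rX₁ rY₁).or (isEdge rX₂ rY₂))).not).flag) <|
  .seq (.set rT (reg rX₀)) <| .seq bfs <|
  .seq (fill aS rV ((Expr.read aLive (reg rV)).and (.read aD (reg rV))).flag) <|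
  .seq (fill aX rV (const 0)) <|
  .seq (.write aX (reg rX₀) (.add (reg rY₀) (const 1))) <|
  .seq (.write aX (reg rX₁) (.add (reg rY₁) (const 1))) <|
  .seq (.write aX (reg rX₂) (.add (reg rY₂) (const 1))) <|
  .seq (fill aY rV ((Expr.eq (reg rV) (reg rY₀)).or ((Expr.eq (reg rV) (reg rY₁)).or
    (.eq (reg rV) (reg rY₂)))).flag) <|
  .seq (.set rA (const 0)) <|
  scan rV rA ((Expr.read aS (reg rV)).and (Expr.read aX (reg rV)).not)

/-- After `side`, the arrays `aS`, `aX` and `aY` hold a part of the graph, the assignment of `y j +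
1` to `x j`, and the set of the vertices `y j`. -/
theorem exec_side {n : ℕ} {σ : State} {H : SimpleGraph ℕ} {A : Finset ℕ} {x y : Fin 3 → ℕ}
    (hσ : Rows n σ) (hG : IsGraph n (σ.arr aE) (σ.arr aLive) H A) (hx : xs σ = x) (hy : ys σ = y) :
    ∃ D, Levels n (fun u v => H.Adj u v ∧ ∀ j, ¬ (u = x j ∧ v = y j) ∧ ¬ (u = y j ∧ v = x j))
        (x 0) D ∧
      IsSet n ((side.exec σ).arr aS) (A.filter fun v => D v ≠ 0) ∧
      (∀ v < n, (side.exec σ).arr aX v ≠ 0 ↔ ∃ j, v = x j) ∧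
      (Function.Injective x → ∀ j, (side.exec σ).arr aX (x j) = y j + 1) ∧
      (∀ v < n, (side.exec σ).arr aY v ≠ 0 ↔ ∃ j, v = y j) ∧
      ((side.exec σ).reg rA ≠ 0 ↔ ∃ v < n, (side.exec σ).arr aS v ≠ 0 ∧
        (side.exec σ).arr aX v = 0) := by
  have x0 : x 0 = σ.reg rX₀ := by rw [← hx]; rfl
  have x1 : x 1 = σ.reg rX₁ := by rw [← hx]; rfl
  have x2 : x 2 = σ.reg rX₂ := by rw [← hx]; rfl
  have y0 : y 0 = σ.reg rY₀ := by rw [← hy]; rfl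
  have y1 : y 1 = σ.reg rY₁ := by rw [← hy]; rfl
  have y2 : y 2 = σ.reg rY₂ := by rw [← hy]; rfl
  have hs₁ : ∀ u < n, ∀ v < n, _ ↔ _ := fun u hu v hv => exec_fillMat_flag (a := aB) (u := rU)
    (v := rV) (n := n) (σ := σ) (e := (mat aE (reg rU) (reg rV)).and
    ((isEdge rX₀ rY₀).or ((isEdge rX₁ rY₁).or (isEdge rX₂ rY₂))).not) hσ
    (by decide) (by decide) (by decide) (by decide)
    (fun u v => H.Adj u v ∧ ∀ j, ¬ (u = x j ∧ v = y j) ∧ ¬ (u = y j ∧ v = x j)) (by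
      intro i hi j hj τ hF h1 h2 h3
      simp [Fin.forall_fin_succ, x0, x1, x2, y0, y1, y2, mat, isEdge, holds_read, eval, h1, h2,
        hF.arr, hF.reg, hσ.row i hi, ← hG.mat i hi j hj]) (i := u) (j := v) hu hv
  set σ₁ := (fillMat aB rU rV ((mat aE (reg rU) (reg rV)).and
    ((isEdge rX₀ rY₀).or ((isEdge rX₁ rY₁).or (isEdge rX₂ rY₂))).not).flag).exec σ with h₁
  have hF₁ : Frame [rU, rV, rK, rT, rA] [aB, aD, aS, aX, aY] σ σ₁ := frame_of (by decide) (by decide) σ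
  set σ₂ := (Cmd.set rT (reg rX₀)).exec σ₁ with h₂
  have hF₁₂ : Frame [rT] [] σ₁ σ₂ := frame_of (by decide) (by decide) σ₁
  have hF₂ := hF₁.trans (hF₁₂.mono (by decide) (by decide))
  have hr₂ := hσ.of_frame hF₂ (by decide) (by decide)
  have ht : σ₂.reg rT = x 0 := by
    rw [x0]
    exact hF₁.reg (by decide)
  have hL := exec_bfs hr₂
  rw [ht, hF₁₂.arr (by decide)] at hL
  set σ₃ := bfs.exec σ₂ with h₃
  have hF₃ : Frame [rU, rV, rK, rT, rA] [aB, aD, aS, aX, aY] σ σ₃ :=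
    hF₂.trans (frame_of (P := bfs) (by decide) (by decide) σ₂)
  have hr₃ := hσ.of_frame hF₃ (by decide) (by decide)
  have hs₄ : ∀ v < n, _ ↔ _ := fun v hv => exec_fill_flag (a := aS) (v := rV) (n := n) (σ := σ₃)
    (e := (Expr.read aLive (reg rV)).and (.read aD (reg rV)))
    hr₃.size (by decide) (fun v => v ∈ A ∧ σ₃.arr aD v ≠ 0) (by
      intro i hi τ hF h1 _
      simp [holds_read, eval, h1, hF.arr, hF₃.arr (b := aLive), ← hG.set i hi]) (i := v) hv
  set σ₄ := (fill aS rV ((Expr.read aLive (reg rV)).and (.read aD (reg rV))).flag).exec σ₃ with h₄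
  have hF₄ : Frame [rU, rV, rK, rT, rA] [aB, aD, aS, aX, aY] σ σ₄ :=
    hF₃.trans (frame_of (P := fill aS rV ((Expr.read aLive (reg rV)).and
    (.read aD (reg rV))).flag) (by decide) (by decide) σ₃)
  have hr₄ := hσ.of_frame hF₄ (by decide) (by decide)
  have hs₅ := exec_fill (a := aX) (v := rV) (e := const 0) (σ := σ₄) (by decide) (fun _ => 0)
    (fun _ _ _ _ _ _ => rfl)
  rw [hr₄.size] at hs₅
  set σ₅ := (fill aX rV (const 0)).exec σ₄ with h₅
  have hF₄₅ : Frame [rV] [aX] σ₄ σ₅ := frame_of (by decide) (by decide) σ₄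
  have hF₅ := hF₄.trans (hF₄₅.mono (by decide) (by decide))
  set σ₆ := (Cmd.write aX (reg rX₀) (.add (reg rY₀) (const 1))).exec σ₅ with h₆
  set σ₇ := (Cmd.write aX (reg rX₁) (.add (reg rY₁) (const 1))).exec σ₆ with h₇
  set σ₈ := (Cmd.write aX (reg rX₂) (.add (reg rY₂) (const 1))).exec σ₇ with h₈
  have hF₅₈ : Frame [rU, rV, rK, rT, rA] [aX] σ₅ σ₈ :=
    ((frame_of (by decide) (by decide) σ₅).trans (frame_of (by decide) (by decide) σ₆)).trans
      (frame_of (by decide) (by decide) σ₇)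
  have hX₈ : σ₈.arr aX = Function.update (Function.update (Function.update (σ₅.arr aX) (x 0) (y 0 + 1))
      (x 1) (y 1 + 1)) (x 2) (y 2 + 1) := by
    rw [x0, x1, x2, y0, y1, y2]
    show (((σ₅.setArr aX (σ₅.reg rX₀) (σ₅.reg rY₀ + 1)).setArr aX (σ₅.reg rX₁)
      (σ₅.reg rY₁ + 1)).setArr aX (σ₅.reg rX₂) (σ₅.reg rY₂ + 1)).arr aX = _
    rw [setArr_arr_self, setArr_arr_self, setArr_arr_self]
    simp only [hF₅.reg (y := rX₀) (by decide), hF₅.reg (y := rX₁) (by decide),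
      hF₅.reg (y := rX₂) (by decide), hF₅.reg (y := rY₀) (by decide), hF₅.reg (y := rY₁) (by decide),
      hF₅.reg (y := rY₂) (by decide)]
  have hF₈ := hF₅.trans (hF₅₈.mono (by decide) (by decide))
  have hr₈ := hσ.of_frame hF₈ (by decide) (by decide)
  have hs₉ : ∀ v < n, _ ↔ _ := fun v hv => exec_fill_flag (a := aY) (v := rV) (n := n) (σ := σ₈)
    (e := (Expr.eq (reg rV) (reg rY₀)).or ((Expr.eq (reg rV) (reg rY₁)).or
      (.eq (reg rV) (reg rY₂))))
    hr₈.size (by decide) (fun v => ∃ j, v = y j) (by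
      intro i hi τ hF h1 _
      simp [Fin.exists_fin_succ, y0, y1, y2, eval, h1, hF.reg, hF₈.reg]) (i := v) hv
  set σ₉ := (fill aY rV ((Expr.eq (reg rV) (reg rY₀)).or ((Expr.eq (reg rV) (reg rY₁)).or
    (.eq (reg rV) (reg rY₂)))).flag).exec σ₈ with h₉
  have hF₈₉ : Frame [rV] [aY] σ₈ σ₉ := frame_of (by decide) (by decide) σ₈
  set σ₁₀ := (Cmd.set rA (const 0)).exec σ₉ with h₁₀
  have hF₉₁₀ : Frame [rA] [] σ₉ σ₁₀ := frame_of (by decide) (by decide) σ₉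
  have hF₁₀ := (hF₈.trans (hF₈₉.mono (by decide) (by decide))).trans
    (hF₉₁₀.mono (by decide) (by decide))
  have hr₁₀ := hσ.of_frame hF₁₀ (by decide) (by decide)
  have hs₁₁ := exec_scan (v := rV) (r := rA) (σ := σ₁₀)
    (e := (Expr.read aS (reg rV)).and (Expr.read aX (reg rV)).not)
    (by decide) (by decide) (by decide)
    (fun v => σ₁₀.arr aS v ≠ 0 ∧ σ₁₀.arr aX v = 0) (by
      intro i hi τ hF h1
      simp [holds_read, eval, h1, hF.arr])
  have hF₁₁ : Frame [rV, rA] [] σ₁₀ (side.exec σ) := frame_of (by decide) (by decide) σ₁₀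
  change (side.exec σ).reg rA ≠ 0 ↔ _ at hs₁₁
  have eX : (side.exec σ).arr aX = σ₈.arr aX := by
    rw [hF₁₁.arr (by decide), hF₉₁₀.arr (by decide), hF₈₉.arr (by decide)]
  have eS : (side.exec σ).arr aS = σ₄.arr aS := by
    rw [hF₁₁.arr (by decide), hF₉₁₀.arr (by decide), hF₈₉.arr (by decide), hF₅₈.arr (by decide),
      hF₄₅.arr (by decide)]
  have eY : (side.exec σ).arr aY = σ₉.arr aY := by
    rw [hF₁₁.arr (by decide), hF₉₁₀.arr (by decide)]
  refine ⟨σ₃.arr aD, ⟨hL.root, fun v hv h1 h2 => ?_, fun u hu h1 v hv h2 => hL.closed u hu h1 v hv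
      ((hs₁ u hu v hv).2 h2), hL.le⟩, fun v hv => ?_, fun v hv => ?_, fun hinj j => ?_, ?_, ?_⟩
  · obtain ⟨u, hu, h3, h4, h5⟩ := hL.pred v hv h1 h2
    exact ⟨u, hu, h3, h4, (hs₁ u hu v hv).1 h5⟩
  · rw [eS, hs₄ v hv, Finset.mem_filter]
  · rw [eX, hX₈]
    simp only [Fin.exists_fin_succ, Function.update_apply, hs₅ v]
    simp [hv]
    split_ifs with h1 h2 h3 <;> simp_all
  · rw [eX, hX₈]
    have h01 : x 0 ≠ x 1 := fun h => absurd (hinj h) (by decide)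
    have h02 : x 0 ≠ x 2 := fun h => absurd (hinj h) (by decide)
    have h12 : x 1 ≠ x 2 := fun h => absurd (hinj h) (by decide)
    fin_cases j <;> simp [h01, h02, h12]
  · intro v hv
    rw [eY, hs₉ v hv]
  · rw [hs₁₁, hr₁₀.size, hF₁₁.arr (by decide), hF₁₁.arr (by decide)]
    simp [show σ₁₀.reg rA = 0 from rfl]

/-- The test that the registers `x` and `y` hold an edge from `aS` to its complement. -/
def leaves (x y : ℕ) : Expr :=
  (mat aE (reg x) (reg y)).and ((Expr.read aS (reg x)).and (Expr.read aS (reg y)).not)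

/-- The test that the contents of three registers are not all different. -/
def notDistinct (x y z : ℕ) : Expr :=
  (Expr.eq (reg x) (reg y)).or ((Expr.eq (reg x) (reg z)).or (.eq (reg y) (reg z)))

/-- The test that the three chosen edges are disjoint and leave the set in `aS`. -/
def valid : Expr :=
  ((leaves rX₀ rY₀).and ((leaves rX₁ rY₁).and (leaves rX₂ rY₂))).and
    ((notDistinct rX₀ rX₁ rX₂).or (notDistinct rY₀ rY₁ rY₂)).not

theorem injective_iff {a b c : ℕ} : Function.Injective ![a, b, c] ↔ a ≠ b ∧ a ≠ c ∧ b ≠ c := by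
  constructor
  · intro h
    exact ⟨fun h' => absurd (@h 0 1 h') (by decide), fun h' => absurd (@h 0 2 h') (by decide),
      fun h' => absurd (@h 1 2 h') (by decide)⟩
  · rintro ⟨h1, h2, h3⟩ i j hij
    fin_cases i <;> fin_cases j <;> simp_all

theorem holds_valid {n : ℕ} {σ : State} {H : SimpleGraph ℕ} {X : Finset ℕ} {x y : Fin 3 → ℕ}
    (hσ : Rows n σ) (hE : IsMat n (σ.arr aE) H) (hX : IsSet n (σ.arr aS) X) (hx : xs σ = x)
    (hy : ys σ = y) (hxn : ∀ j, x j < n) (hyn : ∀ j, y j < n) :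
    valid.Holds σ ↔ (∀ j, H.Adj (x j) (y j) ∧ x j ∈ X ∧ y j ∉ X) ∧ Function.Injective x ∧
      Function.Injective y := by
  have key : ∀ r s, σ.reg r < n → σ.reg s < n → ((leaves r s).Holds σ ↔
      H.Adj (σ.reg r) (σ.reg s) ∧ σ.reg r ∈ X ∧ σ.reg s ∉ X) := by
    intro r s hr hs
    simp [leaves, mat, holds_read, eval, hσ.row _ hr, ← hE _ hr _ hs, ← hX _ hr, ← hX _ hs]
  subst hx hy
  rw [valid, holds_and, holds_and, holds_and, holds_not, holds_or, key _ _ (hxn 0) (hyn 0),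
    key _ _ (hxn 1) (hyn 1), key _ _ (hxn 2) (hyn 2), xs, ys, injective_iff, injective_iff]
  simp only [notDistinct, holds_or, holds_eq, eval, not_or, Fin.forall_fin_succ]
  simp

/-- A set that is closed under the edges other than `x j y j` is the side of a matching cut. -/
theorem isMatchingCut_of_levels {n : ℕ} {H : SimpleGraph ℕ} {A : Finset ℕ} {x y : Fin 3 → ℕ}
    {D : ℕ → ℕ} (hT : ∀ {u v}, H.Adj u v → u ∈ A) (hlt : ∀ v ∈ A, v < n)
    (hD : Levels n (fun u v => H.Adj u v ∧ ∀ j, ¬ (u = x j ∧ v = y j) ∧ ¬ (u = y j ∧ v = x j))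
      (x 0) D)
    (h : ∀ j, H.Adj (x j) (y j) ∧ x j ∈ A.filter (D · ≠ 0) ∧ y j ∉ A.filter (D · ≠ 0))
    (hx : Function.Injective x) (hy : Function.Injective y) :
    IsMatchingCut H A (A.filter (D · ≠ 0)) x y where
  sub := Finset.filter_subset _ _
  x_mem j := (h j).2.1
  y_mem j := hT (h j).1.symm
  y_notMem j := (h j).2.2
  x_inj := hx
  y_inj := hy
  adj j := (h j).1
  cut u hu v hv hvX huv := by
    by_contra! hno
    rw [Finset.mem_filter] at hu
    refine hvX (Finset.mem_filter.2 ⟨hv, hD.closed u (hlt u hu.1) hu.2 v (hlt v hv) ⟨huv, fun j => ?_⟩⟩)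
    refine ⟨fun h' => hno j h'.1 h'.2, ?_⟩
    rintro ⟨rfl, rfl⟩
    exact (h j).2.2 (Finset.mem_filter.2 hu)

/-- The side of a matching cut is connected, hence it is what the search finds from `x 0`. -/
theorem IsMatchingCut.filter_levels {n : ℕ} {H : SimpleGraph ℕ} {A X : Finset ℕ} {x y : Fin 3 → ℕ}
    {D : ℕ → ℕ} (hT : Tight H A) (hlt : ∀ v ∈ A, v < n)
    (hD : Levels n (fun u v => H.Adj u v ∧ ∀ j, ¬ (u = x j ∧ v = y j) ∧ ¬ (u = y j ∧ v = x j))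
      (x 0) D) (hC : IsMatchingCut H A X x y) : A.filter (D · ≠ 0) = X := by
  ext v
  rw [Finset.mem_filter]
  constructor
  · rintro ⟨hv, h0⟩
    have key : ∀ m, ∀ v < n, D v = m → D v ≠ 0 → v ∈ X := by
      intro m
      induction m with
      | zero => intro v _ h1 h2; exact absurd h1 h2
      | succ m ih =>
        intro v hv hm h0
        by_cases hvt : v = x 0
        · exact hvt ▸ hC.x_mem 0
        · obtain ⟨u, hu, h1, h2, h3, h4⟩ := hD.pred v hv h0 hvt
          by_contra hvX
          obtain ⟨j, hj⟩ := hC.cut u (ih u hu (by omega) h2) v (hT.mem h3.symm) hvX h3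
          exact (h4 j).1 hj
    exact key _ v (hlt v hv) rfl h0
  · intro hv
    refine ⟨hC.sub hv, hC.closed_eq hT (R := (D · ≠ 0)) (i := 0) (by simp [hD.root]) ?_ hv⟩
    intro u hu w hw h1 huw
    refine hD.closed u (hlt u (hC.sub hu)) h1 w (hlt w (hC.sub hw)) ⟨huw, fun j => ⟨?_, ?_⟩⟩
    · rintro ⟨-, rfl⟩; exact hC.y_notMem j hw
    · rintro ⟨rfl, -⟩; exact hC.y_notMem j hu

/-- A tight graph in which only `h` may have degree more than three, and is not dominating, can be
coloured greedily: take for `z` a vertex at distance two from `h`. -/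
theorem exists_greedy {n : ℕ} {M : SimpleGraph ℕ} {W : Finset ℕ} {h : ℕ} (hM : Tight M W)
    (hlt : ∀ v ∈ W, v < n) (hh : h ∈ W) (hno : ∃ v ∈ W, v ≠ h ∧ ¬ M.Adj h v)
    (hdeg : ∀ v ∈ W, v ≠ h → M.degIn W v ≤ 3) :
    ∃ h < n, ∃ z < n, ∃ t < n, Greedy M W h z t := by
  obtain ⟨z, t, hz, ht, h1, h2, h3, h4⟩ := hM.exists_dist_two hh hno
  exact ⟨h, hlt h hh, z, hlt z hz, t, hlt t ht, Or.inr ⟨hM, h1.symm, h2, h3.symm, h4, hdeg⟩⟩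

/-- The part of a matching cut has at most one vertex of degree more than `3`. -/
def Leaf (H : SimpleGraph ℕ) (A : Finset ℕ) (x y : Fin 3 → ℕ) : Prop :=
  ∃ X, IsMatchingCut H A X x y ∧ (∃ h ∈ X, ∀ v ∈ X, v ≠ h → H.degIn A v ≤ 3) ∧
    ∃ v ∈ X, ∀ j, v ≠ x j

/-- Try to peel off the part that is separated by the three chosen edges. -/
def cutAttempt : Cmd :=
  .ite (reg rFound).not (.seq side (.ite (valid.and (reg rA)) (.seq buildM tryAll) .skip)) .skip

theorem Peeled.setReg {n l : ℕ} {H : SimpleGraph ℕ} {A : Finset ℕ} {ρ σ : State} {x k : ℕ}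
    (hx : x ≠ rFound) (h : Peeled n l H A ρ σ) : Peeled n l H A ρ (σ.setReg x k) :=
  ⟨by simpa [State.setReg, hx.symm] using h.found, h.graph, h.keep⟩

/-- Colouring the torso of a part, once the part has been determined. -/
theorem search_torso {n l : ℕ} {ρ σ : State} {H M H' : SimpleGraph ℕ} {A X W A' : Finset ℕ}
    {Y : ℕ → Prop} (hr : Rows n σ) (hf : σ.reg rFound = 0) (hmax : σ.reg rMax = 3)
    (hl : σ.reg rLev = l) (hln : l < n) (hG : IsGraph n (σ.arr aE) (σ.arr aLive) H A)
    (hX : IsSet n (σ.arr aS) X) (hY : ∀ v < n, σ.arr aY v ≠ 0 ↔ Y v)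
    (hP : Peel n H A X (σ.arr aX) Y M W H' A') (hRC : σ.arr aRC = ρ.arr aRC)
    (hRX : σ.arr aRX = ρ.arr aRX) (hRS : σ.arr aRS = ρ.arr aRS) :
    Peeled n l H A ρ ((Cmd.seq buildM tryAll).exec σ) ∨
      Frame [rH, rZ, rT, rU, rV, rK, rA, rB, rBad] [aB, aD, aC, aP, aM, aW] σ
        ((Cmd.seq buildM tryAll).exec σ) ∧ ¬ ∃ h < n, ∃ z < n, ∃ t < n, Greedy M W h z t := by
  have hM := exec_buildM hr hG hX hY hP
  set σ₁ := buildM.exec σ with h₁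
  have hF₁ : Frame [rH, rZ, rT, rU, rV, rK, rA, rB, rBad] [aB, aD, aC, aP, aM, aW] σ σ₁ :=
    frame_of (by decide) (by decide) σ
  have hs := search_tryAll (n := n) (σ₀ := σ₁) (M := M) (W := W) (Win := Peeled n l H A ρ)
    (hr.of_frame hF₁ (by decide) (by decide)) ((hF₁.reg (by decide)).trans hf)
    ((hF₁.reg (by decide)).trans hmax) hM ?_ (fun _ h => h.found) (fun _ _ _ hx h => h.setReg hx)
    σ₁ (Frame.refl _ _ _)
  · rcases hs with hs | ⟨hF, hno⟩
    · exact Or.inl hs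
    · exact Or.inr ⟨hF₁.trans (hF.mono (by decide) (by decide)), hno⟩
  · intro τ hF hC
    have hF' := hF₁.trans (hF.mono (by decide) (by decide))
    refine exec_commit (X := X) (M := M) (W := W) (H' := H') (A' := A') (Y := Y)
      (hr.of_frame hF' (by decide) (by decide)) ((hF'.reg (by decide)).trans hl) hln ?_ ?_ ?_ hC
      ((hF'.arr (by decide)).trans hRC) ((hF'.arr (by decide)).trans hRX)
      ((hF'.arr (by decide)).trans hRS)
    · rwa [hF'.arr (by decide), hF'.arr (by decide)]
    · rwa [hF'.arr (by decide)]
    · rwa [hF'.arr (by decide)]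

/-- If the chosen edges form a matching cut with a side as in `Leaf`, then the torso of this side
can be coloured greedily, and the side is peeled off. Whatever else is peeled off is a side of a
matching cut, too. -/
theorem search_cutAttempt {n l : ℕ} {σ₁ : State} {H : SimpleGraph ℕ} {A : Finset ℕ}
    {x y : Fin 3 → ℕ} {Base : State → Prop} (hr : Rows n σ₁) (hf : σ₁.reg rFound = 0)
    (hmax : σ₁.reg rMax = 3) (hl : σ₁.reg rLev = l) (hln : l < n)
    (hG : IsGraph n (σ₁.arr aE) (σ₁.arr aLive) H A) (hT : Tight H A) (hxn : ∀ j, x j < n)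
    (hyn : ∀ j, y j < n)
    (hBase : ∀ σ, Base σ → Frame [rH, rZ, rT, rU, rV, rK, rA, rB, rBad, rX₀, rX₁, rX₂, rY₀, rY₁, rY₂]
      [aB, aD, aC, aP, aM, aW, aS, aX, aY] σ₁ σ ∧ xs σ = x ∧ ys σ = y)
    (hstable : ∀ σ τ, Base σ → Frame [rH, rZ, rT, rU, rV, rK, rA, rB, rBad]
      [aB, aD, aC, aP, aM, aW, aS, aX, aY] σ τ → Base τ) :
    Search cutAttempt Base (Peeled n l H A σ₁) (Leaf H A x y) := by
  classical
  intro σ hσ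
  obtain ⟨hF, hx, hy⟩ := hBase σ hσ
  have he : (reg rFound).not.eval σ ≠ 0 := by
    simp [Expr.not, eval, hF.reg (y := rFound) (by decide), hf]
  have hside := exec_side (n := n) (σ := σ) (H := H) (A := A) (x := x) (y := y)
    (hr.of_frame hF (by decide) (by decide)) (by rwa [hF.arr (by decide), hF.arr (by decide)]) hx hy
  set σ₂ := side.exec σ with h₂
  have hσ₂ : Base σ₂ := hstable _ _ hσ (frame_of (by decide) (by decide) σ)
  obtain ⟨hF₂, hx₂, hy₂⟩ := hBase σ₂ hσ₂
  have hr₂ := hr.of_frame hF₂ (by decide) (by decide)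
  have hG₂ : IsGraph n (σ₂.arr aE) (σ₂.arr aLive) H A := by
    rwa [hF₂.arr (by decide), hF₂.arr (by decide)]
  obtain ⟨D, hD, hS, hX, hXx, hY, hA⟩ := hside
  have hval := holds_valid hr₂ hG₂.mat hS hx₂ hy₂ hxn hyn
  have hA' : σ₂.reg rA ≠ 0 ↔ ∃ v ∈ A.filter (D · ≠ 0), ∀ j, v ≠ x j := by
    rw [hA]
    constructor
    · rintro ⟨v, hv, h1, h2⟩
      exact ⟨v, (hS v hv).1 h1, fun j hj => (hX v hv).2 ⟨j, hj⟩ h2⟩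
    · rintro ⟨v, hv, h⟩
      have hvn := hG.lt v (Finset.mem_filter.1 hv).1
      refine ⟨v, hvn, (hS v hvn).2 hv, ?_⟩
      by_contra h0
      obtain ⟨j, hj⟩ := (hX v hvn).1 h0
      exact h j hj
  have hex : cutAttempt.exec σ =
      (Cmd.ite (valid.and (reg rA)) (.seq buildM tryAll) .skip).exec σ₂ := by
    rw [cutAttempt, exec, if_pos he]
    rfl
  rw [hex, exec_ite, holds_and, hval]
  by_cases hok : ((∀ j, H.Adj (x j) (y j) ∧ x j ∈ A.filter (D · ≠ 0) ∧ y j ∉ A.filter (D · ≠ 0)) ∧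
      Function.Injective x ∧ Function.Injective y) ∧ (reg rA).Holds σ₂
  · rw [if_pos hok]
    obtain ⟨⟨h1, h2, h3⟩, h4⟩ := hok
    have hC := isMatchingCut_of_levels hT.mem hG.lt hD h1 h2 h3
    have hP := cut_peel hT hG.lt hC (hA'.1 h4) hX (hXx h2)
    rcases search_torso (l := l) (ρ := σ₁) hr₂ ((hF₂.reg (by decide)).trans hf)
      ((hF₂.reg (by decide)).trans hmax) ((hF₂.reg (by decide)).trans hl) hln hG₂ hS hY hP
      (hF₂.arr (by decide)) (hF₂.arr (by decide)) (hF₂.arr (by decide)) with hs | ⟨hF', hno⟩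
    · exact Or.inl hs
    · refine Or.inr ⟨hstable _ _ hσ₂ (hF'.mono (by decide) (by decide)), ?_⟩
      rintro ⟨X, hX', ⟨h, hh, hdeg⟩, -⟩
      have hXeq := IsMatchingCut.filter_levels hT hG.lt hD hX'
      rw [hXeq] at hno hC
      refine hno (exists_greedy (h := h) (hC.symm.tight_split hT)
        (fun v hv => hG.lt v (mem_splitSet.1 hv).1)
        (mem_splitSet.2 ⟨hC.sub hh, Or.inl (by simp [hh])⟩) (hC.symm.exists_not_adj h) ?_)
      intro v hv hvh
      obtain ⟨hvA, hv'⟩ := mem_splitSet.1 hv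
      by_cases hvX : v ∈ X
      · rw [hC.symm.degIn_eq hvA (by simp [hvX])]
        exact hdeg v hvX hvh
      · obtain ⟨j, rfl⟩ := hv'.resolve_left (by simp [hvX, hvA])
        exact hC.symm.degIn_x_le j
  · rw [if_neg hok]
    refine Or.inr ⟨hσ₂, ?_⟩
    rintro ⟨X, hX', -, hv⟩
    have hXeq := IsMatchingCut.filter_levels hT hG.lt hD hX'
    rw [← hXeq] at hX' hv
    exact hok ⟨⟨fun j => ⟨hX'.adj j, hX'.x_mem j, hX'.y_notMem j⟩, hX'.x_inj, hX'.y_inj⟩, hA'.2 hv⟩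

/-- Try all triples of edges. -/
def cuts : Cmd :=
  .forN rX₀ (.forN rX₁ (.forN rX₂ (.forN rY₀ (.forN rY₁ (.forN rY₂ cutAttempt)))))

theorem search_cuts {n l : ℕ} {σ₁ : State} {H : SimpleGraph ℕ} {A : Finset ℕ} (hr : Rows n σ₁)
    (hf : σ₁.reg rFound = 0)
    (hmax : σ₁.reg rMax = 3) (hl : σ₁.reg rLev = l) (hln : l < n)
    (hG : IsGraph n (σ₁.arr aE) (σ₁.arr aLive) H A) (hT : Tight H A) :
    Search cuts
      (Frame [rH, rZ, rT, rU, rV, rK, rA, rB, rBad, rX₀, rX₁, rX₂, rY₀, rY₁, rY₂]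
        [aB, aD, aC, aP, aM, aW, aS, aX, aY] σ₁) (Peeled n l H A σ₁)
      (∃ a < n, ∃ b < n, ∃ c < n, ∃ d < n, ∃ e < n, ∃ f < n, Leaf H A ![a, b, c] ![d, e, f]) := by
  have hsize : ∀ σ, Frame [rH, rZ, rT, rU, rV, rK, rA, rB, rBad, rX₀, rX₁, rX₂, rY₀, rY₁, rY₂]
      [aB, aD, aC, aP, aM, aW, aS, aX, aY] σ₁ σ → σ.reg 0 = n :=
    fun σ hσ => (hσ.reg (by decide)).trans hr.size
  have hW : ∀ x, x ≠ rFound → ∀ σ k, Peeled n l H A σ₁ σ → Peeled n l H A σ₁ (σ.setReg x k) :=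
    fun x hx σ k h => h.setReg hx
  have k0 : Keeps cutAttempt (Peeled n l H A σ₁) := keeps_guard fun _ h => h.found
  have k1 := k0.forN (x := rY₂) (by decide) (hW _ (by decide))
  have k2 := k1.forN (x := rY₁) (by decide) (hW _ (by decide))
  have k3 := k2.forN (x := rY₀) (by decide) (hW _ (by decide))
  have k4 := k3.forN (x := rX₂) (by decide) (hW _ (by decide))
  have k5 := k4.forN (x := rX₁) (by decide) (hW _ (by decide))
  refine Search.forN (by decide) hsize (fun σ k h => h.setReg (by decide) k)
    (hW _ (by decide)) k5 fun a ha => ?_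
  refine Search.forN (by decide) (fun σ h => hsize σ h.1)
    (fun σ k h => ⟨h.1.setReg (by decide) k, h.2⟩) (hW _ (by decide)) k4 fun b hb => ?_
  refine Search.forN (by decide) (fun σ h => hsize σ h.1.1)
    (fun σ k h => ⟨⟨h.1.1.setReg (by decide) k, h.1.2⟩, h.2⟩) (hW _ (by decide)) k3 fun c hc => ?_
  refine Search.forN (by decide) (fun σ h => hsize σ h.1.1.1)
    (fun σ k h => ⟨⟨⟨h.1.1.1.setReg (by decide) k, h.1.1.2⟩, h.1.2⟩, h.2⟩) (hW _ (by decide)) k2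
    fun d hd => ?_
  refine Search.forN (by decide) (fun σ h => hsize σ h.1.1.1.1)
    (fun σ k h => ⟨⟨⟨⟨h.1.1.1.1.setReg (by decide) k, h.1.1.1.2⟩, h.1.1.2⟩, h.1.2⟩, h.2⟩)
    (hW _ (by decide)) k1 fun e he => ?_
  refine Search.forN (by decide) (fun σ h => hsize σ h.1.1.1.1.1)
    (fun σ k h => ⟨⟨⟨⟨⟨h.1.1.1.1.1.setReg (by decide) k, h.1.1.1.1.2⟩, h.1.1.1.2⟩, h.1.1.2⟩, h.1.2⟩,
      h.2⟩) (hW _ (by decide)) k0 fun f hf' => ?_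
  refine search_cutAttempt hr hf hmax hl hln hG hT (fun j => ?_) (fun j => ?_) ?_ ?_
  · fin_cases j <;> simpa
  · fin_cases j <;> simpa
  · rintro σ ⟨⟨⟨⟨⟨⟨h0, h1⟩, h2⟩, h3⟩, h4⟩, h5⟩, h6⟩
    exact ⟨h0, by rw [xs, h1, h2, h3], by rw [ys, h4, h5, h6]⟩
  · rintro σ τ ⟨⟨⟨⟨⟨⟨h0, h1⟩, h2⟩, h3⟩, h4⟩, h5⟩, h6⟩ hF
    exact ⟨⟨⟨⟨⟨⟨h0.trans (hF.mono (by decide) (by decide)), (hF.reg (by decide)).trans h1⟩,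
      (hF.reg (by decide)).trans h2⟩, (hF.reg (by decide)).trans h3⟩,
      (hF.reg (by decide)).trans h4⟩, (hF.reg (by decide)).trans h5⟩, (hF.reg (by decide)).trans h6⟩

/-- Prepare for colouring the whole graph in `aE`. -/
def whole : Cmd :=
  .seq (fill aS rV (.read aLive (reg rV))) <|
  .seq (fill aX rV (const 0)) (fill aY rV (const 0))

theorem exec_whole {n : ℕ} {σ : State} (hn : σ.reg 0 = n) :
    (∀ v < n, (whole.exec σ).arr aS v = σ.arr aLive v) ∧ (∀ v < n, (whole.exec σ).arr aX v = 0) ∧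
      ∀ v < n, (whole.exec σ).arr aY v = 0 := by
  have hs₁ := exec_fill (a := aS) (v := rV) (e := .read aLive (reg rV)) (σ := σ) (by decide)
    (fun v => σ.arr aLive v) (fun i hi τ hF h1 _ => by simp [eval, h1, hF.arr])
  set σ₁ := (fill aS rV (.read aLive (reg rV))).exec σ with h₁
  have hn₁ : σ₁.reg 0 = n := (exec_reg (by decide) σ).trans hn
  have hs₂ := exec_fill (a := aX) (v := rV) (e := const 0) (σ := σ₁) (by decide) (fun _ => 0)
    (fun _ _ _ _ _ _ => rfl)
  set σ₂ := (fill aX rV (const 0)).exec σ₁ with h₂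
  have hn₂ : σ₂.reg 0 = n := (exec_reg (by decide) σ₁).trans hn₁
  have hs₃ := exec_fill (a := aY) (v := rV) (e := const 0) (σ := σ₂) (by decide) (fun _ => 0)
    (fun _ _ _ _ _ _ => rfl)
  have hF₁₂ : Frame [rV] [aX] σ₁ σ₂ := frame_of (by decide) (by decide) σ₁
  have hF₂₃ : Frame [rV] [aY] σ₂ (whole.exec σ) := frame_of (by decide) (by decide) σ₂
  refine ⟨fun v hv => ?_, fun v hv => ?_, fun v hv => ?_⟩
  · rw [hF₂₃.arr (by decide), hF₁₂.arr (by decide), hs₁ v, if_pos (hn ▸ hv)]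
  · rw [hF₂₃.arr (by decide), hs₂ v, if_pos (hn₁ ▸ hv)]
  · exact (hs₃ v).trans (if_pos (hn₂ ▸ hv))

/-- One round: peel off a part of the graph in `aE`, the whole graph if possible. -/
def level : Cmd :=
  .seq (.set rFound (const 0)) <| .seq (.seq whole (.seq buildM tryAll)) cuts

/-- Every round succeeds. If the graph in `aE` is not used up, then either at most one vertex has
degree more than three, and the whole graph is coloured, or there is a matching cut with a suitable
side. -/
theorem exec_level {n l : ℕ} {σ : State} {H : SimpleGraph ℕ} {A : Finset ℕ} (hr : Rows n σ)
    (hmax : σ.reg rMax = 3) (hl : σ.reg rLev = l) (hln : l < n)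
    (hG : IsGraph n (σ.arr aE) (σ.arr aLive) H A) (hA : Good H A) :
    Peeled n l H A σ (level.exec σ) := by
  set σ₁ := (Cmd.set rFound (const 0)).exec σ with h₁
  have hF₁ : Frame [rFound] [] σ σ₁ := frame_of (by decide) (by decide) σ
  have hr₁ := hr.of_frame hF₁ (by decide) (by decide)
  have hf₁ : σ₁.reg rFound = 0 := rfl
  have hmax₁ : σ₁.reg rMax = 3 := (hF₁.reg (by decide)).trans hmax
  have hl₁ : σ₁.reg rLev = l := (hF₁.reg (by decide)).trans hl
  suffices h : Peeled n l H A σ₁ (cuts.exec ((Cmd.seq whole (.seq buildM tryAll)).exec σ₁)) from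
    ⟨h.found, h.graph, h.keep⟩
  obtain ⟨hS, hX, hY⟩ := exec_whole hr₁.size
  set σ₂ := whole.exec σ₁ with h₂
  have hF₂ : Frame [rH, rZ, rT, rU, rV, rK, rA, rB, rBad, rX₀, rX₁, rX₂, rY₀, rY₁, rY₂]
      [aB, aD, aC, aP, aM, aW, aS, aX, aY] σ₁ σ₂ := frame_of (by decide) (by decide) σ₁
  have hr₂ := hr₁.of_frame hF₂ (by decide) (by decide)
  have hs := search_torso (l := l) (ρ := σ₁) (X := A) (Y := fun _ => False) (H := H) (A := A) hr₂
    ((hF₂.reg (by decide)).trans hf₁)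
    ((hF₂.reg (by decide)).trans hmax₁) ((hF₂.reg (by decide)).trans hl₁) hln
    (by rwa [hF₂.arr (by decide), hF₂.arr (by decide)])
    (fun v hv => by rw [hS v hv]; exact hG.set v hv) (fun v hv => by simp [hY v hv])
    (whole_peel hG.mem hG.lt hX)
    (hF₂.arr (by decide)) (hF₂.arr (by decide)) (hF₂.arr (by decide))
  have hK : Keeps cuts (Peeled n l H A σ₁) := by
    have hW : ∀ x, x ≠ rFound → ∀ σ k, Peeled n l H A σ₁ σ → Peeled n l H A σ₁ (σ.setReg x k) :=
      fun x hx σ k h => h.setReg hx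
    have k0 : Keeps cutAttempt (Peeled n l H A σ₁) := keeps_guard fun _ h => h.found
    exact (((((k0.forN (x := rY₂) (by decide) (hW _ (by decide))).forN (x := rY₁) (by decide)
      (hW _ (by decide))).forN (x := rY₀) (by decide) (hW _ (by decide))).forN (x := rX₂) (by decide)
      (hW _ (by decide))).forN (x := rX₁) (by decide) (hW _ (by decide))).forN (x := rX₀) (by decide)
      (hW _ (by decide))
  show Peeled n l H A σ₁ (cuts.exec ((Cmd.seq buildM tryAll).exec σ₂))
  rcases hs with hs | ⟨hF, hno⟩
  · exact hK _ hs
  rcases hA with rfl | ⟨hT, hdom⟩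
  · exact absurd ⟨0, by omega, 0, by omega, 0, by omega, Or.inl rfl⟩ hno
  by_cases hdeg : ∃ g ∈ A, ∃ g' ∈ A, g ≠ g' ∧ 4 ≤ H.degIn A g ∧ 4 ≤ H.degIn A g'
  · obtain ⟨g, hg, g', hg', hne, hd, hd'⟩ := hdeg
    obtain ⟨X, x, y, h, hC, hh, hdeg, hX⟩ := hT.exists_leaf hg hg' hne hd hd'
    refine (search_cuts hr₁ hf₁ hmax₁ hl₁ hln hG hT _
      (hF₂.trans (hF.mono (by decide) (by decide)))).resolve_right fun h' => h'.2 ?_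
    have hx : ∀ j, x j < n := fun j => hG.lt _ (hC.sub (hC.x_mem j))
    have hy : ∀ j, y j < n := fun j => hG.lt _ (hC.y_mem j)
    have ex : ![x 0, x 1, x 2] = x := by funext j; fin_cases j <;> rfl
    have ey : ![y 0, y 1, y 2] = y := by funext j; fin_cases j <;> rfl
    exact ⟨x 0, hx 0, x 1, hx 1, x 2, hx 2, y 0, hy 0, y 1, hy 1, y 2, hy 2, by
      rw [ex, ey]; exact ⟨X, hC, ⟨h, hh, hdeg⟩, hX⟩⟩
  · push Not at hdeg
    refine absurd ?_ hno
    obtain ⟨h, hh, hd⟩ : ∃ h ∈ A, ∀ v ∈ A, v ≠ h → H.degIn A v ≤ 3 := by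
      by_cases hex : ∃ g ∈ A, 4 ≤ H.degIn A g
      · obtain ⟨g, hg, hd⟩ := hex
        refine ⟨g, hg, fun v hv hvg => ?_⟩
        have := hdeg g hg v hv hvg.symm hd
        omega
      · push Not at hex
        have : A.Nonempty := Finset.card_pos.1 (by have := hT.card; omega)
        obtain ⟨h, hh⟩ := this
        exact ⟨h, hh, fun v hv _ => by have := hex v hv; omega⟩
    exact exists_greedy hT hG.lt hh (hdom h hh) hd

/-! ### Putting the colourings together -/

/-- `Chain S a l b` means that `b` is reached from `a` by `l` steps, the `i`-th of them in the
relation `S i`. -/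
inductive Chain {α : Type*} (S : ℕ → α → α → Prop) (a : α) : ℕ → α → Prop
  | zero : Chain S a 0 a
  | succ {l : ℕ} {b c : α} : Chain S a l b → S l b c → Chain S a (l + 1) c

theorem Chain.mono {α : Type*} {S S' : ℕ → α → α → Prop} {a b : α} {l : ℕ} (h : Chain S a l b)
    (hS : ∀ i < l, ∀ b c, S i b c → S' i b c) : Chain S' a l b := by
  induction h with
  | zero => exact .zero
  | succ _ hs ih => exact .succ (ih fun i hi => hS i (by omega)) (hS _ (by omega) _ _ hs)

theorem Extends.congr {n : ℕ} {c w c' w' : ℕ → ℕ} {S S' : ℕ → Prop} {H H' : SimpleGraph ℕ}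
    {A A' : Finset ℕ} (h : Extends n c w S H A H' A') (hc : ∀ v < n, c' v = c v)
    (hw : ∀ v < n, w' v = w v) (hS : ∀ v < n, S' v ↔ S v) : Extends n c' w' S' H A H' A' := by
  intro f hf
  obtain ⟨⟨p, q, hpq, h1⟩, h2⟩ := h f hf
  refine ⟨⟨p, q, hpq, fun v hv => ?_⟩, fun p q hpq h3 f' h4 h5 => h2 p q hpq (fun v hv => ?_) f'
    (fun v hv hS' => ?_) fun v hv hS' => ?_⟩
  · rw [hc v hv, hw v hv]; exact h1 v hv
  · rw [← hc v hv, ← hw v hv]; exact h3 v hv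
  · rw [← hc v hv]; exact h4 v hv ((hS v hv).2 hS')
  · exact h5 v hv fun h => hS' ((hS v hv).1 h)

/-- Row `l` of the records of `σ` describes how colourings extend from the second graph to the
first. -/
def Recorded (n : ℕ) (σ : State) (l : ℕ) (b c : SimpleGraph ℕ × Finset ℕ) : Prop :=
  Extends n (fun v => σ.arr aRC (l * n + v)) (fun v => σ.arr aRX (l * n + v))
    (fun v => σ.arr aRS (l * n + v) ≠ 0) b.1 b.2 c.1 c.2

/-- After `n` rounds the graph is used up, since its vertex set shrinks in each round. -/
theorem exec_levels {n : ℕ} {σ : State} {H : SimpleGraph ℕ} {A : Finset ℕ} (hr : Rows n σ)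
    (hmax : σ.reg rMax = 3) (hG : IsGraph n (σ.arr aE) (σ.arr aLive) H A) (hA : Good H A) :
    ∃ H', Chain (Recorded n ((Cmd.forN rLev level).exec σ)) (H, A) n (H', ∅) ∧
      ∀ {u v}, ¬ H'.Adj u v := by
  have hcard : A.card ≤ n := by
    have : A ⊆ Finset.range n := fun v hv => Finset.mem_range.2 (hG.lt v hv)
    simpa using Finset.card_le_card this
  have key := forN_inv (x := rLev) (σ := σ) (P := level) (by decide)
    (fun l τ => ∃ H' A', IsGraph n (τ.arr aE) (τ.arr aLive) H' A' ∧ Good H' A' ∧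
      (A' = ∅ ∨ A'.card + l ≤ n) ∧ Chain (Recorded n τ) (H, A) l (H', A'))
    ⟨H, A, hG, hA, Or.inr (by simpa using hcard), .zero⟩ ?_
  · rw [hr.size] at key
    obtain ⟨H', A', hG', -, hc, hch⟩ := key
    have : A' = ∅ := hc.elim id fun h => Finset.card_eq_zero.1 (by omega)
    subst this
    exact ⟨H', hch, fun h => absurd (hG'.mem h) (by simp)⟩
  rintro l hl τ ⟨H', A', hG', hA', hc, hch⟩ hτl hF
  rw [hr.size] at hl
  have hF' : Frame [rH, rZ, rT, rU, rV, rK, rA, rB, rBad, rX₀, rX₁, rX₂, rY₀, rY₁, rY₂, rFound, rLev]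
      [aB, aD, aC, aP, aM, aW, aS, aX, aY, aE, aLive, aRC, aRX, aRS] σ τ :=
    hF.mono (by decide) (by decide)
  have hp := exec_level (hr.of_frame hF' (by decide) (by decide)) ((hF'.reg (by decide)).trans hmax)
    hτl hl hG' hA'
  obtain ⟨H'', A'', h1, h2, h3, h4⟩ := hp.graph
  refine ⟨H'', A'', h1, h2, ?_, .succ (b := (H', A')) (hch.mono fun i hi b c h => ?_) h4⟩
  · rcases h3 with h3 | h3
    · exact Or.inl h3
    · rcases hc with rfl | hc
      · simp at h3
      · right; omega
  · have hk := hp.keep i (by omega)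
    refine Extends.congr h (fun v hv => (hk v hv).1) (fun v hv => (hk v hv).2.1) fun v hv => ?_
    show ((level.exec τ).arr aRS (i * n + v) ≠ 0 ↔ _)
    rw [(hk v hv).2.2]

/-- The recorded colour of the vertex `rV`, permuted according to `aP`. -/
def permuted : Expr :=
  .read aP (.add (.eq (mat aRC (reg rLev) (reg rV)) (const 1))
    (.add (.eq (mat aRC (reg rLev) (reg rV)) (const 2))
      (.eq (mat aRC (reg rLev) (reg rV)) (const 2))))

/-- Extend the colouring in `aOut` by the colours in row `rLev` of the records, permuted by `rP` and
`rQ`, unless there is a conflict. -/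
def tryPerm : Cmd :=
  .ite (reg rFound).not
    (.seq (.write aP (const 0) (.sub (.sub (const 6) (reg rP)) (reg rQ))) <|
    .seq (.write aP (const 1) (reg rP)) <| .seq (.write aP (const 2) (reg rQ)) <|
    .seq (.set rBad (((Expr.eq (reg rP) (const 0)).or (.lt (const 3) (reg rP))).or
      (((Expr.eq (reg rQ) (const 0)).or (.lt (const 3) (reg rQ))).or (.eq (reg rP) (reg rQ))))) <|
    .seq (scan rV rBad ((mat aRX (reg rLev) (reg rV)).and
      (.eq permuted (.read aOut (.sub (mat aRX (reg rLev) (reg rV)) (const 1)))))) <|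
    .ite (reg rBad) .skip <| .seq (.set rFound (const 1)) <|
    .forN rV (.ite (mat aRS (reg rLev) (reg rV)) (.write aOut (reg rV) permuted) .skip)) .skip

theorem eval_permuted {n l p q : ℕ} {σ : State} (hσ : Rows n σ) (hl : σ.reg rLev = l) (hln : l < n)
    (h0 : σ.arr aP 0 = 6 - p - q) (h1 : σ.arr aP 1 = p) (h2 : σ.arr aP 2 = q) :
    permuted.eval σ = permColour p q (σ.arr aRC (l * n + σ.reg rV)) := by
  simp only [permuted, mat, eval, hl, hσ.row l hln, permColour]
  split_ifs with h3 h4 <;> simp_all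

/-- An attempt with `p` and `q` succeeds if they describe a permutation that makes the recorded
colouring compatible with the present one. -/
theorem search_perm {n l p q : ℕ} {σ₁ : State} {H H' : SimpleGraph ℕ} {A A' : Finset ℕ}
    {Base : State → Prop} (hr : Rows n σ₁) (hf : σ₁.reg rFound = 0) (hl : σ₁.reg rLev = l)
    (hln : l < n) (hext : Recorded n σ₁ l (H, A) (H', A')) (hC : IsCol H' A' 3 (σ₁.arr aOut))
    (hBase : ∀ σ, Base σ → Frame [rP, rQ, rV, rBad] [aP] σ₁ σ ∧ σ.reg rP = p ∧ σ.reg rQ = q)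
    (hstable : ∀ σ τ, Base σ → Frame [rV, rBad] [aP] σ τ → Base τ) :
    Search tryPerm Base (fun σ => σ.reg rFound ≠ 0 ∧ IsCol H A 3 (σ.arr aOut))
      (IsPerm p q ∧ ∀ v < n, σ₁.arr aRX (l * n + v) ≠ 0 →
        permColour p q (σ₁.arr aRC (l * n + v)) ≠ σ₁.arr aOut (σ₁.arr aRX (l * n + v) - 1)) := by
  classical
  intro σ hσ
  obtain ⟨hF, hp, hq⟩ := hBase σ hσ
  have hfσ : σ.reg rFound = 0 := (hF.reg (by decide)).trans hf
  have he : (reg rFound).not.eval σ ≠ 0 := by simp [Expr.not, eval, hfσ]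
  set σ₂ := (Cmd.write aP (const 0) (.sub (.sub (const 6) (reg rP)) (reg rQ))).exec σ with h₂
  set σ₃ := (Cmd.write aP (const 1) (reg rP)).exec σ₂ with h₃
  set σ₄ := (Cmd.write aP (const 2) (reg rQ)).exec σ₃ with h₄
  set σ₅ := (Cmd.set rBad (((Expr.eq (reg rP) (const 0)).or (.lt (const 3) (reg rP))).or
      (((Expr.eq (reg rQ) (const 0)).or (.lt (const 3) (reg rQ))).or
        (.eq (reg rP) (reg rQ))))).exec σ₄ with h₅
  have hFσ₅ : Frame [rV, rBad] [aP] σ σ₅ :=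
    (((frame_of (by decide) (by decide) σ).trans (frame_of (by decide) (by decide) σ₂)).trans
      (frame_of (by decide) (by decide) σ₃)).trans (frame_of (by decide) (by decide) σ₄)
  have hp₅ : σ₅.reg rP = p := (hFσ₅.reg (by decide)).trans hp
  have hq₅ : σ₅.reg rQ = q := (hFσ₅.reg (by decide)).trans hq
  have hP₅ : σ₅.arr aP 0 = 6 - p - q ∧ σ₅.arr aP 1 = p ∧ σ₅.arr aP 2 = q := by
    rw [← hp, ← hq]
    exact ⟨rfl, rfl, rfl⟩
  have hbad₅ : σ₅.reg rBad ≠ 0 ↔ ¬ IsPerm p q := by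
    have : σ₅.reg rBad ≠ 0 ↔ (((Expr.eq (reg rP) (const 0)).or (.lt (const 3) (reg rP))).or
      (((Expr.eq (reg rQ) (const 0)).or (.lt (const 3) (reg rQ))).or
        (.eq (reg rP) (reg rQ)))).Holds σ₅ := Iff.rfl
    rw [this]
    simp only [holds_or, holds_eq, holds_lt, eval, hp₅, hq₅, IsPerm]
    omega
  have hF₅ : Frame [rP, rQ, rV, rBad] [aP] σ₁ σ₅ := hF.trans (hFσ₅.mono (by decide) (by decide))
  have hr₅ := hr.of_frame hF₅ (by decide) (by decide)
  have hs₆ := exec_scan (v := rV) (r := rBad) (σ := σ₅)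
    (e := (mat aRX (reg rLev) (reg rV)).and
      (.eq permuted (.read aOut (.sub (mat aRX (reg rLev) (reg rV)) (const 1)))))
    (by decide) (by decide) (by decide)
    (fun v => σ₁.arr aRX (l * n + v) ≠ 0 ∧
      permColour p q (σ₁.arr aRC (l * n + v)) = σ₁.arr aOut (σ₁.arr aRX (l * n + v) - 1)) (by
      rw [hr₅.size]
      intro i hi τ hF' h1
      have hτ := hr₅.of_frame hF' (by decide) (by decide)
      have hlτ : τ.reg rLev = l := by rw [hF'.reg (by decide), hF₅.reg (by decide), hl]
      have e1 : τ.arr aP = σ₅.arr aP := hF'.arr (by decide)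
      rw [holds_and, holds_eq, eval_permuted hτ hlτ hln (by rw [e1, hP₅.1]) (by rw [e1, hP₅.2.1])
        (by rw [e1, hP₅.2.2])]
      simp [mat, holds_read, eval, hlτ, hF'.arr, hF₅.arr, hr.row l hln, h1])
  set σ₆ := Cmd.exec _ σ₅ with h₆
  rw [hbad₅, hr₅.size] at hs₆
  have hFσ₆ : Frame [rV, rBad] [aP] σ σ₆ := hFσ₅.trans (frame_of (by decide) (by decide) σ₅)
  have hP₆ : σ₆.arr aP = σ₅.arr aP := exec_arr (by decide) σ₅
  have hex : tryPerm.exec σ = (Cmd.ite (reg rBad) .skip <| .seq (.set rFound (const 1)) <|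
    .forN rV (.ite (mat aRS (reg rLev) (reg rV)) (.write aOut (reg rV) permuted) .skip)).exec σ₆ := by
    rw [tryPerm, exec, if_pos he]
    rfl
  rw [hex]
  by_cases hb : σ₆.reg rBad = 0
  · left
    rw [exec, if_neg (by simp [eval, hb])]
    set σ₇ := (Cmd.set rFound (const 1)).exec σ₆ with h₇
    have hF₇ : Frame [rP, rQ, rV, rBad, rFound] [aP] σ₁ σ₇ :=
      ((hF.mono (by decide) (by decide)).trans (hFσ₆.mono (by decide) (by decide))).trans
        (frame_of (by decide) (by decide) σ₆)
    have hr₇ := hr.of_frame hF₇ (by decide) (by decide)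
    have hP₇ : σ₇.arr aP = σ₅.arr aP := hP₆
    have hfound : ((Cmd.forN rV (.ite (mat aRS (reg rLev) (reg rV)) (.write aOut (reg rV) permuted)
      .skip)).exec σ₇).reg rFound ≠ 0 := by
      rw [exec_reg (by decide)]
      exact one_ne_zero
    have hI := forN_inv (x := rV) (σ := σ₇)
      (P := .ite (mat aRS (reg rLev) (reg rV)) (.write aOut (reg rV) permuted) .skip) (by decide)
      (fun k τ => ∀ v, τ.arr aOut v = if v < k ∧ σ₁.arr aRS (l * n + v) ≠ 0 then
        permColour p q (σ₁.arr aRC (l * n + v)) else σ₁.arr aOut v) (by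
          intro v
          rw [if_neg (by omega)]
          show σ₇.arr aOut v = _
          rw [hF₇.arr (by decide)]) (by
      intro k hk τ hI hτk hF' v
      have hF'' : Frame [rV] [aOut] σ₇ τ := hF'.mono (by decide) (by decide)
      have hτ := hr₇.of_frame hF'' (by decide) (by decide)
      have hlτ : τ.reg rLev = l := by rw [hF''.reg (by decide), hF₇.reg (by decide), hl]
      have e1 : τ.arr aP = σ₅.arr aP := (hF''.arr (by decide)).trans hP₇
      have e2 : τ.arr aRC = σ₁.arr aRC := (hF''.arr (by decide)).trans (hF₇.arr (by decide))
      have hperm := eval_permuted (p := p) (q := q) hτ hlτ hln (by rw [e1, hP₅.1])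
        (by rw [e1, hP₅.2.1]) (by rw [e1, hP₅.2.2])
      rw [hτk, e2] at hperm
      have hS : (mat aRS (reg rLev) (reg rV)).Holds τ ↔ σ₁.arr aRS (l * n + k) ≠ 0 := by
        simp [mat, holds_read, eval, hlτ, hτk, hτ.row l hln, hF''.arr (b := aRS), hF₇.arr (b := aRS)]
      show (Cmd.exec _ τ).arr aOut v = _
      rw [exec_ite]
      by_cases hSk : σ₁.arr aRS (l * n + k) ≠ 0
      · rw [if_pos (hS.2 hSk)]
        show (τ.setArr aOut (τ.reg rV) (permuted.eval τ)).arr aOut v = _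
        rw [setArr_arr_self, hτk, hperm]
        by_cases hvk : v = k
        · subst hvk
          simp [hSk]
        · rw [Function.update_of_ne hvk, hI v]
          exact if_congr (and_congr_left' (by omega)) rfl rfl
      · rw [if_neg (fun h => hSk (hS.1 h))]
        show τ.arr aOut v = _
        rw [hI v]
        by_cases hvk : v = k
        · subst hvk
          simp [hSk]
        · exact if_congr (and_congr_left' (by omega)) rfl rfl)
    rw [hr₇.size] at hI
    refine ⟨hfound, ?_⟩
    have hno : ¬ (¬ IsPerm p q ∨ ∃ i < n, σ₁.arr aRX (l * n + i) ≠ 0 ∧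
      permColour p q (σ₁.arr aRC (l * n + i)) = σ₁.arr aOut (σ₁.arr aRX (l * n + i) - 1)) :=
      fun h => hs₆.2 h hb
    push Not at hno
    refine (hext _ hC).2 p q hno.1 (fun v hv h => hno.2 v hv h) _ (fun v hv hS => ?_)
      fun v hv hS => ?_
    · exact (hI v).trans (if_pos ⟨hv, hS⟩)
    · exact (hI v).trans (if_neg fun h => hS h.2)
  · right
    rw [exec, if_pos (by simpa [eval] using hb)]
    refine ⟨hstable _ _ hσ hFσ₆, ?_⟩
    rintro ⟨h1, h2⟩
    rcases hs₆.1 hb with h | ⟨v, hv, h3, h4⟩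
    exacts [h h1, h2 v hv h3 h4]

/-- Extend the colouring in `aOut` by means of the records, the last row first. -/
def unwind : Cmd :=
  .forN rK (.seq (.set rLev (.sub (.sub (reg rN) (const 1)) (reg rK))) <|
    .seq (.set rFound (const 0)) (.forN rP (.forN rQ tryPerm)))

/-- Undoing all rounds turns the empty colouring into a `3`-colouring of the original graph. -/
theorem exec_unwind {n : ℕ} {σ : State} {H H' : SimpleGraph ℕ} {A : Finset ℕ} (hr : Rows n σ)
    (h4 : 4 ≤ n) (hch : Chain (Recorded n σ) (H, A) n (H', ∅)) (hH' : ∀ {u v}, ¬ H'.Adj u v) :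
    IsCol H A 3 ((unwind.exec σ).arr aOut) := by
  have key := forN_inv (x := rK) (σ := σ) (P := .seq (.set rLev (.sub (.sub (reg rN) (const 1))
    (reg rK))) <| .seq (.set rFound (const 0)) (.forN rP (.forN rQ tryPerm))) (by decide)
    (fun k τ => ∃ b, Chain (Recorded n σ) (H, A) (n - k) b ∧ IsCol b.1 b.2 3 (τ.arr aOut))
    ⟨_, hch, fun u v h => absurd h hH', fun v hv => absurd hv (by simp)⟩ ?_
  · rw [hr.size] at key
    obtain ⟨b, hb, hC⟩ := key
    rw [Nat.sub_self] at hb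
    cases hb
    exact hC
  rintro k hk τ ⟨c, hc, hC⟩ hτk hF
  rw [hr.size] at hk
  obtain ⟨l, hl⟩ : ∃ l, n - k = l + 1 := ⟨n - k - 1, by omega⟩
  rw [hl] at hc
  obtain ⟨b, hb, hs⟩ : ∃ b, Chain (Recorded n σ) (H, A) l b ∧ Recorded n σ l b c := by
    cases hc with
    | succ h h' => exact ⟨_, h, h'⟩
  refine ⟨b, by rwa [show n - (k + 1) = l by omega], ?_⟩
  have hF' : Frame [rK, rLev, rFound, rP, rQ, rV, rBad] [aP, aOut] σ τ :=
    hF.mono (by decide) (by decide)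
  set τ₁ := (Cmd.set rLev (.sub (.sub (reg rN) (const 1)) (reg rK))).exec τ with h₁
  set τ₂ := (Cmd.set rFound (const 0)).exec τ₁ with h₂
  have hF₂ : Frame [rK, rLev, rFound, rP, rQ, rV, rBad] [aP, aOut] σ τ₂ :=
    (hF'.trans (frame_of (by decide) (by decide) τ)).trans (frame_of (by decide) (by decide) τ₁)
  have hr₂ := hr.of_frame hF₂ (by decide) (by decide)
  have hl₂ : τ₂.reg rLev = l := by
    show τ.reg rN - 1 - τ.reg rK = l
    rw [hτk, hF'.reg (by decide), hr.size]
    omega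
  have hs₂ : Recorded n τ₂ l b c := by
    unfold Recorded
    rw [hF₂.arr (by decide), hF₂.arr (by decide), hF₂.arr (by decide)]
    exact hs
  obtain ⟨⟨p, q, hpq, hno⟩, -⟩ := hs₂ _ hC
  have hW : ∀ x, x ≠ rFound → ∀ (σ : State) (k : ℕ), (σ.reg rFound ≠ 0 ∧ IsCol b.1 b.2 3 (σ.arr aOut)) →
      (σ.setReg x k).reg rFound ≠ 0 ∧ IsCol b.1 b.2 3 ((σ.setReg x k).arr aOut) :=
    fun x hx σ k h => ⟨by simpa [State.setReg, hx.symm] using h.1, h.2⟩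
  have k0 : Keeps tryPerm fun σ => σ.reg rFound ≠ 0 ∧ IsCol b.1 b.2 3 (σ.arr aOut) :=
    keeps_guard fun _ h => h.1
  have k1 := k0.forN (x := rQ) (by decide) (hW _ (by decide))
  have hsize : ∀ σ, Frame [rP, rQ, rV, rBad] [aP] τ₂ σ → σ.reg 0 = n :=
    fun σ hσ => (hσ.reg (by decide)).trans hr₂.size
  have hsearch : Search (.forN rP (.forN rQ tryPerm)) (Frame [rP, rQ, rV, rBad] [aP] τ₂)
      (fun σ => σ.reg rFound ≠ 0 ∧ IsCol b.1 b.2 3 (σ.arr aOut)) (∃ p < n, ∃ q < n, IsPerm p q ∧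
        ∀ v < n, τ₂.arr aRX (l * n + v) ≠ 0 →
        permColour p q (τ₂.arr aRC (l * n + v)) ≠ τ₂.arr aOut (τ₂.arr aRX (l * n + v) - 1)) := by
    refine Search.forN (by decide) hsize (fun σ k h => h.setReg (by decide) k)
      (hW _ (by decide)) k1 fun p hp => ?_
    refine Search.forN (by decide) (fun σ h => hsize σ h.1)
      (fun σ k h => ⟨h.1.setReg (by decide) k, h.2⟩) (hW _ (by decide)) k0 fun q hq => ?_
    refine search_perm hr₂ rfl hl₂ (by omega) hs₂ hC (fun σ h => ⟨h.1.1, h.1.2, h.2⟩) ?_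
    rintro ρ ρ' ⟨⟨h1, h2⟩, h3⟩ hρ
    exact ⟨⟨h1.trans (hρ.mono (by decide) (by decide)), (hρ.reg (by decide)).trans h2⟩,
      (hρ.reg (by decide)).trans h3⟩
  rcases hsearch τ₂ (Frame.refl _ _ _) with h | ⟨-, h⟩
  · exact h.2
  · have := hpq
    unfold IsPerm at this
    exact absurd ⟨p, by omega, q, by omega, hpq, hno⟩ h

/-! ### Few colours and wheels -/

/-- The graph `M` on `W` without the vertices `h` and `z` is bipartite, and there are enough
colours for `h` and `z`, if these are vertices at all. -/
structure Parity (M : SimpleGraph ℕ) (W : Finset ℕ) (cb h z t : ℕ) : Prop where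
  two_le : 2 ≤ cb
  three_le : h ∈ W → 3 ≤ cb
  four_le : z ∈ W → 4 ≤ cb
  mem : t ∈ W
  ne_left : t ≠ h
  ne_right : t ≠ z
  bipartite : ∃ g : ℕ → Bool, ∀ u v, M.Adj u v → u ≠ h → u ≠ z → v ≠ h → v ≠ z → g u ≠ g v

/-- Colour the graph in `aM` without `rH` and `rZ` with two colours, and these vertices with further
colours. -/
def attemptParity : Cmd := attempt colourParity (.set rFound (const 1))

/-- Success of a parity colouring. -/
def Coloured (M : SimpleGraph ℕ) (W : Finset ℕ) (cb : ℕ) (σ : State) : Prop :=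
  σ.reg rFound ≠ 0 ∧ IsCol M W cb (σ.arr aC)

theorem Coloured.setReg {M : SimpleGraph ℕ} {W : Finset ℕ} {cb x : ℕ} (hx : x ≠ rFound) (σ : State)
    (k : ℕ) (h : Coloured M W cb σ) : Coloured M W cb (σ.setReg x k) :=
  ⟨by simpa [State.setReg, hx.symm] using h.1, h.2⟩

theorem keeps_attemptParity {M : SimpleGraph ℕ} {W : Finset ℕ} {cb : ℕ} :
    Keeps attemptParity (Coloured M W cb) := keeps_guard fun _ h => h.1

/-- An attempt succeeds if the graph without `h` and `z` is bipartite. -/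
theorem search_parity {n cb h z t : ℕ} {σ₀ : State} {M : SimpleGraph ℕ} {W : Finset ℕ}
    {Base : State → Prop} (hr : Rows n σ₀) (hf : σ₀.reg rFound = 0) (hmax : σ₀.reg rMax = cb)
    (hG : IsGraph n (σ₀.arr aM) (σ₀.arr aW) M W) (hM : Tight M W)
    (hBase : ∀ σ, Base σ → Frame [rH, rZ, rT, rU, rV, rK, rA, rB, rBad] [aB, aD, aC, aP] σ₀ σ ∧
      σ.reg rH = h ∧ σ.reg rZ = z ∧ σ.reg rT = t)
    (hstable : ∀ σ τ, Base σ → Frame [rU, rV, rK, rA, rB, rBad] [aB, aD, aC, aP] σ τ → Base τ) :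
    Search attemptParity Base (Coloured M W cb) (Parity M W cb h z t) := by
  have hB : ∀ σ, Base σ → Rows n σ ∧ σ.reg rFound = 0 ∧ σ.reg rMax = cb ∧
      IsGraph n (σ.arr aM) (σ.arr aW) M W := by
    intro σ hσ
    have hF := (hBase σ hσ).1
    refine ⟨hr.of_frame hF (by decide) (by decide), (hF.reg (by decide)).trans hf,
      (hF.reg (by decide)).trans hmax, ?_⟩
    rwa [hF.arr (by decide), hF.arr (by decide)]
  refine search_attempt (by decide) (by decide) hstable hB
    (fun σ hσ hC => ⟨one_ne_zero, hC⟩) ?_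
  rintro ⟨h1, h2, h3, h4, h5, h6, g, hg⟩ σ hσ hL
  obtain ⟨-, e1, e2, e3⟩ := hBase σ hσ
  rw [e1, e2, e3] at hL
  exact exec_colourParity_isCol (hB σ hσ).1.size e1 e2 hG.mem hG.lt h1 h2 h3 h5 h6 hg hL
    (hL.reach hM hG.lt h4 h5 h6)

/-- Look for a colouring with `2` colours. -/
def colourTwo : Cmd :=
  .seq (.set rFound (const 0)) <| .seq (.set rMax (const 2)) <| .seq (.set rH (reg rN)) <|
    .seq (.set rZ (reg rN)) (.forN rT attemptParity)

/-- Look for a colouring with `3` colours, one of which is used only once. -/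
def colourThree : Cmd :=
  .seq (.set rFound (const 0)) <| .seq (.set rMax (const 3)) <|
    .seq (.set rZ (reg rN)) (.forN rH (.forN rT attemptParity))

/-- Look for a colouring with `4` colours, two of which are used only once. -/
def colourFour : Cmd :=
  .seq (.set rFound (const 0)) <| .seq (.set rMax (const 4)) <|
    .forN rH (.forN rZ (.forN rT attemptParity))

theorem exec_colourTwo {n : ℕ} {σ : State} {M : SimpleGraph ℕ} {W : Finset ℕ} (hr : Rows n σ)
    (hG : IsGraph n (σ.arr aM) (σ.arr aW) M W) (hM : Tight M W) :
    Coloured M W 2 (colourTwo.exec σ) ∨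
      (colourTwo.exec σ).reg rFound = 0 ∧ ¬ ∃ t < n, Parity M W 2 n n t := by
  set σ₀ := ((((σ.setReg rFound 0).setReg rMax 2).setReg rH (σ.reg rN)).setReg rZ (σ.reg rN))
  have hr₀ : Rows n σ₀ := ⟨hr.size, hr.row⟩
  have hex : colourTwo.exec σ = (Cmd.forN rT attemptParity).exec σ₀ := rfl
  have hs : Search (.forN rT attemptParity) (fun σ => (Frame [rH, rZ, rT, rU, rV, rK, rA, rB, rBad]
      [aB, aD, aC, aP] σ₀ σ ∧ σ.reg rH = n) ∧ σ.reg rZ = n) (Coloured M W 2)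
      (∃ t < n, Parity M W 2 n n t) := by
    refine Search.forN (by decide) (fun σ h => (h.1.1.reg (by decide)).trans hr.size)
      (fun σ k h => ⟨⟨h.1.1.setReg (by decide) k, h.1.2⟩, h.2⟩)
      (fun σ k => Coloured.setReg (by decide) σ k) keeps_attemptParity fun t ht => ?_
    refine search_parity hr₀ rfl rfl hG hM (fun σ h => ⟨h.1.1.1, h.1.1.2, h.1.2, h.2⟩) ?_
    rintro σ τ ⟨⟨⟨h1, h2⟩, h3⟩, h4⟩ hF
    exact ⟨⟨⟨h1.trans (hF.mono (by decide) (by decide)), (hF.reg (by decide)).trans h2⟩,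
      (hF.reg (by decide)).trans h3⟩, (hF.reg (by decide)).trans h4⟩
  rw [hex]
  rcases hs σ₀ ⟨⟨Frame.refl _ _ _, hr.size⟩, hr.size⟩ with h | ⟨h, h'⟩
  · exact Or.inl h
  · exact Or.inr ⟨h.1.1.reg (by decide), h'⟩

theorem exec_colourThree {n : ℕ} {σ : State} {M : SimpleGraph ℕ} {W : Finset ℕ} (hr : Rows n σ)
    (hG : IsGraph n (σ.arr aM) (σ.arr aW) M W) (hM : Tight M W) :
    Coloured M W 3 (colourThree.exec σ) ∨
      (colourThree.exec σ).reg rFound = 0 ∧ ¬ ∃ h < n, ∃ t < n, Parity M W 3 h n t := by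
  set σ₀ := (((σ.setReg rFound 0).setReg rMax 3).setReg rZ (σ.reg rN))
  have hr₀ : Rows n σ₀ := ⟨hr.size, hr.row⟩
  have hex : colourThree.exec σ = (Cmd.forN rH (.forN rT attemptParity)).exec σ₀ := rfl
  have hs : Search (.forN rH (.forN rT attemptParity)) (fun σ =>
      Frame [rH, rZ, rT, rU, rV, rK, rA, rB, rBad] [aB, aD, aC, aP] σ₀ σ ∧ σ.reg rZ = n)
      (Coloured M W 3) (∃ h < n, ∃ t < n, Parity M W 3 h n t) := by
    refine Search.forN (by decide) (fun σ h => (h.1.reg (by decide)).trans hr.size)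
      (fun σ k h => ⟨h.1.setReg (by decide) k, h.2⟩) (fun σ k => Coloured.setReg (by decide) σ k)
      (keeps_attemptParity.forN (by decide) fun σ k => Coloured.setReg (by decide) σ k) fun h hh => ?_
    refine Search.forN (by decide) (fun σ h => (h.1.1.reg (by decide)).trans hr.size)
      (fun σ k h => ⟨⟨h.1.1.setReg (by decide) k, h.1.2⟩, h.2⟩)
      (fun σ k => Coloured.setReg (by decide) σ k) keeps_attemptParity fun t ht => ?_
    refine search_parity hr₀ rfl rfl hG hM (fun σ h => ⟨h.1.1.1, h.1.2, h.1.1.2, h.2⟩) ?_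
    rintro σ τ ⟨⟨⟨h1, h2⟩, h3⟩, h4⟩ hF
    exact ⟨⟨⟨h1.trans (hF.mono (by decide) (by decide)), (hF.reg (by decide)).trans h2⟩,
      (hF.reg (by decide)).trans h3⟩, (hF.reg (by decide)).trans h4⟩
  rw [hex]
  rcases hs σ₀ ⟨Frame.refl _ _ _, hr.size⟩ with h | ⟨h, h'⟩
  · exact Or.inl h
  · exact Or.inr ⟨h.1.reg (by decide), h'⟩

theorem exec_colourFour {n : ℕ} {σ : State} {M : SimpleGraph ℕ} {W : Finset ℕ} (hr : Rows n σ)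
    (hG : IsGraph n (σ.arr aM) (σ.arr aW) M W) (hM : Tight M W)
    (hgood : ∃ h < n, ∃ z < n, ∃ t < n, Parity M W 4 h z t) : Coloured M W 4 (colourFour.exec σ) := by
  set σ₀ := ((σ.setReg rFound 0).setReg rMax 4)
  have hr₀ : Rows n σ₀ := ⟨hr.size, hr.row⟩
  have hex : colourFour.exec σ = (Cmd.forN rH (.forN rZ (.forN rT attemptParity))).exec σ₀ := rfl
  have k1 : Keeps (.forN rT attemptParity) (Coloured M W 4) :=
    keeps_attemptParity.forN (by decide) fun σ k => Coloured.setReg (by decide) σ k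
  have hs : Search (.forN rH (.forN rZ (.forN rT attemptParity)))
      (Frame [rH, rZ, rT, rU, rV, rK, rA, rB, rBad] [aB, aD, aC, aP] σ₀)
      (Coloured M W 4) (∃ h < n, ∃ z < n, ∃ t < n, Parity M W 4 h z t) := by
    refine Search.forN (by decide) (fun σ h => (h.reg (by decide)).trans hr.size)
      (fun σ k h => h.setReg (by decide) k) (fun σ k => Coloured.setReg (by decide) σ k)
      (k1.forN (by decide) fun σ k => Coloured.setReg (by decide) σ k) fun h hh => ?_
    refine Search.forN (by decide) (fun σ h => (h.1.reg (by decide)).trans hr.size)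
      (fun σ k h => ⟨h.1.setReg (by decide) k, h.2⟩) (fun σ k => Coloured.setReg (by decide) σ k)
      k1 fun z hz => ?_
    refine Search.forN (by decide) (fun σ h => (h.1.1.reg (by decide)).trans hr.size)
      (fun σ k h => ⟨⟨h.1.1.setReg (by decide) k, h.1.2⟩, h.2⟩)
      (fun σ k => Coloured.setReg (by decide) σ k) keeps_attemptParity fun t ht => ?_
    refine search_parity hr₀ rfl rfl hG hM (fun σ h => ⟨h.1.1.1, h.1.1.2, h.1.2, h.2⟩) ?_
    rintro σ τ ⟨⟨⟨h1, h2⟩, h3⟩, h4⟩ hF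
    exact ⟨⟨⟨h1.trans (hF.mono (by decide) (by decide)), (hF.reg (by decide)).trans h2⟩,
      (hF.reg (by decide)).trans h3⟩, (hF.reg (by decide)).trans h4⟩
  rw [hex]
  exact (hs σ₀ (Frame.refl _ _ _)).resolve_right fun h => h.2 hgood

/-- Set `rA` if the graph in `aE` has a dominating vertex. -/
def dominate : Cmd :=
  .seq (.set rA (const 0)) <|
  .forN rH (.seq (.set rBad (const 0)) <|
    .seq (scan rV rBad ((Expr.eq (reg rV) (reg rH)).not.and (mat aE (reg rH) (reg rV)).not)) <|
    .ite (reg rBad) .skip (.set rA (const 1)))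

theorem exec_dominate {n : ℕ} {σ : State} {H : SimpleGraph ℕ} (hr : Rows n σ)
    (hE : IsMat n (σ.arr aE) H) :
    (dominate.exec σ).reg rA ≠ 0 ↔ ∃ h < n, ∀ v < n, v ≠ h → H.Adj h v := by
  set σ₁ := (Cmd.set rA (const 0)).exec σ with h₁
  have hF₁ : Frame [rA] [] σ σ₁ := frame_of (by decide) (by decide) σ
  have hr₁ := hr.of_frame hF₁ (by decide) (by decide)
  have key := forN_inv (x := rH) (σ := σ₁) (P := .seq (.set rBad (const 0)) <|
    .seq (scan rV rBad ((Expr.eq (reg rV) (reg rH)).not.and (mat aE (reg rH) (reg rV)).not)) <|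
    .ite (reg rBad) .skip (.set rA (const 1))) (by decide)
    (fun k τ => τ.reg rA ≠ 0 ↔ ∃ h < k, ∀ v < n, v ≠ h → H.Adj h v)
    ⟨fun h => absurd rfl h, fun ⟨_, h, _⟩ => by omega⟩ ?_
  · rw [hr₁.size] at key
    exact key
  intro k hk τ hI hτk hF
  rw [hr₁.size] at hk
  have hF' : Frame [rA, rH, rBad, rV] [] σ₁ τ := hF.mono (by decide) (by decide)
  set τ₁ := (Cmd.set rBad (const 0)).exec τ with h₂
  have hFτ₁ : Frame [rBad] [] τ τ₁ := frame_of (by decide) (by decide) τ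
  have hF₂ : Frame [rA, rH, rBad, rV] [] σ₁ τ₁ := hF'.trans (hFτ₁.mono (by decide) (by decide))
  have hr₂ := hr₁.of_frame hF₂ (by decide) (by decide)
  have hs := exec_scan (v := rV) (r := rBad) (σ := τ₁)
    (e := (Expr.eq (reg rV) (reg rH)).not.and (mat aE (reg rH) (reg rV)).not)
    (by decide) (by decide) (by decide) (fun v => v ≠ k ∧ ¬ H.Adj k v) (by
      rw [hr₂.size]
      intro i hi ρ hρ h1
      have e1 : ρ.reg rH = k := by rw [hρ.reg (by decide), hFτ₁.reg (by decide), hτk]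
      simp [mat, holds_read, eval, h1, e1, hρ.arr, hF₂.arr, hF₁.arr, hr.row k hk, ← hE k hk i hi])
  set τ₂ := Cmd.exec _ τ₁ with h₃
  rw [hr₂.size, show τ₁.reg rBad = 0 from rfl] at hs
  have hA : τ₂.reg rA = τ.reg rA := by
    rw [h₃, exec_reg (by decide)]
    exact hFτ₁.reg (by decide)
  have hex : (∃ h < k + 1, ∀ v < n, v ≠ h → H.Adj h v) ↔
      (∃ h < k, ∀ v < n, v ≠ h → H.Adj h v) ∨ ∀ v < n, v ≠ k → H.Adj k v := by
    constructor
    · rintro ⟨i, hi, h⟩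
      by_cases hik : i = k
      · exact Or.inr (hik ▸ h)
      · exact Or.inl ⟨i, by omega, h⟩
    · rintro (⟨i, hi, h⟩ | h)
      exacts [⟨i, by omega, h⟩, ⟨k, by omega, h⟩]
  show ((Cmd.ite (reg rBad) .skip (.set rA (const 1))).exec τ₂).reg rA ≠ 0 ↔ _
  rw [hex]
  by_cases hb : τ₂.reg rBad = 0
  · have hdom : ∀ v < n, v ≠ k → H.Adj k v := by
      intro v hv hvk
      by_contra h
      exact hs.2 (Or.inr ⟨v, hv, hvk, h⟩) hb
    rw [iff_true_right (Or.inr hdom)]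
    rw [exec, if_neg (by simp [eval, hb])]
    exact one_ne_zero
  · rw [exec, if_pos (by simpa [eval] using hb)]
    have hdom : ¬ ∀ v < n, v ≠ k → H.Adj k v := by
      intro h
      rcases hs.1 hb with h' | ⟨v, hv, h1, h2⟩
      exacts [h' rfl, h2 (h v hv h1)]
    rw [or_iff_left hdom]
    show τ₂.reg rA ≠ 0 ↔ _
    rw [hA]
    exact hI

/-! ### The whole program -/

/-- Compute the row offsets, and copy the adjacency matrix. -/
def init : Cmd :=
  .seq (.set rA (const 0)) <|
  .seq (.forN rV (.seq (.write aRow (reg rV) (reg rA)) (.set rA (.add (reg rA) (reg rN))))) <|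
  .seq (fillMat aE rU rV (mat aIn (reg rU) (reg rV)).flag) <|
  .seq (fill aLive rV (const 1)) <| .seq whole buildM

theorem exec_init {n : ℕ} {σ : State} {H : SimpleGraph ℕ} (hn : σ.reg 0 = n)
    (hH : IsMat n (σ.arr aIn) H) (hT : ∀ {u v}, H.Adj u v → u ∈ Finset.range n) :
    Rows n (init.exec σ) ∧
      IsGraph n ((init.exec σ).arr aE) ((init.exec σ).arr aLive) H (Finset.range n) ∧
      IsGraph n ((init.exec σ).arr aM) ((init.exec σ).arr aW) H (Finset.range n) := by
  set σ₁ := (Cmd.set rA (const 0)).exec σ with h₁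
  have hn₁ : σ₁.reg 0 = n := hn
  have key := forN_inv (x := rV) (σ := σ₁)
    (P := .seq (.write aRow (reg rV) (reg rA)) (.set rA (.add (reg rA) (reg rN)))) (by decide)
    (fun k τ => τ.reg rA = k * n ∧ ∀ i < k, τ.arr aRow i = i * n)
    ⟨by simp [State.setReg, h₁, exec, eval], by omega⟩ (by
      rintro k hk τ ⟨hI, hI'⟩ hτk hF
      have e0 : τ.reg 0 = n := (hF.reg (by decide)).trans hn₁
      refine ⟨?_, fun i hi => ?_⟩
      · show τ.reg rA + τ.reg 0 = _
        rw [hI, e0, Nat.succ_mul]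
      · show (τ.setArr aRow (τ.reg rV) (τ.reg rA)).arr aRow i = _
        rw [setArr_arr_self, hτk, hI]
        by_cases hik : i = k
        · subst hik; rw [Function.update_self]
        · rw [Function.update_of_ne hik, hI' i (by omega)])
  rw [hn₁] at key
  set σ₂ := (Cmd.forN rV (.seq (.write aRow (reg rV) (reg rA)) (.set rA (.add (reg rA)
    (reg rN))))).exec σ₁ with h₂
  have hF₂ : Frame [rA, rV] [aRow] σ σ₂ :=
    (frame_of (by decide) (by decide) σ).trans (frame_of (by decide) (by decide) σ₁)
  have hr₂ : Rows n σ₂ := ⟨(hF₂.reg (by decide)).trans hn, key.2⟩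
  have hs₃ : ∀ u < n, ∀ v < n, _ ↔ _ := fun u hu v hv => exec_fillMat_flag (a := aE) (u := rU)
    (v := rV) (n := n) (σ := σ₂) (e := mat aIn (reg rU) (reg rV)) hr₂
    (by decide) (by decide) (by decide) (by decide) H.Adj (by
      intro i hi j hj τ hF h1 h2 _
      simp [mat, holds_read, eval, h1, h2, hF.arr, hr₂.row i hi, hF₂.arr (b := aIn), ← hH i hi j hj])
    (i := u) (j := v) hu hv
  set σ₃ := (fillMat aE rU rV (mat aIn (reg rU) (reg rV)).flag).exec σ₂ with h₃
  have hF₃ : Frame [rU, rV] [aE] σ₂ σ₃ := frame_of (by decide) (by decide) σ₂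
  have hr₃ := hr₂.of_frame hF₃ (by decide) (by decide)
  have hs₄ := exec_fill (a := aLive) (v := rV) (e := const 1) (σ := σ₃) (by decide) (fun _ => 1)
    (fun _ _ _ _ _ _ => rfl)
  rw [hr₃.size] at hs₄
  set σ₄ := (fill aLive rV (const 1)).exec σ₃ with h₄
  have hF₄ : Frame [rV] [aLive] σ₃ σ₄ := frame_of (by decide) (by decide) σ₃
  have hr₄ := hr₃.of_frame hF₄ (by decide) (by decide)
  have hG₄ : IsGraph n (σ₄.arr aE) (σ₄.arr aLive) H (Finset.range n) := by
    refine ⟨?_, fun v hv => ?_, hT, fun v hv => Finset.mem_range.1 hv⟩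
    · rw [hF₄.arr (by decide)]
      exact hs₃
    · simp [hs₄ v, hv]
  obtain ⟨hS, hX, hY⟩ := exec_whole hr₄.size
  set σ₅ := whole.exec σ₄ with h₅
  have hF₅ : Frame [rV] [aS, aX, aY] σ₄ σ₅ := frame_of (by decide) (by decide) σ₄
  have hr₅ := hr₄.of_frame hF₅ (by decide) (by decide)
  have hG₅ : IsGraph n (σ₅.arr aE) (σ₅.arr aLive) H (Finset.range n) := by
    rwa [hF₅.arr (by decide), hF₅.arr (by decide)]
  have hM := exec_buildM (X := Finset.range n) (Y := fun _ => False) hr₅ hG₅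
    (fun v hv => by rw [hS v hv]; exact hG₄.set v hv) (fun v hv => by simp [hY v hv])
    (whole_peel hT hG₄.lt hX)
  have hF₆ : Frame [rU, rV] [aM, aW] σ₅ (init.exec σ) := frame_of (by decide) (by decide) σ₅
  refine ⟨hr₅.of_frame hF₆ (by decide) (by decide), ?_, hM⟩
  rwa [hF₆.arr (by decide), hF₆.arr (by decide)]

/-- Copy the colouring to the output. -/
def copyOut : Cmd := fill aOut rV (.read aC (reg rV))

theorem exec_copyOut {n k : ℕ} {σ : State} {H : SimpleGraph ℕ} {A : Finset ℕ} (hn : σ.reg 0 = n)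
    (hT : ∀ {u v}, H.Adj u v → u ∈ A) (hlt : ∀ v ∈ A, v < n) (hC : IsCol H A k (σ.arr aC)) :
    IsCol H A k ((copyOut.exec σ).arr aOut) := by
  have hs := exec_fill (a := aOut) (v := rV) (e := .read aC (reg rV)) (σ := σ) (by decide)
    (fun v => σ.arr aC v) (fun i hi τ hF h1 _ => by simp [eval, h1, hF.arr])
  have hs' : ∀ v ∈ A, (copyOut.exec σ).arr aOut v = σ.arr aC v := fun v hv =>
    (hs v).trans (if_pos (hn ▸ hlt v hv))
  refine ⟨fun u v huv => ?_, fun v hv => ?_⟩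
  · rw [hs' u (hT huv), hs' v (hT huv.symm)]
    exact hC.proper u v huv
  · rw [hs' v hv]
    exact hC.range v hv

/-- The colouring algorithm: colourings with two colours are tried first, then wheels are treated
separately, and otherwise parts of the graph are peeled off round by round. -/
def main : Cmd :=
  .seq init <| .seq colourTwo <| .ite (reg rFound) copyOut <| .seq dominate <|
  .ite (reg rA) (.seq colourThree <| .ite (reg rFound) copyOut <| .seq colourFour copyOut)
    (.seq (.set rMax (const 3)) <| .seq (.forN rLev level) unwind)

end RAM

namespace SimpleGraph

/-- A wheel has a colouring with four colours of which two are used only once. -/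
theorem Tight.exists_parity {n : ℕ} {H : SimpleGraph ℕ} {A : Finset ℕ} (hT : Tight H A)
    (hlt : ∀ v ∈ A, v < n) {h : ℕ} (hh : h ∈ A) (hdom : ∀ v ∈ A, v ≠ h → H.Adj h v) :
    ∃ h < n, ∃ z < n, ∃ t < n, RAM.Parity H A 4 h z t := by
  obtain ⟨m, w, hm, h1, h2, h3, h4⟩ := hT.exists_cycle hh hdom
  have hz := h1 (m - 1) (by omega)
  have ht := h1 0 (by omega)
  choose! i hi using h3
  refine ⟨h, hlt h hh, w (m - 1), hlt _ hz.1, w 0, hlt _ ht.1, by omega, fun _ => by omega,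
    fun _ => le_rfl, ht.1, ht.2, fun h5 => ?_, fun v => (i v % 2 == 0), ?_⟩
  · have := h2 0 (by omega) (m - 1) (by omega) h5
    omega
  · intro u v huv huh huz hvh hvz
    obtain ⟨hiu, hu⟩ := hi u (hT.mem huv) huh
    obtain ⟨hiv, hv⟩ := hi v (hT.mem huv.symm) hvh
    have h5 : i u ≠ m - 1 := fun h => huz (by rw [← hu, h])
    have h6 : i v ≠ m - 1 := fun h => hvz (by rw [← hv, h])
    have h7 := (h4 _ hiu _ hiv).1 (by rwa [hu, hv])
    simp only [ne_eq, Bool.beq_eq_decide_eq, decide_eq_decide]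
    omega

/-- In a wheel, a `3`-colouring uses only two colours on the rim. -/
theorem IsCol.bipartite_rim {H : SimpleGraph ℕ} {A : Finset ℕ} {f : ℕ → ℕ} (hf : IsCol H A 3 f)
    (hmem : ∀ {u v}, H.Adj u v → u ∈ A) {h : ℕ} (hdom : ∀ v ∈ A, v ≠ h → H.Adj h v) :
    ∃ g : ℕ → Bool, ∀ u v, H.Adj u v → u ≠ h → v ≠ h → g u ≠ g v := by
  refine ⟨fun v => (f v == if f h = 1 then 2 else 1), fun u v huv hu hv => ?_⟩
  have h1 := hf.range u (hmem huv)
  have h2 := hf.range v (hmem huv.symm)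
  have h3 := hf.proper u v huv
  have h4 := hf.proper h u (hdom u (hmem huv) hu)
  have h5 := hf.proper h v (hdom v (hmem huv.symm) hv)
  have h6 := hf.range h (hmem (hdom u (hmem huv) hu))
  simp only [ne_eq, Bool.beq_eq_decide_eq, decide_eq_decide]
  split_ifs <;> omega

end SimpleGraph

namespace RAM
open Cmd RAM.Expr SimpleGraph

/-- The colouring algorithm is correct. As a `2`-colouring is found if there is one, a
`3`-colouring is optimal otherwise; a fourth colour is used only for wheels without `3`-colouring.
-/
theorem exec_main {n : ℕ} {σ : State} {H : SimpleGraph ℕ} (hn : σ.reg 0 = n)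
    (hH : IsMat n (σ.arr aIn) H) (hT : Tight H (Finset.range n)) :
    ∃ k, IsCol H (Finset.range n) k ((main.exec σ).arr aOut) ∧
      (∀ j f, IsCol H (Finset.range n) j f → k ≤ j) ∧
      (k ≤ 3 ∨ ∃ h < n, ∀ v < n, v ≠ h → H.Adj h v) := by
  have h4n : 4 ≤ n := by simpa using hT.card
  have hlt : ∀ v ∈ Finset.range n, v < n := fun v hv => Finset.mem_range.1 hv
  obtain ⟨hr₁, hG₁, hM₁⟩ := exec_init hn hH hT.mem
  set σ₁ := init.exec σ with h₁
  have htwo := exec_colourTwo hr₁ hM₁ hT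
  set σ₂ := colourTwo.exec σ₁ with h₂
  have hF₂ : Frame [rFound, rMax, rH, rZ, rT, rU, rV, rK, rA, rB, rBad] [aB, aD, aC, aP] σ₁ σ₂ :=
    frame_of (by decide) (by decide) σ₁
  have hr₂ := hr₁.of_frame hF₂ (by decide) (by decide)
  -- a colouring with `j` colours can be read as a colouring with `k` colours for `j ≤ k`
  have hmono : ∀ {j k f}, IsCol H (Finset.range n) j f → j ≤ k → IsCol H (Finset.range n) k f :=
    fun h hjk => ⟨h.proper, fun v hv => ⟨(h.range v hv).1, (h.range v hv).2.trans hjk⟩⟩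
  have hex : main.exec σ = (Cmd.ite (reg rFound) copyOut <| .seq dominate <|
      .ite (reg rA) (.seq colourThree <| .ite (reg rFound) copyOut <| .seq colourFour copyOut)
      (.seq (.set rMax (const 3)) <| .seq (.forN rLev level) unwind)).exec σ₂ := rfl
  rw [hex]
  rcases htwo with hC | ⟨hf, hno⟩
  · rw [exec, if_pos (by simpa [eval] using hC.1)]
    refine ⟨2, exec_copyOut hr₂.size hT.mem hlt hC.2, fun j f hf => ?_, Or.inl (by omega)⟩
    have h3 := hT.three_le_degIn (v := 0) (by simp; omega)
    classical
    obtain ⟨v, hv⟩ : ((Finset.range n).filter (H.Adj 0)).Nonempty := by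
      refine Finset.card_pos.1 (lt_of_lt_of_le (by omega) (h3.trans (le_of_eq ?_)))
      unfold degIn
      congr
    have hadj := (Finset.mem_filter.1 hv).2
    have e1 := hf.proper _ _ hadj
    have e2 := hf.range _ (hT.mem hadj)
    have e3 := hf.range _ (hT.mem hadj.symm)
    omega
  have h3j : ∀ j f, IsCol H (Finset.range n) j f → 3 ≤ j := by
    intro j f hf
    by_contra hj
    have hf2 := hmono hf (show j ≤ 2 by omega)
    refine hno ⟨0, by omega, le_rfl, fun h => absurd h (by simp), fun h => absurd h (by simp),
      by simp; omega, by omega, by omega, fun v => (f v == 1), fun u v huv _ _ _ _ => ?_⟩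
    have e1 := hf2.proper _ _ huv
    have e2 := hf2.range _ (hT.mem huv)
    have e3 := hf2.range _ (hT.mem huv.symm)
    simp only [ne_eq, Bool.beq_eq_decide_eq, decide_eq_decide]
    omega
  rw [exec, if_neg (by simpa [eval] using hf)]
  have hdom := exec_dominate (H := H) hr₂ (by rw [hF₂.arr (by decide)]; exact hG₁.mat)
  rw [exec]
  set σ₃ := dominate.exec σ₂ with h₃
  have hF₃ : Frame [rFound, rMax, rH, rZ, rT, rU, rV, rK, rA, rB, rBad] [aB, aD, aC, aP] σ₁ σ₃ :=
    hF₂.trans (frame_of (by decide) (by decide) σ₂)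
  have hr₃ := hr₁.of_frame hF₃ (by decide) (by decide)
  by_cases hA : σ₃.reg rA = 0
  · rw [exec, if_neg (by simpa [eval] using hA)]
    set σ₄ := (Cmd.set rMax (const 3)).exec σ₃ with h₄
    have hF₄ : Frame [rFound, rMax, rH, rZ, rT, rU, rV, rK, rA, rB, rBad] [aB, aD, aC, aP] σ₁ σ₄ :=
      hF₃.trans (frame_of (by decide) (by decide) σ₃)
    have hr₄ := hr₁.of_frame hF₄ (by decide) (by decide)
    have hgood : Good H (Finset.range n) := by
      refine Or.inr ⟨hT, fun h hh => ?_⟩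
      by_contra! hd
      exact hdom.2 ⟨h, hlt h hh, fun v hv hvh => hd v (Finset.mem_range.2 hv) hvh⟩ hA
    obtain ⟨H', hch, hH'⟩ := exec_levels hr₄ rfl
      (by rw [hF₄.arr (by decide), hF₄.arr (by decide)]; exact hG₁) hgood
    refine ⟨3, ?_, h3j, Or.inl le_rfl⟩
    have hr₅ : Rows n ((Cmd.forN rLev level).exec σ₄) :=
      hr₄.of_frame (Cmd.frame (Cmd.forN rLev level) σ₄) (by decide) (by decide)
    exact exec_unwind hr₅ h4n hch hH'
  · rw [exec, if_pos (by simpa [eval] using hA), exec]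
    have hdom' := hdom.1 hA
    obtain ⟨h, hh, hadj⟩ := hdom'
    have hadj' : ∀ v ∈ Finset.range n, v ≠ h → H.Adj h v := fun v hv => hadj v (hlt v hv)
    have hhA : h ∈ Finset.range n := Finset.mem_range.2 hh
    have hM₃ : IsGraph n (σ₃.arr aM) (σ₃.arr aW) H (Finset.range n) := by
      rw [hF₃.arr (by decide), hF₃.arr (by decide)]
      exact hM₁
    have hthree := exec_colourThree hr₃ hM₃ hT
    set σ₄ := colourThree.exec σ₃ with h₄
    have hF₄ : Frame [rFound, rMax, rH, rZ, rT, rU, rV, rK, rA, rB, rBad] [aB, aD, aC, aP] σ₁ σ₄ :=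
      hF₃.trans (frame_of (by decide) (by decide) σ₃)
    have hr₄ := hr₁.of_frame hF₄ (by decide) (by decide)
    rcases hthree with hC | ⟨hf3, hno3⟩
    · rw [exec, if_pos (by simpa [eval] using hC.1)]
      exact ⟨3, exec_copyOut hr₄.size hT.mem hlt hC.2, h3j, Or.inl le_rfl⟩
    · rw [exec, if_neg (by simpa [eval] using hf3), exec]
      have hM₄ : IsGraph n (σ₄.arr aM) (σ₄.arr aW) H (Finset.range n) := by
        rw [hF₄.arr (by decide), hF₄.arr (by decide)]
        exact hM₁
      have hC := exec_colourFour hr₄ hM₄ hT (hT.exists_parity hlt hhA hadj')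
      have hr₅ : Rows n (colourFour.exec σ₄) :=
        hr₄.of_frame (Cmd.frame colourFour σ₄) (by decide) (by decide)
      refine ⟨4, exec_copyOut hr₅.size hT.mem hlt hC.2, fun j f hf => ?_, Or.inr ⟨h, hh, hadj⟩⟩
      by_contra hj
      obtain ⟨g, hg⟩ := (hmono hf (show j ≤ 3 by omega)).bipartite_rim hT.mem hadj'
      obtain ⟨t, ht, hth⟩ : ∃ t < n, t ≠ h := by
        by_cases h0 : h = 0
        · exact ⟨1, by omega, by omega⟩
        · exact ⟨0, by omega, fun h => h0 h.symm⟩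
      exact hno3 ⟨h, hh, t, ht, by omega, fun _ => le_rfl, fun h => absurd h (by simp),
        Finset.mem_range.2 ht, hth, by omega, g, fun u v huv huh _ hvh _ => hg u v huv huh hvh⟩

end RAM

/-! ### Colourings of 3-connected graphs with maximal local connectivity 3 -/

namespace RAM
open SimpleGraph

theorem isMat_input {n : ℕ} (G : SimpleGraph (Fin n)) :
    IsMat n ((input G).arr 0) (G.map Fin.valEmbedding) := by
  classical
  intro u hu v hv
  rw [map_adj]
  simp only [input, true_and, ne_eq, ite_eq_right_iff, one_ne_zero, imp_false, not_not]
  constructor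
  · rintro ⟨i, j, hk, hij⟩
    obtain ⟨h1, h2⟩ := index_inj hv j.isLt hk
    exact ⟨i, j, hij, h1.symm, h2.symm⟩
  · rintro ⟨i, j, hij, h1, h2⟩
    exact ⟨i, j, by rw [← h1, ← h2]; rfl, hij⟩

/-- The program `main` finds an optimal colouring, and it uses a fourth colour only if there is a
vertex that is adjacent to all others. -/
theorem main_optimal {V : Type*} [Finite V] {G : SimpleGraph V} (h3 : G.IsKConnected 3)
    (hm : G.HasMaximalLocalConnectivity 3) {n : ℕ} (e : V ≃ Fin n) :
    ∃ k, (∀ u v, G.Adj u v → output n (main.exec (input (G.map e.toEmbedding))) (e u) ≠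
        output n (main.exec (input (G.map e.toEmbedding))) (e v)) ∧
      (∀ v, 1 ≤ output n (main.exec (input (G.map e.toEmbedding))) (e v) ∧
        output n (main.exec (input (G.map e.toEmbedding))) (e v) ≤ k) ∧
      (∀ j, G.Colorable j → k ≤ j) ∧ (k ≤ 3 ∨ ∃ h, ∀ v, v ≠ h → G.Adj h v) := by
  classical
  have := Fintype.ofFinite V
  set f : V ↪ ℕ := e.toEmbedding.trans Fin.valEmbedding with hf
  have hT := tight_map h3 hm f
  have hrange : Finset.univ.map f = Finset.range n := by
    ext x
    simp only [Finset.mem_map, Finset.mem_univ, true_and, Finset.mem_range]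
    exact ⟨fun ⟨v, hv⟩ => hv ▸ (e v).isLt, fun hx => ⟨e.symm ⟨x, hx⟩, by simp [hf]⟩⟩
  rw [hrange] at hT
  have hmat := isMat_input (G.map e.toEmbedding)
  rw [SimpleGraph.map_map, show ⇑Fin.valEmbedding ∘ ⇑e.toEmbedding = ⇑f from rfl] at hmat
  obtain ⟨k, hcol, hmin, hk⟩ := exec_main (by simp [input]) hmat hT
  refine ⟨k, fun u v huv => hcol.proper _ _ ((map_adj_apply (f := f)).2 huv),
    fun v => hcol.range _ (Finset.mem_range.2 (e v).isLt), fun j hj => ?_, hk.imp_right ?_⟩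
  · obtain ⟨c⟩ := hj
    refine hmin j (fun x => if h : x < n then (c (e.symm ⟨x, h⟩)).val + 1 else 0) ⟨?_, ?_⟩
    · intro u v huv
      obtain ⟨a, b, hab, rfl, rfl⟩ := (map_adj ..).1 huv
      have := c.valid hab
      simpa [hf, Fin.val_inj] using this
    · intro v hv
      have hv' := Finset.mem_range.1 hv
      simp only [hv', dif_pos]
      exact ⟨by omega, (c (e.symm ⟨v, hv'⟩)).isLt⟩
  · rintro ⟨h, hh, hadj⟩
    refine ⟨e.symm ⟨h, hh⟩, fun v hv => ?_⟩
    have h1 := hadj (f v) (e v).isLt (fun heq => hv (by rw [Equiv.eq_symm_apply]; exact Fin.ext heq))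
    rw [← map_adj_apply (f := f)]
    simpa [hf] using h1

end RAM

namespace SimpleGraph

/-- Three colours on a wheel leave two for its rim. -/
theorem IsOddWheel.not_colorable {V : Type*} {G : SimpleGraph V} (h : G.IsOddWheel) :
    ¬ G.Colorable 3 := by
  rintro ⟨c⟩
  obtain ⟨n, hn, hodd, hub, ⟨e⟩, hadj⟩ := h
  have key : ∀ v : {v : V | v ≠ hub}, c v.1 ≠ c hub := fun v => (c.valid (hadj v.1 v.2)).symm
  have hcol : (G.induce {v : V | v ≠ hub}).Colorable 2 := by
    have hc : (G.induce {v : V | v ≠ hub}).Coloring {x : Fin 3 // x ≠ c hub} :=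
      Coloring.mk (fun v => ⟨c v.1, key v⟩)
        fun {u v} huv heq => c.valid huv (congrArg Subtype.val heq)
    simpa [Fintype.card_subtype_compl] using hc.colorable
  have h2 : (cycleGraph n).Colorable 2 := hcol.of_hom e.symm.toHom
  have h3 := chromaticNumber_cycleGraph_of_odd n (by omega) hodd
  rw [← chromaticNumber_le_iff_colorable, h3] at h2
  norm_num at h2

/-- A graph with a vertex that is adjacent to all others is a wheel, hence it is 3-colourable or an
odd wheel. -/
theorem colorable_or_isOddWheel {V : Type*} [Finite V] {G : SimpleGraph V}
    (h3 : G.IsKConnected 3) (hm : G.HasMaximalLocalConnectivity 3) {h : V}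
    (hadj : ∀ v, v ≠ h → G.Adj h v) : G.Colorable 3 ∨ G.IsOddWheel := by
  classical
  have := Fintype.ofFinite V
  have hT := tight_map h3 hm (Function.Embedding.refl V)
  rw [show G.map (Function.Embedding.refl V) = G by ext; simp [map_adj]] at hT
  obtain ⟨m, w, hm3, hwA, hinj, hsurj, hww⟩ :=
    hT.exists_cycle (h := h) (by simp) fun v _ hv => hadj v hv
  have hsurj' : ∀ v, v ≠ h → ∃ i < m, w i = v := fun v hv => hsurj v (by simp) hv
  rcases Nat.even_or_odd m with he | ho
  · left
    choose! ι hι using hsurj'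
    refine ⟨Coloring.mk (fun v => if v = h then (2 : Fin 3) else if ι v % 2 = 0 then 0 else 1) ?_⟩
    intro u v huv
    by_cases hu : u = h
    · have hv : v ≠ h := fun hv => huv.ne (hu.trans hv.symm)
      simp only [hu, hv, if_true, if_false]
      split_ifs <;> decide
    · by_cases hv : v = h
      · simp only [hu, hv, if_true, if_false]
        split_ifs <;> decide
      · obtain ⟨hiu, hwu⟩ := hι u hu
        obtain ⟨hiv, hwv⟩ := hι v hv
        rw [← hwu, ← hwv] at huv
        have h1 := (hww _ hiu _ hiv).1 huv
        obtain ⟨r, hr⟩ := he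
        simp only [hu, hv, if_false]
        rcases Nat.mod_two_eq_zero_or_one (ι u) with a | a <;>
          rcases Nat.mod_two_eq_zero_or_one (ι v) with b | b <;> simp [a, b] <;> omega
  · right
    refine ⟨m, hm3, ho, h, ⟨RelIso.symm ⟨Equiv.ofBijective
      (fun i : Fin m => (⟨w i, (hwA i i.isLt).2⟩ : {v : V | v ≠ h})) ⟨?_, ?_⟩, ?_⟩⟩, hadj⟩
    · intro i j hij
      exact Fin.ext (hinj i i.isLt j j.isLt (congrArg Subtype.val hij))
    · rintro ⟨v, hv⟩
      obtain ⟨i, hi, rfl⟩ := hsurj' v hv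
      exact ⟨⟨i, hi⟩, rfl⟩
    · intro i j
      rw [cycleGraph_adj']
      simp only [comap_adj, Function.Embedding.subtype_apply]
      refine (hww i i.isLt j j.isLt).trans ?_
      have hi := i.isLt
      have hj := j.isLt
      rw [Fin.val_sub, Fin.val_sub]
      have hmod : ∀ x < m, ∀ y < m, (m - y + x) % m = if y ≤ x then x - y else m - y + x := by
        intro x hx y hy
        split_ifs with hxy
        · rw [show m - y + x = (x - y) + m by omega, Nat.add_mod_right, Nat.mod_eq_of_lt (by omega)]
        · exact Nat.mod_eq_of_lt (by omega)
      rw [hmod _ hi _ hj, hmod _ hj _ hi]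
      split_ifs <;> omega

end SimpleGraph

theorem theorem3 :
    (∀ (V : Type*) [Finite V] (G : SimpleGraph V),
      G.IsKConnected 3 → G.HasMaximalLocalConnectivity 3 →
        (G.Colorable 3 ↔ ¬ G.IsOddWheel)) ∧
    (∃ P : RAM.Prog, RAM.FindsOptimalColouringInPolyTime P
      (fun _ G => G.IsKConnected 3 ∧ G.HasMaximalLocalConnectivity 3)) := by
  refine ⟨fun V _ G h3 hm => ⟨fun hc hw => hw.not_colorable hc, fun hw => ?_⟩,
    RAM.main.compile, RAM.main.time, fun n G ⟨h3, hm⟩ => ?_⟩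
  · obtain ⟨k, hproper, hrange, -, hk⟩ := RAM.main_optimal h3 hm (Finite.equivFin V)
    rcases hk with hk | ⟨h, hadj⟩
    · generalize RAM.output _ _ = φ at hproper hrange
      refine ⟨SimpleGraph.Coloring.mk
        (fun v => (⟨φ (Finite.equivFin V v) - 1, by have := hrange v; omega⟩ : Fin 3)) ?_⟩
      intro u v huv heq
      have h1 := hproper u v huv
      have h2 := hrange u
      have h4 := hrange v
      have h5 := congrArg Fin.val heq
      simp only at h5
      omega
    · exact (SimpleGraph.colorable_or_isOddWheel h3 hm hadj).resolve_right hw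
  · obtain ⟨t, ht, hrun⟩ := RAM.Cmd.runs_compile (by decide : RAM.main.WF = true) (RAM.input G)
    refine ⟨t, _, hrun, ht, ?_⟩
    obtain ⟨k, hproper, hrange, hmin, -⟩ := RAM.main_optimal h3 hm (Equiv.refl (Fin n))
    rw [show G.map (Equiv.refl (Fin n)).toEmbedding = G by ext; simp [SimpleGraph.map_adj]] at *
    refine ⟨hproper, fun v => ⟨(hrange v).1, ?_⟩⟩
    exact (Nat.cast_le.2 (hrange v).2).trans (SimpleGraph.le_chromaticNumber_iff_colorable.2 hmin)
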